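/- **Setting.** A convex polygon has $n\ge 3$ vertices in strictly convex position. A terrain is a closed set $T=P_0\setminus(P_1\cup\dots\cup P_k)$, $k\ge 0$, where $P_0$ is a closed convex polygon in the plane and the obstacles $P_1,\dots,P_k$ are pairwise disjoint open convex polygons contained in the interior of $P_0$. For a constant $c>1$, a polygon is $c$-fat if the ratio of the radius of the smallest disc containing it to the radius of the largest disc contained in it is at most $c$; the terrain is regular (for $c$) if all obstacles are $c$-fat. An instance is $(T,p,q)$ with a regular terrain $T$, an initial position $p\in T$ of the agent, and the location $q$ of the treasure, an interior point of $T$. Let $L=L(T,p,q)$ be the length of the shortest path in $T$ from $p$ to $q$, and let $\lambda=\lambda(T,q)=\min(1,\rho)$ (the accessibility), where $\rho$ is the largest radius of a disc centered at $q$ and contained in $T$. The agent, at a point $x$, sees a point $z$ if the segment $xz$ is contained in $T$ and has length at most $1$. It does not know $T$, $p$ or $q$. It has a compass and a unit of length, and it always knows its displacement from $p$, the set of points it sees at the end of each move, the distance travelled in the last move and whether this move was stopped. Its moves are: *free moves* (go along a chosen vector; the move is stopped when it would leave $T$, and the agent is aware of it), and, when it has hit the boundary of one of the polygons $P_i$,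 *boundary moves* (follow the boundary of this polygon in one of the two directions for a chosen distance, or until reaching a point with a chosen property of what the agent perceives there). Before the start the agent receives a binary string, the *advice*, chosen by an oracle that knows $(T,p,q)$; its size is its length. An algorithm determines each move from the advice and the observations made so far. Its cost is the length of the trajectory of the agent from $p$ until it first sees $q$. An algorithm is *computable* if it is controlled by a Turing machine: a computable function of the advice and of the bits telling which of the previous moves were stopped determines a symbolic instruction with rational data, of the form "go straight to the point $p+(u,v)$" or "follow the boundary in a given direction for distance $d$ or until reaching the line through $p$ with direction $(u,v)$". **Corollary 2.1.** For every constant $c>1$, the optimal size of advice sufficient to accomplish treasure hunt at cost $O(L)$ in the class of all regular terrains is $\Theta(\log(L/\lambda))$, for $L$ large and uniformly in $\lambda\in(0,1]$. Precisely: 1. There are a computable algorithm $\mathcal A$ and constants $C,K$ (depending only on $c$) such that for every instance $(T,p,q)$, with $L'=\max(L,2)$, there is an advice string of size at most $K\log_2(L'/\lambda)$ with which $\mathcal A$ sees the treasure at cost at most $C L'$. In particular, for $L\ge 2$ the size is at most $K\log_2(L/\lambda)$ and the cost is at most $CL$. 2. There is a constant $\kappa>0$ (depending only on $c$) such that for every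 $C$ there is $\ell_0$ with the following property. For all reals $\ell\ge\ell_0$ and $\lambda\in(0,1]$ there are a regular terrain $T$ and an initial position $p\in T$ such that for every algorithm $\mathcal A$ (computable or not) there is a location $q$ of the treasure in the interior of $T$ with accessibility exactly $\lambda$ and with $\ell\le L\le 2\ell$, where $L=L(T,p,q)$, for which every advice string with which $\mathcal A$ sees the treasure at cost at most $CL$ has size at least $\kappa\log_2(L/\lambda)$. -/

import Mathlib

open scoped Topology

noncomputable section

/-! The Euclidean plane is identified with `ℂ`: East is `1`, North is `Complex.I`. -/

/-- The signed area `u × v`; it is positive iff `v` points to the left of `u`. -/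
def cross (u v : ℂ) : ℝ := u.re * v.im - u.im * v.re

/-! ### Convex polygons -/

/-- A convex polygon, given by its `n ≥ 3` vertices in counterclockwise cyclic order: every vertex
other than the two ends of an edge lies strictly to the left of this (oriented) edge. -/
structure ConvexPolygon where
  n : ℕ
  three_le : 3 ≤ n
  vertex : ZMod n → ℂ
  ccw : ∀ i j : ZMod n, j ≠ i → j ≠ i + 1 →
    0 < cross (vertex (i + 1) - vertex i) (vertex j - vertex i)

namespace ConvexPolygon

/-- The closed polygon: the points that are on the left of, or on, every edge line. -/
def region (P : ConvexPolygon) : Set ℂ :=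
  {x | ∀ i, 0 ≤ cross (P.vertex (i + 1) - P.vertex i) (x - P.vertex i)}

/-- The open polygon (without its boundary). -/
def inner (P : ConvexPolygon) : Set ℂ :=
  {x | ∀ i, 0 < cross (P.vertex (i + 1) - P.vertex i) (x - P.vertex i)}

/-- `c`-fatness: (radius of the smallest disc containing the polygon) / (radius of the largest disc
contained in it) is at most `c`.  As both extremal discs exist, this says that some disc contained
in the polygon and some disc containing it have radii with ratio at most `c`. -/
def IsFat (c : ℝ) (P : ConvexPolygon) : Prop :=
  ∃ (a b : ℂ) (r R : ℝ), 0 < r ∧ Metric.closedBall a r ⊆ P.region ∧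
    P.region ⊆ Metric.closedBall b R ∧ R ≤ c * r

/-- `β` is a (periodic) parametrization of the perimeter of `P` by arc length, counterclockwise:
`β` is at the vertex number `k` (modulo `n`) at time `a k`, and it traverses the edge from this
vertex to the next one at unit speed. It is unique up to a shift of time. -/
def IsBoundaryParam (P : ConvexPolygon) (β : ℝ → ℂ) : Prop :=
  ∃ a : ℤ → ℝ,
    (∀ k : ℤ, a (k + 1) = a k + dist (P.vertex (k : ZMod P.n)) (P.vertex ((k : ZMod P.n) + 1))) ∧
    ∀ (k : ℤ) (t : ℝ), a k ≤ t → t ≤ a (k + 1) →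
      β t = P.vertex (k : ZMod P.n) +
        ((t - a k) / dist (P.vertex (k : ZMod P.n)) (P.vertex ((k : ZMod P.n) + 1))) •
          (P.vertex ((k : ZMod P.n) + 1) - P.vertex (k : ZMod P.n))

end ConvexPolygon

/-! ### Terrains -/

/-- A convex polygon with finitely many pairwise disjoint (open) convex polygonal obstacles in its
interior. -/
structure Terrain where
  outer : ConvexPolygon
  k : ℕ
  obstacle : Fin k → ConvexPolygon
  obstacle_subset : ∀ i, (obstacle i).inner ⊆ outer.inner
  obstacle_disjoint : ∀ i j, i ≠ j → Disjoint (obstacle i).inner (obstacle j).inner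

namespace Terrain

/-- The terrain as a closed set: the closed outer polygon minus the open obstacles. -/
def carrier (T : Terrain) : Set ℂ := T.outer.region \ ⋃ i, (T.obstacle i).inner

/-- Regular terrains, for the fatness constant `c`. -/
def IsRegular (c : ℝ) (T : Terrain) : Prop := ∀ i, (T.obstacle i).IsFat c

/-- From `x` one sees `z`: the segment `xz` is contained in the terrain and has length at most 1. -/
def Sees (T : Terrain) (x z : ℂ) : Prop := segment ℝ x z ⊆ T.carrier ∧ dist x z ≤ 1

/-- The accessibility `min (1, ρ)`, where `ρ` is the largest radius of a disc with center `q`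
contained in the terrain. -/
def accessibility (T : Terrain) (q : ℂ) : ℝ :=
  sSup {r : ℝ | 0 ≤ r ∧ r ≤ 1 ∧ Metric.closedBall q r ⊆ T.carrier}

/-- The polygonal line through `x` and then the listed points has length `ℓ`, is contained in the
terrain, and ends at `q`. -/
def IsPolyline (T : Terrain) (q : ℂ) : ℂ → List ℂ → ℝ → Prop
  | x, [], ℓ => x = q ∧ ℓ = 0
  | x, y :: l, ℓ => segment ℝ x y ⊆ T.carrier ∧ IsPolyline T q y l (ℓ - dist x y)

/-- The length of the shortest path in the terrain from `p` to `q` (in a terrain with polygonal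
boundary, shortest paths are polygonal lines). -/
def pathDist (T : Terrain) (p q : ℂ) : ℝ := sInf {ℓ : ℝ | ∃ l, T.IsPolyline q p l ℓ}

/-- How far (as a fraction in `[0, 1]`) the move along the vector `v` from `x` gets before it would
leave the terrain. -/
def reach (T : Terrain) (x v : ℂ) : ℝ :=
  sSup {t : ℝ | 0 ≤ t ∧ t ≤ 1 ∧ segment ℝ x (x + t • v) ⊆ T.carrier}

/-- `P` is the polygon on whose boundary an agent at `x` moving in direction `v` is stopped: the
move would lead into the obstacle `P`, or out of the outer polygon `P`. -/
def Blocks (T : Terrain) (P : ConvexPolygon) (x v : ℂ) : Prop :=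
  (∃ i, P = T.obstacle i ∧ ∀ᶠ ε : ℝ in 𝓝[>] 0, x + ε • v ∈ P.inner) ∨
    (P = T.outer ∧ ∀ᶠ ε : ℝ in 𝓝[>] 0, x + ε • v ∉ P.region)

end Terrain

/-! ### The agent -/

/-- What the agent perceives at a point: its displacement from its initial position, and the set of
points it sees (in coordinates centered at its initial position). -/
structure View where
  offset : ℂ
  visible : Set ℂ

/-- A move of the agent. `free v`: go straight along the vector `v` (that is, in a chosen direction
at a chosen distance), until interrupted by the boundary.  `follow ccw d S`: follow the boundary of
the polygon that was hit, counterclockwise or clockwise around this polygon, until distance `d` is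
travelled or a point with the property `S` is reached. -/
inductive Move where
  | free (v : ℂ)
  | follow (ccw : Bool) (d : ℝ) (S : Set View)

/-- What the agent knows after a move: its view, the distance travelled in the last move, and
whether the last move was interrupted by the boundary (free move) or ended at a point with the
chosen property (boundary move). -/
structure Observation extends View where
  travelled : ℝ
  stopped : Bool

/-- A deterministic algorithm: it maps the advice and the sequence of all observations made so far
(the first one at the initial position) to the next move. It does not know the terrain. -/
def Strategy := List Bool → List Observation → Move

/-- The state of the agent: its position, the polygon whose boundary it has hit and is in contact
with (if any), and the data of the last move. -/
structure State where
  pos : ℂ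
  contact : Option ConvexPolygon
  travelled : ℝ
  stopped : Bool

namespace Terrain

/-- The view at the point `x` of an agent that started at `p`. -/
def view (T : Terrain) (p x : ℂ) : View := ⟨x - p, {w | T.Sees x (p + w)}⟩

/-- The observation made in a state. The treasure is not part of it, as the search ends when the
treasure is seen. -/
def observe (T : Terrain) (p : ℂ) (σ : State) : Observation :=
  { T.view p σ.pos with travelled := σ.travelled, stopped := σ.stopped }

/-- A boundary move on `P` from `σ` to `σ'` along `γ`. -/
def FollowStep (T : Terrain) (p : ℂ) (P : ConvexPolygon) (σ : State) (ccw : Bool) (d : ℝ)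
    (S : Set View) (σ' : State) (γ : ℝ → ℂ) : Prop :=
  (∃ β : ℝ → ℂ, P.IsBoundaryParam β ∧ β 0 = σ.pos ∧
    ∀ t, γ t = β (if ccw = true then t else -t)) ∧
  ((σ'.stopped = true ∧ (∃ t, 0 < t ∧ t ≤ d ∧ T.view p (γ t) ∈ S) ∧
      σ'.travelled = sInf {t : ℝ | 0 < t ∧ t ≤ d ∧ T.view p (γ t) ∈ S}) ∨
    (σ'.stopped = false ∧ (¬ ∃ t, 0 < t ∧ t ≤ d ∧ T.view p (γ t) ∈ S) ∧
      σ'.travelled = max d 0)) ∧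
  σ'.pos = γ σ'.travelled ∧ σ'.contact = some P

/-- The execution of one move: the agent goes from the state `σ` to the state `σ'`, and its
trajectory, parametrized by arc length on `[0, σ'.travelled]`, is `γ`. A boundary move of an agent
that is not in contact with the boundary has no effect. -/
def Step (T : Terrain) (p : ℂ) (σ : State) : Move → State → (ℝ → ℂ) → Prop
  | .free v, σ', γ =>
      (∀ t, γ t = σ.pos + (t / ‖v‖) • v) ∧
      σ'.pos = σ.pos + T.reach σ.pos v • v ∧
      σ'.travelled = T.reach σ.pos v * ‖v‖ ∧
      ((T.reach σ.pos v < 1 ∧ σ'.stopped = true ∧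
          ∃ P, σ'.contact = some P ∧ T.Blocks P σ'.pos v) ∨
        (T.reach σ.pos v = 1 ∧ σ'.stopped = false ∧ σ'.contact = none))
  | .follow ccw d S, σ', γ =>
      (∃ P, σ.contact = some P ∧ T.FollowStep p P σ ccw d S σ' γ) ∨
      (σ.contact = none ∧ σ' = ⟨σ.pos, none, 0, false⟩ ∧ ∀ t, γ t = σ.pos)

/-- `σ` and `γ` are the states and the trajectories of the successive moves of an agent that starts
at `p` and executes `A` with the advice `s`. -/
def IsRun (T : Terrain) (p : ℂ) (A : Strategy) (s : List Bool) (σ : ℕ → State)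
    (γ : ℕ → ℝ → ℂ) : Prop :=
  σ 0 = ⟨p, none, 0, false⟩ ∧
  ∀ n, T.Step p (σ n) (A s ((List.range (n + 1)).map fun m => T.observe p (σ m))) (σ (n + 1)) (γ n)

/-- With the advice `s`, the agent that starts at `p` and executes `A` sees the treasure `q` at cost
at most `B`: the length of its trajectory until it sees `q` is at most `B`. -/
def Finds (T : Terrain) (p q : ℂ) (A : Strategy) (s : List Bool) (B : ℝ) : Prop :=
  ∃ (σ : ℕ → State) (γ : ℕ → ℝ → ℂ), T.IsRun p A s σ γ ∧
    ∃ (n : ℕ) (t : ℝ), 0 ≤ t ∧ t ≤ (σ (n + 1)).travelled ∧ T.Sees (γ n t) q ∧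
      (∑ m ∈ Finset.range n, (σ (m + 1)).travelled) + t ≤ B

end Terrain

/-! ### Algorithms controlled by a Turing machine -/

/-- An integer `e.2 - e.1`, given by two natural numbers. -/
def pairInt (e : ℕ × ℕ) : ℤ := (e.2 : ℤ) - (e.1 : ℤ)

/-- Symbolic instructions with rational data. `Sum.inl (a, b, m)`: go straight to the point
`(a + b i) / (m + 1)` (in coordinates centered at the initial position).
`Sum.inr (ccw, k, m, a, b)`: follow the boundary for distance `k / (m + 1)` or until the line through
the initial position with direction `a + b i` is reached. -/
abbrev Instruction := ((ℕ × ℕ) × (ℕ × ℕ) × ℕ) ⊕ (Bool × ℕ × ℕ × (ℕ × ℕ) × (ℕ × ℕ))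

/-- The move that an instruction stands for, for an agent whose displacement from its initial
position is `x`. -/
def Instruction.toMove (x : ℂ) : Instruction → Move
  | Sum.inl (a, b, m) =>
      .free (((pairInt a : ℂ) + (pairInt b : ℂ) * Complex.I) / ((m : ℂ) + 1) - x)
  | Sum.inr (ccw, k, m, a, b) =>
      .follow ccw ((k : ℝ) / ((m : ℝ) + 1))
        {V | cross ((pairInt a : ℂ) + (pairInt b : ℂ) * Complex.I) V.offset = 0}

/-- The agent is a Turing machine: a computable function of the advice and of the bits `stopped`
observed so far prints the next instruction. -/
def Strategy.IsComputable (A : Strategy) : Prop :=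
  ∃ f : List Bool → List Bool → Instruction, Computable₂ f ∧
    ∀ (s : List Bool) (h : List Observation) (o : Observation),
      A s (h ++ [o]) = (f s ((h ++ [o]).map Observation.stopped)).toMove o.offset

end

/-!
Upper bound. The advice is the binary code of a point `q'` with rational coordinates (relative to
the initial position `p`) at distance at most half the accessibility from the treasure `q`;
numerator and denominator are polynomial in `L' / λ`, so `O(log (L' / λ))` bits suffice. The agent
walks straight towards `q'`. Whenever an obstacle stops it, it zigzags along the boundary of the
obstacle: it tries a distance `d` counterclockwise and comes back, then `d` clockwise and comes
back, and it doubles `d`, until it reaches the line from `p` to `q'` again. At the `i`-th obstacle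
it starts with `d = 2⁻ⁱ`, so that the cost of starting too high is at most a constant in total, and
otherwise the zigzag costs at most a constant times the shorter of the two boundary arcs between the
points at which the line enters and leaves the obstacle. For a `c`-fat polygon this arc is at most
`17 c²` times as long as the chord (`IsChord.exists_short_arc`): seen from a point deep inside the
polygon on one side of the line, the arc on the other side is projected into the chord, and by
fatness this central projection shortens lengths at most by a factor proportional to `c²`
(`IsChord.arc_length_le`). Since the line leaves an obstacle strictly farther along than it enters
it, induction over the obstacles on the line (`Terrain.line_induction`) bounds the total cost by
`O(L')`. The controller reads only the bits `stopped`, and it is primitive recursive.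

Lower bound. The obstacles of the terrain form a square array of `N²` clusters, `N ≈ ℓ / (100 λ)`. A
cluster has eight regular polygons with so many vertices that they are nearly discs; four of them
are at distance `λ` from the center of the cluster, and all eight together block every ray from the
center within distance `10 λ` (`ClusterArray`). A treasure in the center of a cluster has
accessibility `λ`, it is seen only from within this distance, and the shortest path from `p` to it
has length between `ℓ` and `2 ℓ`. The run with a fixed advice string does not depend on the
location of the treasure and moves at unit speed, hence a string serves at most `O(C ℓ / λ)` of the
`N²` locations, and `Ω(ℓ / λ)` strings are needed. So there are locations all of whose useful
strings have length at least `(1 / 2) log (L / λ)` (`counting_bound`).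
-/

/-! ### Signed area and convex polygons -/

lemma cross_add_right (u v w : ℂ) : cross u (v + w) = cross u v + cross u w := by
  simp [cross]; ring

lemma cross_sub_right (u v w : ℂ) : cross u (v - w) = cross u v - cross u w := by
  simp [cross]; ring

lemma cross_smul_right (u v : ℂ) (t : ℝ) : cross u (t • v) = t * cross u v := by
  simp [cross]; ring

lemma cross_smul_left (u v : ℂ) (t : ℝ) : cross (t • u) v = t * cross u v := by
  simp [cross]; ring

lemma cross_self_eq_zero (u : ℂ) : cross u u = 0 := by
  simp [cross]; ring

lemma cross_zero_right (u : ℂ) : cross u 0 = 0 := by simp [cross]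

lemma cross_zero_left (u : ℂ) : cross 0 u = 0 := by simp [cross]

lemma cross_comm (u v : ℂ) : cross v u = -cross u v := by
  simp [cross]; ring

lemma cross_eq_im (u v : ℂ) : cross u v = ((starRingEnd ℂ) u * v).im := by
  simp [cross]; ring

lemma abs_cross_le (u v : ℂ) : |cross u v| ≤ ‖u‖ * ‖v‖ := by
  rw [cross_eq_im]
  refine (Complex.abs_im_le_norm _).trans ?_
  simp

lemma cross_self_mul_I (u : ℂ) : cross u (Complex.I * u) = ‖u‖ ^ 2 := by
  rw [← Complex.normSq_eq_norm_sq, Complex.normSq_apply]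
  simp [cross]

lemma continuous_cross (u : ℂ) : Continuous fun v => cross u v := by
  unfold cross; fun_prop

/-- A vector parallel to `u ≠ 0` is a real multiple of `u`. -/
lemma exists_eq_smul_of_cross_eq_zero {u v : ℂ} (hu : u ≠ 0) (h : cross u v = 0) :
    ∃ t : ℝ, v = t • u := by
  refine ⟨(v / u).re, ?_⟩
  have him : (v / u).im = 0 := by
    have : v / u = (starRingEnd ℂ u * v) / (Complex.normSq u : ℂ) := by
      have h1 : (Complex.normSq u : ℂ) ≠ 0 := by
        exact_mod_cast (Complex.normSq_pos.2 hu).ne'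
      rw [div_eq_div_iff hu h1, ← Complex.mul_conj]; ring
    rw [this, Complex.div_ofReal_im, ← cross_eq_im, h, zero_div]
  have : v / u = ((v / u).re : ℂ) := by
    apply Complex.ext <;> simp [him]
  rw [Complex.real_smul, ← this, div_mul_cancel₀ _ hu]

namespace ConvexPolygon

variable (P : ConvexPolygon)

instance neZero_n : NeZero P.n := ⟨by have := P.three_le; omega⟩

/-- The edge vector from the vertex `i` to the next one. -/
noncomputable def edge (i : ZMod P.n) : ℂ := P.vertex (i + 1) - P.vertex i

/-- The affine function that vanishes on the edge line number `i` and is positive to its left. -/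
noncomputable def side (i : ZMod P.n) (z : ℂ) : ℝ := cross (P.edge i) (z - P.vertex i)

lemma mem_region {z : ℂ} : z ∈ P.region ↔ ∀ i, 0 ≤ P.side i z := Iff.rfl

lemma mem_inner {z : ℂ} : z ∈ P.inner ↔ ∀ i, 0 < P.side i z := Iff.rfl

lemma side_add_smul (i : ZMod P.n) (z v : ℂ) (t : ℝ) :
    P.side i (z + t • v) = P.side i z + t * cross (P.edge i) v := by
  simp only [side, cross_sub_right, cross_add_right, cross_smul_right]; ring

lemma side_lineMap (i : ZMod P.n) (z w : ℂ) (t : ℝ) :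
    P.side i (z + t • (w - z)) = (1 - t) * P.side i z + t * P.side i w := by
  rw [side_add_smul]; simp only [side, cross_sub_right]; ring

lemma continuous_side (i : ZMod P.n) : Continuous (P.side i) :=
  (continuous_cross _).comp (continuous_id.sub continuous_const)

lemma isClosed_region : IsClosed P.region := by
  have : P.region = ⋂ i, {z | 0 ≤ P.side i z} := by ext z; simp [mem_region]
  rw [this]
  exact isClosed_iInter fun i => isClosed_le continuous_const (P.continuous_side i)

lemma isOpen_inner : IsOpen P.inner := by
  have : P.inner = ⋂ i, {z | 0 < P.side i z} := by ext z; simp [mem_inner]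
  rw [this]
  exact isOpen_iInter_of_finite fun i => isOpen_lt continuous_const (P.continuous_side i)

lemma inner_subset_region : P.inner ⊆ P.region := fun _ h i => (h i).le

lemma lineMap_mem_region {z w : ℂ} (hz : z ∈ P.region) (hw : w ∈ P.region) {t : ℝ} (h0 : 0 ≤ t)
    (h1 : t ≤ 1) : z + t • (w - z) ∈ P.region := by
  intro i
  change 0 ≤ P.side i _
  rw [side_lineMap]
  exact add_nonneg (mul_nonneg (by linarith) (hz i)) (mul_nonneg h0 (hw i))

lemma lineMap_mem_inner {z w : ℂ} (hz : z ∈ P.inner) (hw : w ∈ P.region) {t : ℝ} (h0 : 0 ≤ t)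
    (h1 : t < 1) : z + t • (w - z) ∈ P.inner := by
  intro i
  change 0 < P.side i _
  rw [side_lineMap]
  exact add_pos_of_pos_of_nonneg (mul_pos (by linarith) (hz i)) (mul_nonneg h0 (hw i))

lemma one_ne_zero_zmod : (1 : ZMod P.n) ≠ 0 := by
  have := P.three_le
  have : Fact (1 < P.n) := ⟨by omega⟩
  exact one_ne_zero

lemma two_ne_zero_zmod : (2 : ZMod P.n) ≠ 0 := by
  have := P.three_le
  intro h
  have h2 : ((2 : ℕ) : ZMod P.n) = 0 := by exact_mod_cast h
  rw [ZMod.natCast_eq_zero_iff] at h2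
  have := Nat.le_of_dvd (by norm_num) h2
  omega

lemma add_two_ne (i : ZMod P.n) : i + 2 ≠ i := by
  intro h; exact P.two_ne_zero_zmod (by simpa using h)

lemma add_two_ne_add_one (i : ZMod P.n) : i + 2 ≠ i + 1 := by
  intro h
  apply P.one_ne_zero_zmod
  have : i + 1 + 1 = i + 1 + 0 := by rw [add_assoc, one_add_one_eq_two, h, add_zero]
  exact add_left_cancel this

lemma side_vertex_self (i : ZMod P.n) : P.side i (P.vertex i) = 0 := by
  simp [side, cross_zero_right]

lemma side_vertex_succ (i : ZMod P.n) : P.side i (P.vertex (i + 1)) = 0 := by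
  simp [side, edge, cross_self_eq_zero]

lemma side_vertex_pos {i j : ZMod P.n} (h : j ≠ i) (h' : j ≠ i + 1) : 0 < P.side i (P.vertex j) :=
  P.ccw i j h h'

lemma side_vertex_succ_pos (i : ZMod P.n) : 0 < P.side (i + 1) (P.vertex i) := by
  apply P.side_vertex_pos
  · intro h; exact P.one_ne_zero_zmod (by simpa using h.symm)
  · intro h; rw [add_assoc, one_add_one_eq_two] at h; exact P.add_two_ne i h.symm

lemma side_vertex_add_two_pos (i : ZMod P.n) : 0 < P.side i (P.vertex (i + 1 + 1)) := by
  apply P.side_vertex_pos <;> rw [add_assoc, one_add_one_eq_two]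
  · exact P.add_two_ne i
  · exact P.add_two_ne_add_one i

lemma vertex_mem_region (j : ZMod P.n) : P.vertex j ∈ P.region := by
  intro i
  change 0 ≤ P.side i _
  by_cases h : j = i
  · rw [h, side_vertex_self]
  by_cases h' : j = i + 1
  · rw [h', side_vertex_succ]
  exact (P.side_vertex_pos h h').le

lemma edge_ne_zero (i : ZMod P.n) : P.edge i ≠ 0 := by
  intro h
  have := P.side_vertex_add_two_pos i
  rw [side, h, cross_zero_left] at this
  exact lt_irrefl _ this

lemma edge_norm_pos (i : ZMod P.n) : 0 < ‖P.edge i‖ := norm_pos_iff.2 (P.edge_ne_zero i)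

lemma dist_vertex (i : ZMod P.n) : dist (P.vertex i) (P.vertex (i + 1)) = ‖P.edge i‖ := by
  rw [dist_comm, dist_eq_norm, edge]

/-- The barycenter of the vertices lies in the open polygon. -/
lemma inner_nonempty : P.inner.Nonempty := by
  have hn : (0 : ℝ) < P.n := by have := P.three_le; positivity
  refine ⟨(1 / (P.n : ℝ)) • ∑ j, P.vertex j, fun i => ?_⟩
  change 0 < P.side i _
  have h : P.side i ((1 / (P.n : ℝ)) • ∑ j, P.vertex j)
      = (1 / (P.n : ℝ)) * ∑ j, P.side i (P.vertex j) := by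
    have h1 : ∀ s : Finset (ZMod P.n), ∑ j ∈ s, P.side i (P.vertex j)
        = cross (P.edge i) (∑ j ∈ s, P.vertex j) - s.card * cross (P.edge i) (P.vertex i) := by
      intro s
      induction s using Finset.induction_on with
      | empty => simp [cross_zero_right]
      | insert a s ha ih =>
        rw [Finset.sum_insert ha, Finset.sum_insert ha, ih, Finset.card_insert_of_notMem ha,
          cross_add_right, side, cross_sub_right]
        push_cast; ring
    rw [h1, side, cross_sub_right, cross_smul_right, Finset.card_univ, ZMod.card]
    field_simp
  rw [h]
  refine mul_pos (by positivity) ?_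
  refine Finset.sum_pos' (fun j _ => P.vertex_mem_region j i) ⟨i + 1 + 1, Finset.mem_univ _, ?_⟩
  exact P.side_vertex_add_two_pos i

lemma region_subset_closure_inner : P.region ⊆ closure P.inner := by
  intro z hz
  obtain ⟨w, hw⟩ := P.inner_nonempty
  have hc : Filter.Tendsto (fun t : ℝ => z + t • (w - z)) (𝓝[>] 0) (𝓝 z) := by
    have : Continuous fun t : ℝ => z + t • (w - z) := by fun_prop
    have h := this.tendsto 0
    simp only [zero_smul, add_zero] at h
    exact h.mono_left nhdsWithin_le_nhds
  refine mem_closure_of_tendsto hc ?_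
  filter_upwards [Ioo_mem_nhdsGT (zero_lt_one' ℝ)] with t ht
  have h := P.lineMap_mem_inner hw hz (t := 1 - t) (by linarith [ht.2]) (by linarith [ht.1])
  have e : w + (1 - t) • (z - w) = z + t • (w - z) := by
    simp only [Complex.real_smul, Complex.ofReal_sub, Complex.ofReal_one]; ring
  rwa [e] at h

lemma closure_inner : closure P.inner = P.region :=
  Set.Subset.antisymm (closure_minimal P.inner_subset_region P.isClosed_region)
    P.region_subset_closure_inner

/-- A point of the closed polygon on an edge line lies on the edge. -/
lemma exists_eq_of_side_eq_zero {z : ℂ} (hz : z ∈ P.region) {i : ZMod P.n} (h : P.side i z = 0) :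
    ∃ t : ℝ, 0 ≤ t ∧ t ≤ 1 ∧ z = P.vertex i + t • P.edge i := by
  obtain ⟨t, ht⟩ := exists_eq_smul_of_cross_eq_zero (P.edge_ne_zero i) h
  have hzt : z = P.vertex i + t • P.edge i := by rw [← ht]; ring
  refine ⟨t, ?_, ?_, hzt⟩
  · obtain ⟨j, rfl⟩ : ∃ j, i = j + 1 := ⟨i - 1, by ring⟩
    have h1 := hz j
    change 0 ≤ P.side j z at h1
    rw [hzt, edge, side_lineMap, side_vertex_succ] at h1
    have h2 := P.side_vertex_add_two_pos j
    by_contra hlt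
    push Not at hlt
    nlinarith
  · have h1 := hz (i + 1)
    change 0 ≤ P.side (i + 1) z at h1
    rw [hzt, edge, side_lineMap, side_vertex_self] at h1
    have h2 := P.side_vertex_succ_pos i
    by_contra hlt
    push Not at hlt
    nlinarith

lemma exists_side_eq_zero {z : ℂ} (hz : z ∈ P.region) (hz' : z ∉ P.inner) :
    ∃ i, P.side i z = 0 := by
  simp only [mem_inner, not_forall, not_lt] at hz'
  obtain ⟨i, hi⟩ := hz'
  exact ⟨i, le_antisymm hi (hz i)⟩

lemma edge_point_mem_region (i : ZMod P.n) {t : ℝ} (h0 : 0 ≤ t) (h1 : t ≤ 1) :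
    P.vertex i + t • P.edge i ∈ P.region :=
  P.lineMap_mem_region (P.vertex_mem_region i) (P.vertex_mem_region (i + 1)) h0 h1

lemma side_edge_point (i : ZMod P.n) (t : ℝ) : P.side i (P.vertex i + t • P.edge i) = 0 := by
  rw [side_add_smul, side_vertex_self, cross_self_eq_zero]; ring

/-- Half-open edges of a polygon are disjoint: a boundary point determines the edge on which it
lies (without the end point of the edge) and its position there. -/
lemma half_open_edge_unique {i j : ZMod P.n} {s t : ℝ} (hs0 : 0 ≤ s) (hs : s < 1) (ht0 : 0 ≤ t)
    (ht : t < 1) (h : P.vertex i + s • P.edge i = P.vertex j + t • P.edge j) : i = j ∧ s = t := by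
  have key : ∀ {i j : ZMod P.n} {s t : ℝ}, 0 ≤ s → s < 1 → 0 ≤ t → t < 1 →
      P.vertex i + s • P.edge i = P.vertex j + t • P.edge j → j = i ∨ j = i + 1 ∧ t = 0 := by
    intro i j s t hs0 hs ht0 ht h
    have h0 : P.side i (P.vertex j + t • P.edge j) = 0 := by rw [← h, side_edge_point]
    rw [edge, side_lineMap] at h0
    have hj := P.vertex_mem_region j i
    have hj' := P.vertex_mem_region (j + 1) i
    change 0 ≤ P.side i _ at hj hj'
    by_cases h1 : j = i
    · exact Or.inl h1
    by_cases h2 : j = i + 1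
    · refine Or.inr ⟨h2, ?_⟩
      subst h2
      rw [side_vertex_succ] at h0
      have := P.side_vertex_add_two_pos i
      rcases ht0.eq_or_lt with h3 | h3
      · exact h3.symm
      · nlinarith
    · have := P.side_vertex_pos h1 h2
      nlinarith
  have hij : i = j := by
    rcases key hs0 hs ht0 ht h with h1 | ⟨h1, h2⟩
    · exact h1.symm
    · exfalso
      rcases key ht0 ht hs0 hs h.symm with h3 | ⟨h3, -⟩
      · rw [h1] at h3; exact P.one_ne_zero_zmod (by simpa using h3.symm)
      · rw [h1] at h3
        apply P.add_two_ne i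
        rw [← one_add_one_eq_two, ← add_assoc]; exact h3.symm
  subst hij
  refine ⟨rfl, ?_⟩
  have : (s - t) • P.edge i = 0 := by
    rw [sub_smul]; linear_combination h
  rcases smul_eq_zero.1 this with h1 | h1
  · linarith
  · exact absurd h1 (P.edge_ne_zero i)

end ConvexPolygon

/-! ### Arc-length parametrizations of the boundary -/

namespace ConvexPolygon

variable (P : ConvexPolygon)

/-- The times `a k` at which a unit speed motion along the boundary is at the vertex `k`. -/
def IsBreak (a : ℤ → ℝ) : Prop := ∀ k : ℤ, a (k + 1) = a k + ‖P.edge (k : ZMod P.n)‖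

/-- A doubly infinite sequence with prescribed increments and prescribed value at `0`. -/
lemma exists_seq_of_increments (f : ℤ → ℝ) (c : ℝ) :
    ∃ a : ℤ → ℝ, a 0 = c ∧ ∀ k, a (k + 1) = a k + f k := by
  refine ⟨fun k => Int.rec (fun n => c + ∑ j ∈ Finset.range n, f j)
    (fun n => c - ∑ j ∈ Finset.range (n + 1), f (-(j + 1 : ℤ))) k, ?_, ?_⟩
  · change c + ∑ j ∈ Finset.range 0, f j = c
    simp
  intro k
  rcases k with n | n
  · change c + ∑ j ∈ Finset.range (n + 1), f j = _
    rw [Finset.sum_range_succ, ← add_assoc]; rfl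
  · rcases n with _ | n
    · change c + ∑ j ∈ Finset.range 0, f j = c - ∑ j ∈ Finset.range 1, f (-(j + 1 : ℤ)) + f (-1)
      simp
    · change c - ∑ j ∈ Finset.range (n + 1), f (-(j + 1 : ℤ))
        = c - ∑ j ∈ Finset.range (n + 1 + 1), f (-(j + 1 : ℤ)) + f (Int.negSucc (n + 1))
      rw [Finset.sum_range_succ _ (n + 1)]
      have : Int.negSucc (n + 1) = -(((n + 1 : ℕ) : ℤ) + 1) := by
        rw [Int.negSucc_eq]
      rw [this]; ring

variable {P}

lemma IsBreak.strictMono {a : ℤ → ℝ} (ha : P.IsBreak a) : StrictMono a :=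
  strictMono_int_of_lt_succ fun k => by rw [ha]; linarith [P.edge_norm_pos (k : ZMod P.n)]

/-- Every time lies in one of the half-open time intervals spent on the edges. -/
lemma IsBreak.exists_index {a : ℤ → ℝ} (ha : P.IsBreak a) (t : ℝ) :
    ∃ k, a k ≤ t ∧ t < a (k + 1) := by
  obtain ⟨i₀, -, hi₀⟩ := Finset.exists_min_image Finset.univ (fun i : ZMod P.n => ‖P.edge i‖)
    ⟨0, Finset.mem_univ _⟩
  set δ := ‖P.edge i₀‖ with hδ
  have hδ0 : 0 < δ := P.edge_norm_pos i₀
  have hm : Monotone fun k : ℤ => a k - k * δ := by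
    refine monotone_int_of_le_succ fun k => ?_
    have := hi₀ (k : ZMod P.n) (Finset.mem_univ _)
    simp only [ha k]; push_cast; linarith
  obtain ⟨k, hk, hk'⟩ := Int.exists_greatest_of_bdd (P := fun k => a k ≤ t) (by
      obtain ⟨m, hm1⟩ := exists_nat_gt ((t - a 0) / δ)
      refine ⟨m, fun z hz => ?_⟩
      by_contra hlt
      push Not at hlt
      have h1 := hm (show (0 : ℤ) ≤ z by omega)
      simp only [Int.cast_zero, zero_mul, sub_zero] at h1
      rw [div_lt_iff₀ hδ0] at hm1
      have h2 : (m : ℝ) < z := by exact_mod_cast hlt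
      nlinarith) (by
      obtain ⟨m, hm1⟩ := exists_nat_gt ((a 0 - t) / δ)
      refine ⟨-m, ?_⟩
      have h1 := hm (show (-m : ℤ) ≤ 0 by omega)
      simp only [Int.cast_zero, zero_mul, sub_zero] at h1
      rw [div_lt_iff₀ hδ0] at hm1
      push_cast at h1
      linarith)
  refine ⟨k, hk, ?_⟩
  by_contra hlt
  have := hk' (k + 1) (not_lt.1 hlt)
  omega

/-- A transitive property of pairs of times that holds for pairs of times spent on the same edge
holds for all pairs of times. -/
lemma IsBreak.induction_on_edges {a : ℤ → ℝ} (ha : P.IsBreak a) {Q : ℝ → ℝ → Prop}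
    (trans : ∀ x y z, x ≤ y → y ≤ z → Q x y → Q y z → Q x z)
    (onEdge : ∀ k x y, a k ≤ x → x ≤ y → y ≤ a (k + 1) → Q x y) {x y : ℝ} (hxy : x ≤ y) :
    Q x y := by
  obtain ⟨k, hk, hk'⟩ := ha.exists_index x
  have key : ∀ m : ℕ, ∀ y, x ≤ y → y ≤ a (k + 1 + m) → Q x y := by
    intro m
    induction m with
    | zero => intro y h1 h2; exact onEdge k x y hk h1 (by simpa using h2)
    | succ m ih =>
      intro y h1 h2
      by_cases h3 : y ≤ a (k + 1 + m)
      · exact ih y h1 h3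
      · push Not at h3
        have h4 : x ≤ a (k + 1 + m) := hk'.le.trans (ha.strictMono.monotone (by omega))
        refine trans x _ y h4 h3.le (ih _ h4 le_rfl) (onEdge (k + 1 + m) _ _ le_rfl h3.le ?_)
        rw [show k + 1 + (m : ℤ) + 1 = k + 1 + ((m + 1 : ℕ) : ℤ) by push_cast; ring]
        exact h2
  obtain ⟨k', hk1, hk2⟩ := ha.exists_index y
  have hkk : k ≤ k' := by
    have : a k < a (k' + 1) := hk.trans_lt (hxy.trans_lt hk2)
    have := ha.strictMono.lt_iff_lt.1 this
    omega
  refine key (k' - k).toNat y hxy (hk2.le.trans (ha.strictMono.monotone ?_))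
  omega

variable (P) in
lemma isBoundaryParam_iff {β : ℝ → ℂ} : P.IsBoundaryParam β ↔ ∃ a, P.IsBreak a ∧
    ∀ (k : ℤ) (t : ℝ), a k ≤ t → t ≤ a (k + 1) →
      β t = P.vertex (k : ZMod P.n) + ((t - a k) / ‖P.edge (k : ZMod P.n)‖) •
        P.edge (k : ZMod P.n) := by
  simp only [IsBoundaryParam, dist_vertex]; rfl

/-- Through every boundary point there is an arc-length parametrization that starts there. -/
lemma exists_isBoundaryParam {z : ℂ} (hz : z ∈ P.region) (hz' : z ∉ P.inner) :
    ∃ β, P.IsBoundaryParam β ∧ β 0 = z := by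
  classical
  obtain ⟨i, hi⟩ := P.exists_side_eq_zero hz hz'
  obtain ⟨s, hs0, hs1, hzs⟩ := P.exists_eq_of_side_eq_zero hz hi
  obtain ⟨m, rfl⟩ := ZMod.intCast_surjective i
  obtain ⟨b, -, hb⟩ := exists_seq_of_increments (fun k : ℤ => ‖P.edge (k : ZMod P.n)‖) 0
  set ℓ := ‖P.edge (m : ZMod P.n)‖ with hℓ
  have hℓ0 : 0 < ℓ := P.edge_norm_pos _
  set a : ℤ → ℝ := fun k => b k - b m - s * ℓ with hadef
  have ha : P.IsBreak a := fun k => by simp only [hadef, hb k]; ring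
  choose idx h1 h2 using ha.exists_index
  set F : ℤ → ℝ → ℂ := fun k t => P.vertex (k : ZMod P.n) +
    ((t - a k) / ‖P.edge (k : ZMod P.n)‖) • P.edge (k : ZMod P.n) with hF
  have hβ : ∀ (k : ℤ) (t : ℝ), a k ≤ t → t ≤ a (k + 1) → F (idx t) t = F k t := by
    intro k t hk hk'
    have hle : k ≤ idx t := by
      have := ha.strictMono.lt_iff_lt.1 (hk.trans_lt (h2 t)); omega
    have hle' : idx t ≤ k + 1 := ha.strictMono.le_iff_le.1 ((h1 t).trans hk')
    rcases (show idx t = k ∨ idx t = k + 1 by omega) with h | h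
    · rw [h]
    · have hta : t = a (k + 1) := le_antisymm hk' (by rw [← h]; exact h1 t)
      rw [h]
      simp only [hF, hta, sub_self, zero_div, zero_smul, add_zero]
      rw [ha k, add_sub_cancel_left, div_self (P.edge_norm_pos _).ne', one_smul, edge]
      push_cast; ring
  refine ⟨fun t => F (idx t) t, P.isBoundaryParam_iff.2 ⟨a, ha, hβ⟩, ?_⟩
  have ham : a m = -(s * ℓ) := by simp [hadef]
  change F (idx 0) 0 = z
  rw [hβ m 0 (by rw [ham]; nlinarith) (by rw [ha m, ham, ← hℓ]; nlinarith), hzs]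
  simp only [hF, ham, ← hℓ]
  congr 2
  field_simp
  ring

lemma IsBoundaryParam.shift {β : ℝ → ℂ} (hβ : P.IsBoundaryParam β) (c : ℝ) :
    P.IsBoundaryParam fun t => β (t + c) := by
  obtain ⟨a, ha, h⟩ := P.isBoundaryParam_iff.1 hβ
  refine P.isBoundaryParam_iff.2 ⟨fun k => a k - c, fun k => by simp only [ha k]; ring, ?_⟩
  intro k t h1 h2
  simp only at h1 h2 ⊢
  rw [h k (t + c) (by linarith) (by linarith)]
  congr 3; ring

/-- On one edge the motion is uniform, with a unit velocity `u` parallel to the edge. -/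
lemma exists_unit_velocity {β : ℝ → ℂ} {a : ℤ → ℝ}
    (h : ∀ (k : ℤ) (t : ℝ), a k ≤ t → t ≤ a (k + 1) →
      β t = P.vertex (k : ZMod P.n) + ((t - a k) / ‖P.edge (k : ZMod P.n)‖) •
        P.edge (k : ZMod P.n)) (k : ℤ) :
    ∃ u : ℂ, ‖u‖ = 1 ∧ (∀ z, P.side (k : ZMod P.n) z
        = ‖P.edge (k : ZMod P.n)‖ * cross u (z - P.vertex (k : ZMod P.n))) ∧
      (∀ t, a k ≤ t → t ≤ a (k + 1) → P.side (k : ZMod P.n) (β t) = 0) ∧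
      ∀ s t, a k ≤ s → s ≤ a (k + 1) → a k ≤ t → t ≤ a (k + 1) → β t = β s + (t - s) • u := by
  have hp := P.edge_norm_pos (k : ZMod P.n)
  refine ⟨(1 / ‖P.edge (k : ZMod P.n)‖) • P.edge (k : ZMod P.n), ?_, ?_, ?_, ?_⟩
  · rw [norm_smul, Real.norm_of_nonneg (by positivity)]; field_simp
  · intro z; rw [cross_smul_left, side]; field_simp
  · intro t h1 h2; rw [h k t h1 h2, side_edge_point]
  · intro s t h1 h2 h3 h4
    rw [h k s h1 h2, h k t h3 h4, smul_smul, add_assoc, ← add_smul]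
    congr 2; field_simp; ring

lemma IsBoundaryParam.dist_le {β : ℝ → ℂ} (hβ : P.IsBoundaryParam β) (s t : ℝ) :
    dist (β s) (β t) ≤ |s - t| := by
  obtain ⟨a, ha, h⟩ := P.isBoundaryParam_iff.1 hβ
  have key : ∀ {s t : ℝ}, s ≤ t → dist (β s) (β t) ≤ t - s := by
    intro s t hst
    refine ha.induction_on_edges (Q := fun s t => dist (β s) (β t) ≤ t - s) ?_ ?_ hst
    · intro x y z _ _ h1 h2
      exact (dist_triangle _ (β y) _).trans (by linarith)
    · intro k x y h1 h2 h3
      obtain ⟨u, hu, -, -, hu'⟩ := exists_unit_velocity h k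
      rw [hu' x y h1 (h2.trans h3) (h1.trans h2) h3, dist_self_add_right, norm_smul, hu,
        Real.norm_of_nonneg (by linarith), mul_one]
  rcases le_total s t with hst | hst
  · rw [abs_sub_comm, abs_of_nonneg (by linarith)]; exact key hst
  · rw [dist_comm, abs_of_nonneg (by linarith)]; exact key hst

lemma IsBoundaryParam.continuous {β : ℝ → ℂ} (hβ : P.IsBoundaryParam β) : Continuous β := by
  refine (LipschitzWith.of_dist_le_mul (K := 1) fun s t => ?_).continuous
  simpa [Real.dist_eq] using hβ.dist_le s t

lemma IsBoundaryParam.mem_region {β : ℝ → ℂ} (hβ : P.IsBoundaryParam β) (t : ℝ) :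
    β t ∈ P.region := by
  obtain ⟨a, ha, h⟩ := P.isBoundaryParam_iff.1 hβ
  obtain ⟨k, h1, h2⟩ := ha.exists_index t
  rw [h k t h1 h2.le]
  have hp := P.edge_norm_pos (k : ZMod P.n)
  refine P.edge_point_mem_region _ (div_nonneg (by linarith) hp.le) ?_
  rw [div_le_one hp]; linarith [ha k]

lemma IsBoundaryParam.notMem_inner {β : ℝ → ℂ} (hβ : P.IsBoundaryParam β) (t : ℝ) :
    β t ∉ P.inner := by
  obtain ⟨a, ha, h⟩ := P.isBoundaryParam_iff.1 hβ
  obtain ⟨k, h1, h2⟩ := ha.exists_index t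
  rw [h k t h1 h2.le]
  intro hi
  have := hi (k : ZMod P.n)
  change 0 < P.side _ _ at this
  rw [side_edge_point] at this
  exact lt_irrefl _ this

/-- Just after the time `t` the motion follows an edge that contains `β t`. -/
lemma IsBoundaryParam.exists_right {β : ℝ → ℂ} (hβ : P.IsBoundaryParam β) (t : ℝ) :
    ∃ (i : ZMod P.n) (r : ℝ), 0 < r ∧ P.side i (β t) = 0 ∧
      ∃ ε > 0, ∀ s, 0 ≤ s → s ≤ ε → β (t + s) = β t + (s * r) • P.edge i := by
  obtain ⟨a, ha, h⟩ := P.isBoundaryParam_iff.1 hβ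
  obtain ⟨k, h1, h2⟩ := ha.exists_index t
  have hp := P.edge_norm_pos (k : ZMod P.n)
  refine ⟨k, 1 / ‖P.edge (k : ZMod P.n)‖, by positivity, ?_, a (k + 1) - t, by linarith, ?_⟩
  · rw [h k t h1 h2.le, side_edge_point]
  · intro s hs hs'
    rw [h k t h1 h2.le, h k (t + s) (by linarith) (by linarith), add_assoc, ← add_smul]
    congr 2; field_simp; ring

/-- Just before the time `t` the motion follows an edge that contains `β t`. -/
lemma IsBoundaryParam.exists_left {β : ℝ → ℂ} (hβ : P.IsBoundaryParam β) (t : ℝ) :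
    ∃ (i : ZMod P.n) (r : ℝ), 0 < r ∧ P.side i (β t) = 0 ∧
      ∃ ε > 0, ∀ s, 0 ≤ s → s ≤ ε → β (t - s) = β t - (s * r) • P.edge i := by
  obtain ⟨a, ha, h⟩ := P.isBoundaryParam_iff.1 hβ
  obtain ⟨k, h1, h2⟩ : ∃ k, a k < t ∧ t ≤ a (k + 1) := by
    obtain ⟨k, h1, h2⟩ := ha.exists_index t
    rcases h1.eq_or_lt with h3 | h3
    · refine ⟨k - 1, ?_, ?_⟩
      · rw [← h3]; exact ha.strictMono (by omega)
      · rw [sub_add_cancel]; exact h3.ge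
    · exact ⟨k, h3, h2.le⟩
  have hp := P.edge_norm_pos (k : ZMod P.n)
  refine ⟨k, 1 / ‖P.edge (k : ZMod P.n)‖, by positivity, ?_, t - a k, by linarith, ?_⟩
  · rw [h k t h1.le h2, side_edge_point]
  · intro s hs hs'
    rw [h k t h1.le h2, h k (t - s) (by linarith) (by linarith), add_sub_assoc, ← sub_smul]
    congr 2; field_simp; ring

/-- An arc-length parametrization of the boundary is determined by its starting point. -/
lemma IsBoundaryParam.unique {β β' : ℝ → ℂ} (hβ : P.IsBoundaryParam β)
    (hβ' : P.IsBoundaryParam β') (h0 : β 0 = β' 0) : β = β' := by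
  obtain ⟨a, ha, h⟩ := P.isBoundaryParam_iff.1 hβ
  obtain ⟨a', ha', h'⟩ := P.isBoundaryParam_iff.1 hβ'
  obtain ⟨k, h1, h2⟩ := ha.exists_index 0
  obtain ⟨k', h1', h2'⟩ := ha'.exists_index 0
  have hp := P.edge_norm_pos (k : ZMod P.n)
  have hp' := P.edge_norm_pos (k' : ZMod P.n)
  rw [h k 0 h1 h2.le, h' k' 0 h1' h2'.le] at h0
  have hu := P.half_open_edge_unique (div_nonneg (by linarith) hp.le)
    ((div_lt_one hp).2 (by linarith [ha k])) (div_nonneg (by linarith) hp'.le)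
    ((div_lt_one hp').2 (by linarith [ha' k'])) h0
  obtain ⟨hkk, hst⟩ := hu
  have hak : a k = a' k' := by
    rw [← hkk] at hst
    rw [div_left_inj' hp.ne'] at hst
    linarith
  -- the two sequences of break times agree up to the shift `k' - k` of the indices
  have hcast : ∀ j : ℤ, (((k' - k) + j : ℤ) : ZMod P.n) = (j : ZMod P.n) := by
    intro j; push_cast; rw [← hkk]; ring
  have hshift : ∀ j : ℤ, a' ((k' - k) + j) = a j := by
    have hc : ∀ j : ℤ, a' ((k' - k) + (j + 1)) - a (j + 1) = a' ((k' - k) + j) - a j := by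
      intro j
      rw [← add_assoc, ha', ha, hcast]; ring
    have hk0 : a' ((k' - k) + k) - a k = 0 := by rw [sub_add_cancel, hak, sub_self]
    have hall : ∀ j : ℤ, a' ((k' - k) + j) - a j = 0 := by
      intro j
      induction j using Int.inductionOn' (b := k) with
      | zero => exact hk0
      | succ j _ ih => rw [hc, ih]
      | pred j _ ih => rw [← hc (j - 1), sub_add_cancel, ih]
    intro j; linarith [hall j]
  funext t
  obtain ⟨j, h3, h4⟩ := ha.exists_index t
  rw [h j t h3 h4.le, h' ((k' - k) + j) t (by rw [hshift]; exact h3)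
    (by rw [add_assoc, hshift]; exact h4.le), hshift, hcast]

end ConvexPolygon

/-! ### Chords of convex polygons and the arcs that they cut off -/

namespace ConvexPolygon

variable {P : ConvexPolygon} {w x : ℂ} {τ : ℝ}

/-- The line through `x` with direction `w` enters the open polygon at `x` and leaves it at
`x + τ w`. -/
structure IsChord (P : ConvexPolygon) (w x : ℂ) (τ : ℝ) : Prop where
  pos : 0 < τ
  mem_inner : ∀ s, 0 < s → s < τ → x + s • w ∈ P.inner
  exit_mem : x + τ • w ∈ P.region
  mem_region_imp : ∀ s : ℝ, x + s • w ∈ P.region → 0 ≤ s ∧ s ≤ τ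

lemma mem_inner_of_between {s₀ s₁ s : ℝ} (h₀ : x + s₀ • w ∈ P.inner)
    (h₁ : x + s₁ • w ∈ P.region) (h : s₀ ≤ s ∧ s < s₁ ∨ s₁ < s ∧ s ≤ s₀) :
    x + s • w ∈ P.inner := by
  have hne : s₁ - s₀ ≠ 0 := by
    rcases h with h | h <;> intro h' <;> linarith [h.1, h.2]
  have hm := P.lineMap_mem_inner h₀ h₁ (t := (s - s₀) / (s₁ - s₀)) ?_ ?_
  · have e : x + s₀ • w + ((s - s₀) / (s₁ - s₀)) • (x + s₁ • w - (x + s₀ • w)) = x + s • w := by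
      rw [add_sub_add_left_eq_sub, ← sub_smul, smul_smul, div_mul_cancel₀ _ hne, add_assoc,
        ← add_smul]
      congr 2; ring
    rwa [e] at hm
  · rcases h with h | h
    · exact div_nonneg (by linarith) (by linarith)
    · exact div_nonneg_of_nonpos (by linarith) (by linarith)
  · rcases h with h | h
    · rw [div_lt_one (by linarith)]; linarith
    · rw [div_lt_one_of_neg (by linarith)]; linarith

/-- If a motion in direction `w` from a boundary point enters the open polygon and is outside of it
at time `σ`, then it runs through a chord, which it leaves at time `σ` at the latest. -/
lemma exists_isChord {σ s₀ : ℝ} (hx : x ∈ P.region) (hx' : x ∉ P.inner) (hσ : 0 < σ)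
    (hq : x + σ • w ∉ P.inner) (hs₀ : 0 < s₀) (hin : x + s₀ • w ∈ P.inner) :
    ∃ τ, τ ≤ σ ∧ P.IsChord w x τ ∧ x + τ • w ∉ P.inner := by
  have hx0 : x + (0 : ℝ) • w ∈ P.region := by simpa using hx
  have hx0' : x + (0 : ℝ) • w ∉ P.inner := by simpa using hx'
  have hs₀σ : s₀ < σ := by
    by_contra hlt
    push Not at hlt
    exact hq (mem_inner_of_between hin hx0 (Or.inr ⟨hσ, hlt⟩))
  have hcont : Continuous fun s : ℝ => x + s • w := by fun_prop
  have hK : IsCompact (Set.Icc 0 σ ∩ (fun s : ℝ => x + s • w) ⁻¹' P.region) :=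
    isCompact_Icc.inter_right (P.isClosed_region.preimage hcont)
  obtain ⟨τ, ⟨⟨hτ0, hτσ⟩, hτr⟩, hmax⟩ := hK.exists_isMaxOn
    ⟨s₀, ⟨hs₀.le, hs₀σ.le⟩, P.inner_subset_region hin⟩ continuousOn_id
  have hs₀τ : s₀ ≤ τ := hmax ⟨⟨hs₀.le, hs₀σ.le⟩, P.inner_subset_region hin⟩
  have hτ' : x + τ • w ∉ P.inner := by
    intro hi
    have hlt : τ < σ := lt_of_le_of_ne hτσ (by rintro rfl; exact hq hi)
    have hev : ∀ᶠ s in 𝓝[>] τ, x + s • w ∈ P.inner :=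
      nhdsWithin_le_nhds (hcont.continuousAt.eventually (P.isOpen_inner.mem_nhds hi))
    obtain ⟨s, hs, hs1, hs2⟩ := (hev.and (Ioo_mem_nhdsGT hlt)).exists
    have : s ≤ τ := hmax ⟨⟨by linarith, hs2.le⟩, P.inner_subset_region hs⟩
    linarith
  refine ⟨τ, hτσ, ⟨by linarith, ?_, hτr, ?_⟩, hτ'⟩
  · intro s h1 h2
    rcases le_total s s₀ with h | h
    · exact mem_inner_of_between hin hx0 (Or.inr ⟨h1, h⟩)
    · exact mem_inner_of_between hin hτr (Or.inl ⟨h, h2⟩)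
  · intro s hs
    constructor
    · by_contra hlt
      exact hx0' (mem_inner_of_between hin hs (Or.inr ⟨not_le.1 hlt, hs₀.le⟩))
    · by_contra hlt
      exact hτ' (mem_inner_of_between hin hs (Or.inl ⟨hs₀τ, not_le.1 hlt⟩))

namespace IsChord

lemma direction_ne_zero (h : P.IsChord w x τ) : w ≠ 0 := by
  rintro rfl
  have := h.pos
  have h1 := (h.mem_region_imp (τ + 1) (by simpa using h.exit_mem)).2
  linarith

lemma cross_edge_pos (h : P.IsChord w x τ) {i : ZMod P.n} (hi : P.side i x = 0) :
    0 < cross (P.edge i) w := by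
  have hp := h.pos
  have h1 := h.mem_inner (τ / 2) (by linarith) (by linarith) i
  change 0 < P.side i _ at h1
  rw [side_add_smul, hi, zero_add] at h1
  exact pos_of_mul_pos_right h1 (by linarith)

/-- The line of the chord meets the boundary of the polygon only at the ends of the chord. -/
lemma eq_or_eq_of_cross_eq_zero (h : P.IsChord w x τ) {z : ℂ} (hz : z ∈ P.region)
    (hz' : z ∉ P.inner) (h0 : cross w (z - x) = 0) : z = x ∨ z = x + τ • w := by
  obtain ⟨s, hs⟩ := exists_eq_smul_of_cross_eq_zero h.direction_ne_zero h0
  have hzs : z = x + s • w := by rw [← hs]; ring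
  rw [hzs] at hz hz'
  obtain ⟨h1, h2⟩ := h.mem_region_imp s hz
  rcases h1.eq_or_lt with h3 | h3
  · left; rw [hzs, ← h3]; simp
  rcases h2.eq_or_lt with h4 | h4
  · right; rw [hzs, h4]
  · exact absurd (h.mem_inner s h3 h4) hz'

/-- Whenever the counterclockwise motion along the boundary is at the entry point `x`, it crosses
the line of the chord from left to right. -/
lemma crosses_at_entry (h : P.IsChord w x τ) {β : ℝ → ℂ} (hβ : P.IsBoundaryParam β) {t : ℝ}
    (ht : β t = x) : ∃ δ > 0, ∀ s, 0 < s → s ≤ δ →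
      cross w (β (t + s) - x) < 0 ∧ 0 < cross w (β (t - s) - x) := by
  obtain ⟨i, r, hr, hi, ε, hε, h1⟩ := hβ.exists_right t
  obtain ⟨j, r', hr', hj, ε', hε', h2⟩ := hβ.exists_left t
  rw [ht] at hi hj h1 h2
  have hci := h.cross_edge_pos hi
  have hcj := h.cross_edge_pos hj
  refine ⟨min ε ε', lt_min hε hε', fun s hs hs' => ⟨?_, ?_⟩⟩
  · rw [h1 s hs.le (hs'.trans (min_le_left _ _)), add_sub_cancel_left, cross_smul_right,
      cross_comm]
    have := mul_pos (mul_pos hs hr) hci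
    linarith
  · rw [h2 s hs.le (hs'.trans (min_le_right _ _)), sub_sub_cancel_left, ← neg_smul,
      cross_smul_right, cross_comm]
    have := mul_pos (mul_pos hs hr') hcj
    linarith

end IsChord

/-- The motion along the boundary in one of the two directions. -/
noncomputable def travel (β : ℝ → ℂ) (ccw : Bool) (t : ℝ) : ℂ := β (if ccw = true then t else -t)

lemma IsBoundaryParam.continuous_travel {β : ℝ → ℂ} (hβ : P.IsBoundaryParam β) (ccw : Bool) :
    Continuous (travel β ccw) := by
  unfold travel
  cases ccw
  · simpa [Function.comp_def] using hβ.continuous.comp continuous_neg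
  · simpa using hβ.continuous

/-- The sign that makes the signed area relative to a chord positive on the side to which the
motion from the entry point in the given direction goes first: the right side for the
counterclockwise direction. -/
noncomputable def turnSign (ccw : Bool) : ℝ := if ccw = true then -1 else 1

lemma turnSign_sq (ccw : Bool) : turnSign ccw * turnSign ccw = 1 := by
  cases ccw <;> simp [turnSign]

namespace IsChord

/-- Both motions along the boundary cross the line of the chord at the entry point, towards the
side on which `turnSign` makes signed areas positive. -/
lemma travel_at_entry (h : P.IsChord w x τ) {β : ℝ → ℂ} (hβ : P.IsBoundaryParam β) (ccw : Bool)
    {t : ℝ} (ht : travel β ccw t = x) : ∃ δ > 0, ∀ s, 0 < s → s ≤ δ →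
      0 < turnSign ccw * cross w (travel β ccw (t + s) - x) ∧
      turnSign ccw * cross w (travel β ccw (t - s) - x) < 0 := by
  cases ccw
  · simp only [travel, turnSign, Bool.false_eq_true, if_false, one_mul] at ht ⊢
    obtain ⟨δ, hδ, hd⟩ := h.crosses_at_entry hβ ht
    refine ⟨δ, hδ, fun s h1 h2 => ?_⟩
    obtain ⟨h3, h4⟩ := hd s h1 h2
    rw [show -(t + s) = -t - s by ring, show -(t - s) = -t + s by ring]
    exact ⟨h4, h3⟩
  · simp only [travel, turnSign, if_true] at ht ⊢
    obtain ⟨δ, hδ, hd⟩ := h.crosses_at_entry hβ ht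
    refine ⟨δ, hδ, fun s h1 h2 => ?_⟩
    obtain ⟨h3, h4⟩ := hd s h1 h2
    constructor <;> linarith

/-- Before the first return to the line of the chord, the motion stays on one side of it. -/
lemma travel_side_pos (h : P.IsChord w x τ) {β : ℝ → ℂ} (hβ : P.IsBoundaryParam β) (ccw : Bool)
    (h0 : β 0 = x) {t : ℝ} (ht : 0 < t)
    (hne : ∀ s, 0 < s → s ≤ t → cross w (travel β ccw s - x) ≠ 0) :
    0 < turnSign ccw * cross w (travel β ccw t - x) := by
  obtain ⟨δ, hδ, hd⟩ := h.travel_at_entry hβ ccw (t := 0) (by simp [travel, h0])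
  by_contra hcon
  push Not at hcon
  set s := min δ t with hs
  have hs0 : 0 < s := lt_min hδ ht
  have h1 := (hd s hs0 (min_le_left _ _)).1
  rw [zero_add] at h1
  have hc : Continuous fun u => turnSign ccw * cross w (travel β ccw u - x) :=
    continuous_const.mul ((continuous_cross w).comp
      ((hβ.continuous_travel ccw).sub continuous_const))
  obtain ⟨u, ⟨hu1, hu2⟩, hu⟩ := intermediate_value_Icc' (min_le_right δ t) hc.continuousOn
    ⟨hcon, h1.le⟩
  refine hne u (hs0.trans_le hu1) hu2 ?_
  have hsg := turnSign_sq ccw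
  have : turnSign ccw * (turnSign ccw * cross w (travel β ccw u - x)) = 0 := by
    simp only at hu; rw [hu, mul_zero]
  rwa [← mul_assoc, hsg, one_mul] at this

/-- The motion along the boundary that starts at the entry point either does not return to the line
of the chord in time `d`, or it first returns to this line at the exit point. -/
lemma travel_cases (h : P.IsChord w x τ) {β : ℝ → ℂ} (hβ : P.IsBoundaryParam β) (ccw : Bool)
    (h0 : β 0 = x) (d : ℝ) :
    (∃ t, 0 < t ∧ t ≤ d ∧ cross w (travel β ccw t - x) = 0 ∧ travel β ccw t = x + τ • w ∧
      ∀ s, 0 < s → s < t → cross w (travel β ccw s - x) ≠ 0) ∨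
    ∀ s, 0 < s → s ≤ d → cross w (travel β ccw s - x) ≠ 0 := by
  by_cases hz : ∀ s, 0 < s → s ≤ d → cross w (travel β ccw s - x) ≠ 0
  · exact Or.inr hz
  left
  push Not at hz
  obtain ⟨s₁, hs1, hs1d, hs1z⟩ := hz
  obtain ⟨δ, hδ, hd⟩ := h.travel_at_entry hβ ccw (t := 0) (by simp [travel, h0])
  have hsmall : ∀ s, 0 < s → s ≤ δ → cross w (travel β ccw s - x) ≠ 0 := by
    intro s h1 h2 h3
    have := (hd s h1 h2).1
    rw [zero_add, h3, mul_zero] at this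
    exact lt_irrefl _ this
  have hc : Continuous fun u => cross w (travel β ccw u - x) :=
    (continuous_cross w).comp ((hβ.continuous_travel ccw).sub continuous_const)
  have hK : IsCompact (Set.Icc δ d ∩ (fun u => cross w (travel β ccw u - x)) ⁻¹' {0}) :=
    isCompact_Icc.inter_right (isClosed_singleton.preimage hc)
  have hδs : δ ≤ s₁ := by
    by_contra hlt; exact hsmall s₁ hs1 (not_le.1 hlt).le hs1z
  obtain ⟨t, ⟨⟨ht1, ht2⟩, htz⟩, hmin⟩ := hK.exists_isMinOn ⟨s₁, ⟨hδs, hs1d⟩, hs1z⟩ continuousOn_id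
  have ht0 : 0 < t := hδ.trans_le ht1
  have hfirst : ∀ s, 0 < s → s < t → cross w (travel β ccw s - x) ≠ 0 := by
    intro s h1 h2 h3
    rcases le_total s δ with h4 | h4
    · exact hsmall s h1 h4 h3
    · have : t ≤ s := hmin ⟨⟨h4, h2.le.trans ht2⟩, h3⟩
      linarith
  refine ⟨t, ht0, ht2, htz, ?_, hfirst⟩
  rcases h.eq_or_eq_of_cross_eq_zero (hβ.mem_region _) (hβ.notMem_inner _) htz with hx | hy
  · -- a return to `x` would come from the other side of the line
    exfalso
    obtain ⟨δ', hδ', hd'⟩ := h.travel_at_entry hβ ccw (t := t) hx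
    set s := min δ' (t / 2) with hs
    have hs0 : 0 < s := lt_min hδ' (by linarith)
    have hst : s ≤ t / 2 := min_le_right _ _
    have h1 := (hd' s hs0 (min_le_left _ _)).2
    have h2 := h.travel_side_pos hβ ccw h0 (t := t - s) (by linarith)
      (fun u hu hu' => hfirst u hu (by linarith))
    linarith
  · exact hy

end IsChord

/-- An arc of the boundary on one side of the line of a chord is at most as long as a multiple of
the chord, if the center `a` of an inscribed disc of radius `r` is on the other side: seen from a
point `a'` at distance at least `r / 2` from the line, the arc projects to the chord, and this
central projection moves at speed at least `(r / R)² / 16`. -/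
lemma IsChord.arc_length_le (h : P.IsChord w x τ) {β : ℝ → ℂ} (hβ : P.IsBoundaryParam β)
    (ccw : Bool) {a b : ℂ} {r R A B : ℝ} (hr : 0 < r) (hin : Metric.closedBall a r ⊆ P.region)
    (hout : P.region ⊆ Metric.closedBall b R) (ha : turnSign ccw * cross w (a - x) ≤ 0)
    (hAB : A ≤ B) (hside : ∀ t, A ≤ t → t ≤ B → 0 ≤ turnSign ccw * cross w (β t - x)) :
    r ^ 2 * (B - A) ≤ 16 * R ^ 2 * (τ * ‖w‖) := by
  set sg := turnSign ccw with hsg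
  have hsq : sg * sg = 1 := turnSign_sq ccw
  have hw : 0 < ‖w‖ := norm_pos_iff.2 h.direction_ne_zero
  set a' : ℂ := a - (sg * (r / 2 / ‖w‖)) • (Complex.I * w) with ha'
  have hsgabs : |sg| = 1 := by
    have : |sg| * |sg| = 1 := by rw [← abs_mul, hsq, abs_one]
    nlinarith [abs_nonneg sg]
  have hin' : Metric.closedBall a' (r / 2) ⊆ P.region := by
    refine (Metric.closedBall_subset_closedBall' ?_).trans hin
    rw [ha', dist_eq_norm, sub_sub_cancel_left, norm_neg, norm_smul, Real.norm_eq_abs, abs_mul,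
      hsgabs, norm_mul, Complex.norm_I, abs_of_nonneg (by positivity)]
    field_simp; linarith
  have ha'r : a' ∈ P.region := hin' (Metric.mem_closedBall_self (by linarith))
  have hR : 0 < R := by
    have h1 := hout (hin (Metric.mem_closedBall_self hr.le))
    have h2 := hout (hin (show a + (r : ℂ) ∈ Metric.closedBall a r by
      simp [abs_of_pos hr]))
    rw [Metric.mem_closedBall] at h1 h2
    have h3 := dist_triangle (a + (r : ℂ)) b a
    rw [dist_self_add_left, Complex.norm_real, Real.norm_of_nonneg hr.le, dist_comm b a] at h3
    linarith
  set H : ℂ → ℝ := fun z => sg * cross w (z - a') with hH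
  set X : ℂ → ℝ := fun z => w.re * (z - a').re + w.im * (z - a').im with hX
  set H0 := H x with hH0
  have hH0r : ‖w‖ * (r / 2) ≤ H0 := by
    have e : H0 = -(sg * cross w (a - x)) + sg * sg * (r / 2 / ‖w‖ * ‖w‖ ^ 2) := by
      simp only [hH0, hH, ha']
      rw [show x - (a - (sg * (r / 2 / ‖w‖)) • (Complex.I * w))
        = -(a - x) + (sg * (r / 2 / ‖w‖)) • (Complex.I * w) by ring, cross_add_right,
        cross_smul_right, cross_self_mul_I, ← neg_one_smul ℝ (a - x), cross_smul_right]
      ring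
    rw [e, hsq, show r / 2 / ‖w‖ * ‖w‖ ^ 2 = ‖w‖ * (r / 2) by field_simp]
    linarith
  have hH0pos : 0 < H0 := lt_of_lt_of_le (by positivity) hH0r
  have hHlow : ∀ t, A ≤ t → t ≤ B → H0 ≤ H (β t) := by
    intro t h1 h2
    have := hside t h1 h2
    have e : H (β t) = sg * cross w (β t - x) + H0 := by
      simp only [hH0, hH]
      rw [← mul_add, ← cross_add_right]; congr 2; ring
    rw [e]; linarith
  have hHup : ∀ t, H (β t) ≤ ‖w‖ * (2 * R) := by
    intro t
    have h1 := hout (hβ.mem_region t)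
    have h2 := hout ha'r
    rw [Metric.mem_closedBall] at h1 h2
    have h3 : ‖β t - a'‖ ≤ 2 * R := by
      rw [← dist_eq_norm]
      have := dist_triangle_right (β t) a' b
      linarith
    calc H (β t) ≤ |H (β t)| := le_abs_self _
      _ = |cross w (β t - a')| := by simp only [hH]; rw [abs_mul, hsgabs, one_mul]
      _ ≤ ‖w‖ * ‖β t - a'‖ := abs_cross_le _ _
      _ ≤ _ := by gcongr
  have hws : w.re * w.re + w.im * w.im = ‖w‖ ^ 2 := by
    rw [← Complex.normSq_eq_norm_sq, Complex.normSq_apply]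
  -- the central projection of the arc to the line stays in the chord
  have hrange : ∀ t, A ≤ t → t ≤ B → ∃ s, 0 ≤ s ∧ s ≤ τ ∧
      X (β t) / H (β t) = (X x + s * ‖w‖ ^ 2) / H0 := by
    intro t h1 h2
    have hl := hHlow t h1 h2
    have hHpos : 0 < H (β t) := hH0pos.trans_le hl
    set ρ := H0 / H (β t) with hρ
    have hpr := P.lineMap_mem_region ha'r (hβ.mem_region t) (t := ρ) (by positivity)
      ((div_le_one hHpos).2 hl)
    have hcr : cross w (a' + ρ • (β t - a') - x) = 0 := by
      have e : sg * cross w (a' + ρ • (β t - a') - x) = ρ * H (β t) - H0 := by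
        simp only [hH0, hH, cross_sub_right, cross_add_right, cross_smul_right]; ring
      rw [hρ, div_mul_cancel₀ _ hHpos.ne', sub_self] at e
      have : sg ≠ 0 := by rintro h0; rw [h0] at hsq; simp at hsq
      exact (mul_eq_zero.1 e).resolve_left this
    obtain ⟨s, hs⟩ := exists_eq_smul_of_cross_eq_zero h.direction_ne_zero hcr
    have hpt : a' + ρ • (β t - a') = x + s • w := by rw [← hs]; ring
    rw [hpt] at hpr
    obtain ⟨hs0, hsτ⟩ := h.mem_region_imp s hpr
    refine ⟨s, hs0, hsτ, ?_⟩
    have hXs : ρ * X (β t) = X x + s * ‖w‖ ^ 2 := by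
      have e1 : ρ • (β t - a') = (x - a') + s • w := by
        rw [sub_add_eq_add_sub, ← hpt, add_sub_cancel_left]
      have e2 := congrArg Complex.re e1
      have e3 := congrArg Complex.im e1
      simp only [Complex.real_smul, Complex.re_ofReal_mul, Complex.im_ofReal_mul,
        Complex.add_re, Complex.add_im] at e2 e3
      simp only [hX]
      rw [← hws]
      linear_combination w.re * e2 + w.im * e3
    rw [← hXs, hρ]
    field_simp
  have hmono : A ≤ A → B ≤ B →
      r / (8 * R ^ 2) * (B - A) ≤ -sg * (X (β B) / H (β B) - X (β A) / H (β A)) := by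
    obtain ⟨br, hbr, hform⟩ := P.isBoundaryParam_iff.1 hβ
    refine hbr.induction_on_edges (Q := fun t₁ t₂ => A ≤ t₁ → t₂ ≤ B →
      r / (8 * R ^ 2) * (t₂ - t₁) ≤ -sg * (X (β t₂) / H (β t₂) - X (β t₁) / H (β t₁))) ?_ ?_ hAB
    · intro t₁ t₂ t₃ h1 h2 h3 h4 h5 h6
      have := h3 h5 (h2.trans h6)
      have := h4 (h5.trans h1) h6
      linarith
    · intro k t₁ t₂ h1 h2 h3 h4 h5
      obtain ⟨u, hu1, hus, hu0, huv⟩ := exists_unit_velocity hform k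
      have hedge := P.edge_norm_pos (k : ZMod P.n)
      have hP1 : 0 < H (β t₁) := hH0pos.trans_le (hHlow t₁ h4 (h2.trans h5))
      have hP2 : 0 < H (β t₂) := hH0pos.trans_le (hHlow t₂ (h4.trans h2) h5)
      -- the disc around `a'` is to the left of the edge
      have hleft : r / 2 ≤ cross u (a' - β t₁) := by
        have hm : a' - (r / 2 : ℝ) • (Complex.I * u) ∈ P.region := by
          apply hin'
          rw [Metric.mem_closedBall, dist_eq_norm, sub_sub_cancel_left, norm_neg, norm_smul,
            norm_mul, Complex.norm_I, hu1, Real.norm_of_nonneg (by linarith)]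
          simp
        have h7 := hm (k : ZMod P.n)
        change 0 ≤ P.side _ _ at h7
        have h8 := hu0 t₁ h1 (h2.trans h3)
        rw [hus] at h7 h8
        have h9 := nonneg_of_mul_nonneg_right h7 hedge
        have h10 := (mul_eq_zero.1 h8).resolve_left hedge.ne'
        have h11 := cross_self_mul_I u
        rw [hu1] at h11
        simp only [cross_sub_right, cross_smul_right] at h9 h10 h11 ⊢
        rw [h11] at h9
        linarith
      have hdet : (t₂ - t₁) * (r / 2) ≤ cross (β t₁ - a') (β t₂ - a') := by
        have e : cross (β t₁ - a') (β t₂ - a') = (t₂ - t₁) * cross u (a' - β t₁) := by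
          rw [huv t₁ t₂ h1 (h2.trans h3) (h1.trans h2) h3,
            show β t₁ + (t₂ - t₁) • u - a' = (β t₁ - a') + (t₂ - t₁) • u by ring,
            cross_add_right, cross_self_eq_zero, zero_add, cross_smul_right, cross_comm u]
          rw [← neg_sub (β t₁) a', ← neg_one_smul ℝ (β t₁ - a'), cross_smul_right]
          ring
        rw [e]
        exact mul_le_mul_of_nonneg_left hleft (by linarith)
      have hid : -sg * (X (β t₂) * H (β t₁) - X (β t₁) * H (β t₂))
          = ‖w‖ ^ 2 * cross (β t₁ - a') (β t₂ - a') := by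
        have e : X (β t₂) * H (β t₁) - X (β t₁) * H (β t₂)
            = -sg * (‖w‖ ^ 2 * cross (β t₁ - a') (β t₂ - a')) := by
          rw [← hws]; simp only [hX, hH, cross]; ring
        rw [e]
        linear_combination (‖w‖ ^ 2 * cross (β t₁ - a') (β t₂ - a')) * hsq
      have hq : -sg * (X (β t₂) / H (β t₂) - X (β t₁) / H (β t₁))
          = ‖w‖ ^ 2 * cross (β t₁ - a') (β t₂ - a') / (H (β t₁) * H (β t₂)) := by
        rw [← hid]; field_simp
      rw [hq, le_div_iff₀ (mul_pos hP1 hP2)]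
      have hprod : H (β t₁) * H (β t₂) ≤ (‖w‖ * (2 * R)) * (‖w‖ * (2 * R)) :=
        mul_le_mul (hHup t₁) (hHup t₂) hP2.le (by positivity)
      have ht : 0 ≤ t₂ - t₁ := by linarith
      calc r / (8 * R ^ 2) * (t₂ - t₁) * (H (β t₁) * H (β t₂))
          ≤ r / (8 * R ^ 2) * (t₂ - t₁) * ((‖w‖ * (2 * R)) * (‖w‖ * (2 * R))) := by gcongr
        _ = ‖w‖ ^ 2 * ((t₂ - t₁) * (r / 2)) := by field_simp; ring
        _ ≤ _ := by gcongr
  have hm := hmono le_rfl le_rfl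
  obtain ⟨s₁, hs1, hs1', e1⟩ := hrange A le_rfl hAB
  obtain ⟨s₂, hs2, hs2', e2⟩ := hrange B hAB le_rfl
  rw [e1, e2] at hm
  have hfin : r / (8 * R ^ 2) * (B - A) ≤ τ * ‖w‖ ^ 2 / H0 := by
    have hs12 : -sg * (s₂ - s₁) ≤ τ := by
      refine (le_abs_self _).trans ?_
      rw [abs_mul, abs_neg, hsgabs, one_mul, abs_le]
      constructor <;> linarith
    calc _ ≤ _ := hm
      _ = -sg * (s₂ - s₁) * ‖w‖ ^ 2 / H0 := by ring
      _ ≤ _ := by gcongr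
  have hfin2 : τ * ‖w‖ ^ 2 / H0 ≤ τ * ‖w‖ ^ 2 / (‖w‖ * (r / 2)) := by
    have := h.pos
    gcongr
  have hfin3 := hfin.trans hfin2
  rw [show τ * ‖w‖ ^ 2 / (‖w‖ * (r / 2)) = 2 * (τ * ‖w‖) / r by field_simp,
    div_mul_eq_mul_div, div_le_div_iff₀ (by positivity) hr] at hfin3
  nlinarith

/-- In a fat polygon, one of the two arcs between the ends of a chord is at most as long as a
multiple of the chord. -/
lemma IsChord.exists_short_arc {c : ℝ} (h : P.IsChord w x τ) (hc : 0 < c) (hfat : P.IsFat c) :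
    ∃ ccw : Bool, ∀ β, P.IsBoundaryParam β → β 0 = x →
      ∃ t, 0 < t ∧ t ≤ 17 * c ^ 2 * (τ * ‖w‖) ∧ cross w (travel β ccw t - x) = 0 := by
  obtain ⟨a, b, r, R, hr, hin, hout, hRr⟩ := hfat
  obtain ⟨ccw, hccw⟩ : ∃ ccw : Bool, turnSign ccw * cross w (a - x) ≤ 0 := by
    rcases le_total 0 (cross w (a - x)) with h1 | h1
    · exact ⟨true, by simpa [turnSign] using h1⟩
    · exact ⟨false, by simpa [turnSign] using h1⟩
  refine ⟨ccw, fun β hβ h0 => ?_⟩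
  by_contra hcon
  push Not at hcon
  have hw : 0 < ‖w‖ := norm_pos_iff.2 h.direction_ne_zero
  set D := 17 * c ^ 2 * (τ * ‖w‖) with hD
  have hτw : 0 < τ * ‖w‖ := mul_pos h.pos hw
  have hD0 : 0 < D := by positivity
  have hside : ∀ t, 0 ≤ t → t ≤ D → 0 ≤ turnSign ccw * cross w (travel β ccw t - x) := by
    intro t h1 h2
    rcases h1.eq_or_lt with h3 | h3
    · rw [← h3]; simp [travel, h0, cross_zero_right]
    · exact (h.travel_side_pos hβ ccw h0 h3 fun s hs hs' => hcon s hs (hs'.trans h2)).le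
  have hlen : r ^ 2 * D ≤ 16 * R ^ 2 * (τ * ‖w‖) := by
    cases hcw : ccw
    · have := h.arc_length_le hβ ccw hr hin hout hccw (A := -D) (B := 0) (by linarith) (by
        intro t h1 h2
        have := hside (-t) (by linarith) (by linarith)
        simpa [travel, hcw] using this)
      simpa using this
    · have := h.arc_length_le hβ ccw hr hin hout hccw (A := 0) (B := D) hD0.le (by
        intro t h1 h2
        have := hside t h1 h2
        simpa [travel, hcw] using this)
      simpa using this
  have hR0 : 0 ≤ R := by
    have h1 := hout (hin (Metric.mem_closedBall_self hr.le))
    exact dist_nonneg.trans (Metric.mem_closedBall.1 h1)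
  have hR2 : R ^ 2 ≤ (c * r) ^ 2 := by gcongr
  have h1 : r ^ 2 * D ≤ 16 * (c * r) ^ 2 * (τ * ‖w‖) := hlen.trans (by gcongr)
  have h2 : 0 < c ^ 2 * r ^ 2 * (τ * ‖w‖) := by positivity
  rw [hD] at h1
  nlinarith

end ConvexPolygon

/-! ### Terrains: free moves, obstacles on a line of motion, connectedness -/

lemma segment_add_subset_iff {x v : ℂ} {K : Set ℂ} :
    segment ℝ x (x + v) ⊆ K ↔ ∀ s : ℝ, 0 ≤ s → s ≤ 1 → x + s • v ∈ K := by
  rw [segment_eq_image', Set.image_subset_iff]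
  simp only [add_sub_cancel_left, Set.subset_def, Set.mem_Icc, Set.mem_preimage, and_imp]

lemma segment_subset_iff_lineMap {x y : ℂ} {K : Set ℂ} :
    segment ℝ x y ⊆ K ↔ ∀ s : ℝ, 0 ≤ s → s ≤ 1 → x + s • (y - x) ∈ K := by
  rw [← segment_add_subset_iff, add_sub_cancel]

namespace Terrain

variable (T : Terrain)

lemma mem_carrier {z : ℂ} :
    z ∈ T.carrier ↔ z ∈ T.outer.region ∧ ∀ i, z ∉ (T.obstacle i).inner := by
  simp [carrier]

lemma isClosed_carrier : IsClosed T.carrier := by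
  rw [carrier, Set.sdiff_eq]
  exact T.outer.isClosed_region.inter
    (isOpen_iUnion fun i => (T.obstacle i).isOpen_inner).isClosed_compl

lemma obstacle_region_subset (i : Fin T.k) : (T.obstacle i).region ⊆ T.outer.region := by
  rw [← ConvexPolygon.closure_inner, ← ConvexPolygon.closure_inner]
  exact closure_mono (T.obstacle_subset i)

/-- The boundary of an obstacle belongs to the terrain, even where obstacles touch. -/
lemma boundary_mem_carrier {i : Fin T.k} {z : ℂ} (hz : z ∈ (T.obstacle i).region)
    (hz' : z ∉ (T.obstacle i).inner) : z ∈ T.carrier := by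
  rw [mem_carrier]
  refine ⟨T.obstacle_region_subset i hz, fun j hj => ?_⟩
  by_cases hij : i = j
  · exact hz' (hij ▸ hj)
  · have := (T.obstacle_disjoint i j hij).closure_left (T.obstacle j).isOpen_inner
    rw [ConvexPolygon.closure_inner] at this
    exact Set.disjoint_left.1 this hz hj

variable {T}

lemma reach_nonneg (x v : ℂ) : 0 ≤ T.reach x v := Real.sSup_nonneg fun _ h => h.1

lemma reach_le_one (x v : ℂ) : T.reach x v ≤ 1 :=
  Real.sSup_le (fun _ h => h.2.1) zero_le_one

lemma le_reach {x v : ℂ} {t : ℝ} (h0 : 0 ≤ t) (h1 : t ≤ 1)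
    (h : ∀ s, 0 ≤ s → s ≤ t → x + s • v ∈ T.carrier) : t ≤ T.reach x v := by
  refine le_csSup ⟨1, fun _ h => h.2.1⟩ ⟨h0, h1, segment_add_subset_iff.2 fun s hs0 hs1 => ?_⟩
  rw [smul_smul]
  exact h _ (by positivity) (by nlinarith)

lemma mem_carrier_of_le_reach {x v : ℂ} (hx : x ∈ T.carrier) {s : ℝ} (h0 : 0 ≤ s)
    (h1 : s ≤ T.reach x v) : x + s • v ∈ T.carrier := by
  have hlt : ∀ u, 0 ≤ u → u < T.reach x v → x + u • v ∈ T.carrier := by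
    intro u hu hu'
    obtain ⟨t, ⟨ht0, ht1, ht⟩, hut⟩ := exists_lt_of_lt_csSup
      (⟨0, le_rfl, zero_le_one, by simpa using hx⟩ : Set.Nonempty
        {t : ℝ | 0 ≤ t ∧ t ≤ 1 ∧ segment ℝ x (x + t • v) ⊆ T.carrier}) hu'
    have htpos : 0 < t := hu.trans_lt hut
    have := segment_add_subset_iff.1 ht (u / t) (by positivity) ((div_le_one htpos).2 hut.le)
    rwa [smul_smul, div_mul_cancel₀ _ htpos.ne'] at this
  rcases h1.eq_or_lt with h | h
  · rcases h0.eq_or_lt with h2 | h2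
    · rw [← h2]; simpa using hx
    have hc : Filter.Tendsto (fun u : ℝ => x + u • v) (𝓝[<] s) (𝓝 (x + s • v)) := by
      have : Continuous fun u : ℝ => x + u • v := by fun_prop
      exact (this.tendsto s).mono_left nhdsWithin_le_nhds
    refine T.isClosed_carrier.mem_of_tendsto hc ?_
    filter_upwards [Ioo_mem_nhdsLT h2] with u hu
    exact hlt u hu.1.le (by rw [← h]; exact hu.2)
  · exact hlt s h0 h

lemma segment_subset_of_reach_eq_one {x v : ℂ} (hx : x ∈ T.carrier) (h : T.reach x v = 1) :
    segment ℝ x (x + v) ⊆ T.carrier :=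
  segment_add_subset_iff.2 fun _ h0 h1 => mem_carrier_of_le_reach hx h0 (h1.trans h.ge)

/-- By convexity, the beginning of a ray does not enter and leave the open polygon repeatedly. -/
lemma eventually_inner_or {P : ConvexPolygon} (y v : ℂ) :
    (∀ᶠ ε : ℝ in 𝓝[>] 0, y + ε • v ∈ P.inner) ∨ ∀ᶠ ε : ℝ in 𝓝[>] 0, y + ε • v ∉ P.inner := by
  by_cases h2 : ∀ᶠ ε : ℝ in 𝓝[>] 0, y + ε • v ∉ P.inner
  · exact Or.inr h2
  left
  have h2' : ∃ᶠ ε : ℝ in 𝓝[>] 0, y + ε • v ∈ P.inner := h2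
  obtain ⟨ε₀, hε₀, hpos⟩ := (h2'.and_eventually self_mem_nhdsWithin).exists
  filter_upwards [Ioo_mem_nhdsGT (show (0 : ℝ) < ε₀ from hpos)] with ε hε
  obtain ⟨ε₁, hε₁, h3⟩ := (h2'.and_eventually (Ioo_mem_nhdsGT hε.1)).exists
  exact ConvexPolygon.mem_inner_of_between hε₀ (P.inner_subset_region hε₁)
    (Or.inr ⟨h3.2, hε.2.le⟩)

lemma eventually_region_or {P : ConvexPolygon} {y v : ℂ} (hy : y ∈ P.region) :
    (∀ᶠ ε : ℝ in 𝓝[>] 0, y + ε • v ∉ P.region) ∨ ∀ᶠ ε : ℝ in 𝓝[>] 0, y + ε • v ∈ P.region := by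
  by_cases h : ∃ ε₀ : ℝ, 0 < ε₀ ∧ y + ε₀ • v ∈ P.region
  · right
    obtain ⟨ε₀, h0, hr⟩ := h
    filter_upwards [Ioo_mem_nhdsGT h0] with ε hε
    have := P.lineMap_mem_region hy hr (t := ε / ε₀) (div_nonneg hε.1.le h0.le)
      ((div_le_one h0).2 hε.2.le)
    rwa [add_sub_cancel_left, smul_smul, div_mul_cancel₀ _ h0.ne'] at this
  · left
    push Not at h
    filter_upwards [self_mem_nhdsWithin] with ε hε
    exact h ε hε

/-- A free move that is stopped is stopped by some polygon. -/
lemma exists_blocks {x v : ℂ} (hx : x ∈ T.carrier) (h : T.reach x v < 1) :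
    ∃ P, T.Blocks P (x + T.reach x v • v) v := by
  by_contra! hcon
  set r := T.reach x v with hr
  have hr0 : 0 ≤ r := reach_nonneg x v
  have hy : x + r • v ∈ T.carrier := mem_carrier_of_le_reach hx hr0 le_rfl
  have hev : ∀ᶠ ε : ℝ in 𝓝[>] 0, x + r • v + ε • v ∈ T.carrier := by
    have h1 : ∀ i, ∀ᶠ ε : ℝ in 𝓝[>] 0, x + r • v + ε • v ∉ (T.obstacle i).inner := fun i =>
      (eventually_inner_or _ _).resolve_left fun hi => hcon _ (Or.inl ⟨i, rfl, hi⟩)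
    have h2 : ∀ᶠ ε : ℝ in 𝓝[>] 0, x + r • v + ε • v ∈ T.outer.region :=
      (eventually_region_or (T.mem_carrier.1 hy).1).resolve_left
        fun hi => hcon _ (Or.inr ⟨rfl, hi⟩)
    filter_upwards [Filter.eventually_all.2 h1, h2] with ε h3 h4
    exact T.mem_carrier.2 ⟨h4, h3⟩
  obtain ⟨δ, hδ, hδ'⟩ := mem_nhdsGT_iff_exists_Ioo_subset.1 hev
  have hδ0 : (0 : ℝ) < δ := hδ
  set η := min (δ / 2) (1 - r) with hη
  have hη0 : 0 < η := lt_min (by linarith) (by linarith)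
  have hle : r + η ≤ r := by
    refine le_reach (by linarith) (by linarith [min_le_right (δ / 2) (1 - r)]) fun s h0 h1 => ?_
    rcases le_or_gt s r with h2 | h2
    · exact mem_carrier_of_le_reach hx h0 h2
    · have : s - r ∈ Set.Ioo (0 : ℝ) δ := ⟨by linarith, by linarith [min_le_left (δ / 2) (1 - r)]⟩
      have h3 := hδ' this
      simp only [Set.mem_ofPred_eq] at h3
      rwa [add_assoc, ← add_smul, add_sub_cancel] at h3
  linarith

/-- A move that would stay in the outer polygon can only be stopped by an obstacle. -/
lemma Blocks.exists_obstacle {P : ConvexPolygon} {y v : ℂ} (hb : T.Blocks P y v)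
    (hy : y ∈ T.carrier) {s : ℝ} (hs : 0 < s) (hout : y + s • v ∈ T.outer.region) :
    ∃ i, P = T.obstacle i ∧ y ∈ P.region ∧ y ∉ P.inner ∧
      ∃ s₀ : ℝ, 0 < s₀ ∧ y + s₀ • v ∈ P.inner := by
  rcases hb with ⟨i, rfl, hi⟩ | ⟨rfl, ho⟩
  · refine ⟨i, rfl, ?_, (T.mem_carrier.1 hy).2 i, ?_⟩
    · have hc : Filter.Tendsto (fun t : ℝ => y + t • v) (𝓝[>] 0) (𝓝 y) := by
        have : Continuous fun t : ℝ => y + t • v := by fun_prop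
        have h := this.tendsto 0
        simp only [zero_smul, add_zero] at h
        exact h.mono_left nhdsWithin_le_nhds
      rw [← ConvexPolygon.closure_inner]
      exact mem_closure_of_tendsto hc hi
    · obtain ⟨s₀, h1, h2⟩ := (hi.and self_mem_nhdsWithin).exists
      exact ⟨s₀, h2, h1⟩
  · exfalso
    obtain ⟨ε, h1, h2⟩ := (ho.and (Ioo_mem_nhdsGT hs)).exists
    apply h1
    have := T.outer.lineMap_mem_region (T.mem_carrier.1 hy).1 hout (t := ε / s)
      (div_nonneg h2.1.le hs.le) ((div_le_one hs).2 h2.2.le)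
    rwa [add_sub_cancel_left, smul_smul, div_mul_cancel₀ _ hs.ne'] at this

/-- Induction along the straight line to a target `q` in the terrain: a property of the points of
the terrain that holds for the points from which `q` is reached by a free move, and that holds at
`x` if it holds at the point behind the first obstacle met on the way from `x` to `q`, holds
everywhere. The number of obstacles between the current point and `q` decreases. -/
theorem line_induction {q : ℂ} (hq : q ∈ T.carrier) {motive : ℂ → Prop}
    (base : ∀ x ∈ T.carrier, T.reach x (q - x) = 1 → motive x)
    (step : ∀ x ∈ T.carrier, ∀ r, T.reach x (q - x) = r → r < 1 → ∀ i τ,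
      T.Blocks (T.obstacle i) (x + r • (q - x)) (q - x) →
      x + r • (q - x) ∈ (T.obstacle i).region → x + r • (q - x) ∉ (T.obstacle i).inner →
      (T.obstacle i).IsChord (q - x) (x + r • (q - x)) τ → r + τ ≤ 1 →
      x + r • (q - x) + τ • (q - x) ∉ (T.obstacle i).inner →
      motive (x + r • (q - x) + τ • (q - x)) → motive x) :
    ∀ x ∈ T.carrier, motive x := by
  classical
  set N : ℂ → Finset (Fin T.k) := fun x => Finset.univ.filter fun i =>
    ∃ s : ℝ, 0 ≤ s ∧ s ≤ 1 ∧ x + s • (q - x) ∈ (T.obstacle i).inner with hN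
  suffices h : ∀ n : ℕ, ∀ x ∈ T.carrier, (N x).card = n → motive x from
    fun x hx => h _ x hx rfl
  intro n
  induction n using Nat.strong_induction_on with
  | _ n ih =>
    intro x hx hcard
    rcases (reach_le_one (T := T) x (q - x)).eq_or_lt with h1 | h1
    · exact base x hx h1
    obtain ⟨P, hP⟩ := exists_blocks hx h1
    set r := T.reach x (q - x) with hr
    have hr0 : 0 ≤ r := reach_nonneg x _
    have hx1 : x + r • (q - x) ∈ T.carrier := mem_carrier_of_le_reach hx hr0 le_rfl
    have hqe : x + r • (q - x) + (1 - r) • (q - x) = q := by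
      rw [add_assoc, ← add_smul, add_sub_cancel, one_smul, add_sub_cancel]
    obtain ⟨i, rfl, hreg, hinn, s₀, hs₀, hs₀'⟩ := hP.exists_obstacle hx1 (s := 1 - r)
      (by linarith) (by rw [hqe]; exact (T.mem_carrier.1 hq).1)
    obtain ⟨τ, hτ, hch, hyi⟩ := ConvexPolygon.exists_isChord hreg hinn (σ := 1 - r) (by linarith)
      (by rw [hqe]; exact (T.mem_carrier.1 hq).2 i) hs₀ hs₀'
    refine step x hx r rfl h1 i τ hP hreg hinn hch (by linarith) hyi ?_
    set y := x + r • (q - x) + τ • (q - x) with hy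
    have hyc : y ∈ T.carrier := T.boundary_mem_carrier hch.exit_mem hyi
    refine ih _ ?_ y hyc rfl
    rw [← hcard]
    apply Finset.card_lt_card
    have hpt : ∀ s : ℝ, y + s • (q - y) = x + (r + τ + s * (1 - r - τ)) • (q - x) := by
      intro s
      simp only [hy, Complex.real_smul]; push_cast; ring
    have hpt' : ∀ s : ℝ, y + s • (q - y) = x + r • (q - x) + (τ + s * (1 - r - τ)) • (q - x) := by
      intro s
      simp only [hy, Complex.real_smul]; push_cast; ring
    have hτ0 := hch.pos
    rw [Finset.ssubset_iff_of_subset]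
    · refine ⟨i, ?_, ?_⟩
      · simp only [hN, Finset.mem_filter, Finset.mem_univ, true_and]
        refine ⟨r + τ / 2, by linarith, by linarith, ?_⟩
        rw [add_smul, ← add_assoc]
        exact hch.mem_inner _ (by linarith) (by linarith)
      · simp only [hN, Finset.mem_filter, Finset.mem_univ, true_and, not_exists, not_and]
        intro s h2 h3 h4
        have h5 := (T.obstacle i).inner_subset_region h4
        rw [hpt'] at h5
        have h6 := (hch.mem_region_imp _ h5).2
        have h7 : 0 ≤ s * (1 - r - τ) := mul_nonneg h2 (by linarith)
        have h8 : τ + s * (1 - r - τ) = τ := by linarith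
        rw [hpt', h8] at h4
        exact hyi h4
    · intro j hj
      simp only [hN, Finset.mem_filter, Finset.mem_univ, true_and] at hj ⊢
      obtain ⟨s, h2, h3, h4⟩ := hj
      rw [hpt] at h4
      refine ⟨_, ?_, ?_, h4⟩
      · have : 0 ≤ s * (1 - r - τ) := mul_nonneg h2 (by linarith)
        linarith
      · have : s * (1 - r - τ) ≤ 1 * (1 - r - τ) := mul_le_mul_of_nonneg_right h3 (by linarith)
        linarith

lemma IsPolyline.dist_le {q : ℂ} : ∀ {l : List ℂ} {x : ℂ} {ℓ : ℝ}, T.IsPolyline q x l ℓ →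
    dist x q ≤ ℓ
  | [], x, ℓ, h => by rw [h.1, h.2, dist_self]
  | y :: l, x, ℓ, h => by
    have := IsPolyline.dist_le h.2
    linarith [dist_triangle x y q]

lemma pathDist_le {p q : ℂ} {l : List ℂ} {ℓ : ℝ} (h : T.IsPolyline q p l ℓ) :
    T.pathDist p q ≤ ℓ :=
  csInf_le ⟨dist p q, by rintro _ ⟨l, h⟩; exact h.dist_le⟩ ⟨l, h⟩

/-- The points `x` and `y` are joined by a polygonal line in the terrain. -/
def Linked (T : Terrain) : ℂ → ℂ → Prop :=
  Relation.ReflTransGen fun x y => segment ℝ x y ⊆ T.carrier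

lemma Linked.exists_isPolyline {p q : ℂ} (h : T.Linked p q) : ∃ ℓ l, T.IsPolyline q p l ℓ := by
  induction h using Relation.ReflTransGen.head_induction_on with
  | refl => exact ⟨0, [], rfl, rfl⟩
  | head hxy _ ih =>
    obtain ⟨ℓ, l, h⟩ := ih
    rename_i x y _
    refine ⟨ℓ + dist x y, y :: l, hxy, ?_⟩
    rwa [add_sub_cancel_right]

lemma linked_of_segment {x y : ℂ} (h : segment ℝ x y ⊆ T.carrier) : T.Linked x y :=
  Relation.ReflTransGen.single h

lemma Linked.symm {x y : ℂ} (h : T.Linked x y) : T.Linked y x := by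
  have : Std.Symm fun x y => segment ℝ x y ⊆ T.carrier :=
    ⟨fun a b hab => by rwa [segment_symm]⟩
  exact Relation.ReflTransGen.stdSymm.symm _ _ h

lemma linked_vertices (i : Fin T.k) (j j' : ZMod (T.obstacle i).n) :
    T.Linked ((T.obstacle i).vertex j) ((T.obstacle i).vertex j') := by
  have key : ∀ m : ℕ, T.Linked ((T.obstacle i).vertex j) ((T.obstacle i).vertex (j + m)) := by
    intro m
    induction m with
    | zero => rw [Nat.cast_zero, add_zero]; exact Relation.ReflTransGen.refl
    | succ m ih =>
      refine ih.tail (segment_subset_iff_lineMap.2 fun s h0 h1 => ?_)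
      rw [show j + ((m + 1 : ℕ) : ZMod (T.obstacle i).n) = j + m + 1 by push_cast; ring]
      refine T.boundary_mem_carrier ((T.obstacle i).edge_point_mem_region _ h0 h1) fun h => ?_
      have := h (j + m)
      change 0 < (T.obstacle i).side _ _ at this
      exact this.ne' ((T.obstacle i).side_edge_point _ _)
  have := key (j' - j).val
  rwa [ZMod.natCast_zmod_val, add_sub_cancel] at this

lemma linked_boundary_vertex {i : Fin T.k} {z : ℂ} (hz : z ∈ (T.obstacle i).region)
    (hz' : z ∉ (T.obstacle i).inner) : ∃ j, T.Linked ((T.obstacle i).vertex j) z := by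
  obtain ⟨j, hj⟩ := (T.obstacle i).exists_side_eq_zero hz hz'
  obtain ⟨t, ht0, ht1, hzt⟩ := (T.obstacle i).exists_eq_of_side_eq_zero hz hj
  refine ⟨j, linked_of_segment (segment_subset_iff_lineMap.2 fun s h0 h1 => ?_)⟩
  rw [hzt, add_sub_cancel_left, smul_smul]
  refine T.boundary_mem_carrier
    ((T.obstacle i).edge_point_mem_region _ (by positivity) (by nlinarith)) fun h => ?_
  have := h j
  change 0 < (T.obstacle i).side _ _ at this
  exact this.ne' ((T.obstacle i).side_edge_point _ _)

/-- Terrains are connected by polygonal lines. -/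
theorem linked_of_mem {p q : ℂ} (hp : p ∈ T.carrier) (hq : q ∈ T.carrier) : T.Linked p q := by
  refine line_induction hq (motive := fun x => T.Linked x q) ?_ ?_ p hp
  · intro x hx h
    refine linked_of_segment ?_
    have := segment_subset_of_reach_eq_one hx h
    rwa [add_sub_cancel] at this
  · intro x hx r hr h1 i τ _ hreg hinn hch _ hyi ih
    have h2 : T.Linked x (x + r • (q - x)) := by
      refine linked_of_segment (segment_add_subset_iff.2 fun s h0 h1 => ?_)
      rw [smul_smul]
      have : 0 ≤ r := by rw [← hr]; exact reach_nonneg _ _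
      exact mem_carrier_of_le_reach hx (by positivity) (by rw [hr]; nlinarith)
    obtain ⟨j, hj⟩ := linked_boundary_vertex hreg hinn
    obtain ⟨j', hj'⟩ := linked_boundary_vertex hch.exit_mem hyi
    exact ((h2.trans hj.symm).trans (linked_vertices i j j')).trans (hj'.trans ih)

lemma dist_le_pathDist {p q : ℂ} (hp : p ∈ T.carrier) (hq : q ∈ T.carrier) :
    dist p q ≤ T.pathDist p q :=
  le_csInf (linked_of_mem hp hq).exists_isPolyline (by rintro _ ⟨l, h⟩; exact h.dist_le)

end Terrain

/-! ### The zigzag controller and its computability -/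

/-- The transition function of the controller. A control state `(m, i, k)` consists of the phase
`m`, the number `i` of obstacles already passed and the number `k` of failed attempts to get around
the current obstacle. In phase `0` the agent goes straight to the target. Having been stopped, it
follows the boundary for distance `2 ^ k / 2 ^ i`, counterclockwise in phase `1` and clockwise in
phase `3`; if it does not reach the line to the target, it goes back in phase `2` or `4`. -/
def controlStep (c : ℕ × ℕ × ℕ) (stopped : Bool) : ℕ × ℕ × ℕ :=
  if c.1 = 0 then bif stopped then (1, c.2.1, 0) else c
  else if c.1 = 1 then bif stopped then (0, c.2.1 + 1, 0) else (2, c.2)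
  else if c.1 = 2 then (3, c.2)
  else if c.1 = 3 then bif stopped then (0, c.2.1 + 1, 0) else (4, c.2)
  else (1, c.2.1, c.2.2 + 1)

/-- The instruction issued in a control state, when the target has the rational coordinates
`(a, b) / (m + 1)` given by `e`. -/
def controlInstruction (e : (ℕ × ℕ) × (ℕ × ℕ) × ℕ) (c : ℕ × ℕ × ℕ) : Instruction :=
  if c.1 = 0 then Sum.inl e
  else Sum.inr (decide (c.1 = 1 ∨ c.1 = 4), 2 ^ c.2.2, 2 ^ c.2.1 - 1, e.1, e.2.1)

/-- The natural number with the given binary digits, least significant digit first. -/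
def binaryValue (s : List Bool) : ℕ := s.foldr (fun b n => (bif b then 1 else 0) + 2 * n) 0

/-- The rational target encoded by an advice string. -/
def decodeTarget (s : List Bool) : (ℕ × ℕ) × (ℕ × ℕ) × ℕ :=
  ((binaryValue s).unpair.1.unpair, (binaryValue s).unpair.2.unpair.1.unpair,
    (binaryValue s).unpair.2.unpair.2)

/-- The strategy that goes straight to the target encoded by the advice and gets around the
obstacles on the way by a zigzag. -/
noncomputable def zigzagStrategy : Strategy := fun s l =>
  match l.getLast? with
  | none => .free 0
  | some o => (controlInstruction (decodeTarget s)
      ((l.map Observation.stopped).foldl controlStep (0, 0, 0))).toMove o.offset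

lemma primrec_controlStep : Primrec₂ controlStep := by
  have fstP : Primrec fun x : (ℕ × ℕ × ℕ) × Bool => x.1.1 := Primrec.fst.comp Primrec.fst
  have sndP : Primrec fun x : (ℕ × ℕ × ℕ) × Bool => x.1.2 := Primrec.snd.comp Primrec.fst
  have iP : Primrec fun x : (ℕ × ℕ × ℕ) × Bool => x.1.2.1 := Primrec.fst.comp sndP
  have kP : Primrec fun x : (ℕ × ℕ × ℕ) × Bool => x.1.2.2 := Primrec.snd.comp sndP
  have bP : Primrec fun x : (ℕ × ℕ × ℕ) × Bool => x.2 := Primrec.snd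
  have isP : ∀ m : ℕ, PrimrecPred fun x : (ℕ × ℕ × ℕ) × Bool => x.1.1 = m := fun m =>
    Primrec.eq.comp fstP (Primrec.const m)
  have passed : Primrec fun x : (ℕ × ℕ × ℕ) × Bool => ((0, x.1.2.1 + 1, 0) : ℕ × ℕ × ℕ) :=
    (Primrec.const 0).pair ((Primrec.succ.comp iP).pair (Primrec.const 0))
  have goto : ∀ m : ℕ, Primrec fun x : (ℕ × ℕ × ℕ) × Bool => ((m, x.1.2) : ℕ × ℕ × ℕ) := fun m =>
    (Primrec.const m).pair sndP
  exact Primrec.ite (isP 0) (Primrec.cond bP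
      ((Primrec.const 1).pair (iP.pair (Primrec.const 0))) Primrec.fst)
    (Primrec.ite (isP 1) (Primrec.cond bP passed (goto 2))
      (Primrec.ite (isP 2) (goto 3)
        (Primrec.ite (isP 3) (Primrec.cond bP passed (goto 4))
          ((Primrec.const 1).pair (iP.pair (Primrec.succ.comp kP))))))

lemma primrec_pow_two : Primrec fun n : ℕ => 2 ^ n := by
  have : Primrec fun n : ℕ => Nat.rec (motive := fun _ => ℕ) 1 (fun _ m => 2 * m) n :=
    Primrec.nat_rec₁ 1 ((Primrec.nat_mul.comp (Primrec.const 2) Primrec.snd).to₂)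
  refine this.of_eq fun n => ?_
  induction n with
  | zero => rfl
  | succ n ih => rw [pow_succ, mul_comm, ← ih]

lemma primrec_controlInstruction : Primrec₂ controlInstruction := by
  have mP : Primrec fun x : ((ℕ × ℕ) × (ℕ × ℕ) × ℕ) × (ℕ × ℕ × ℕ) => x.2.1 :=
    Primrec.fst.comp Primrec.snd
  have isP : ∀ m : ℕ, PrimrecPred fun x : ((ℕ × ℕ) × (ℕ × ℕ) × ℕ) × (ℕ × ℕ × ℕ) => x.2.1 = m :=
    fun m => Primrec.eq.comp mP (Primrec.const m)
  have iP : Primrec fun x : ((ℕ × ℕ) × (ℕ × ℕ) × ℕ) × (ℕ × ℕ × ℕ) => x.2.2.1 :=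
    Primrec.fst.comp (Primrec.snd.comp Primrec.snd)
  have kP : Primrec fun x : ((ℕ × ℕ) × (ℕ × ℕ) × ℕ) × (ℕ × ℕ × ℕ) => x.2.2.2 :=
    Primrec.snd.comp (Primrec.snd.comp Primrec.snd)
  refine Primrec.ite (isP 0) (Primrec.sumInl.comp Primrec.fst) (Primrec.sumInr.comp ?_)
  refine (((isP 1).or (isP 4)).decide).pair ((primrec_pow_two.comp kP).pair
    ((Primrec.nat_sub.comp (primrec_pow_two.comp iP) (Primrec.const 1)).pair
      ((Primrec.fst.comp Primrec.fst).pair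
        (Primrec.fst.comp (Primrec.snd.comp Primrec.fst)))))

lemma primrec_binaryValue : Primrec binaryValue := by
  refine Primrec.list_foldr (h := fun _ x => (bif x.1 then 1 else 0) + 2 * x.2) Primrec.id
    (Primrec.const 0) ?_
  have bP : Primrec fun x : List Bool × Bool × ℕ => x.2.1 := Primrec.fst.comp Primrec.snd
  have nP : Primrec fun x : List Bool × Bool × ℕ => x.2.2 := Primrec.snd.comp Primrec.snd
  exact Primrec.nat_add.comp (Primrec.cond bP (Primrec.const 1) (Primrec.const 0))
    (Primrec.nat_mul.comp (Primrec.const 2) nP)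

lemma primrec_decodeTarget : Primrec decodeTarget := by
  have u : Primrec fun s => (binaryValue s).unpair := Primrec.unpair.comp primrec_binaryValue
  have u2 : Primrec fun s => (binaryValue s).unpair.2.unpair :=
    Primrec.unpair.comp (Primrec.snd.comp u)
  exact (Primrec.unpair.comp (Primrec.fst.comp u)).pair
    ((Primrec.unpair.comp (Primrec.fst.comp u2)).pair (Primrec.snd.comp u2))

lemma isComputable_zigzagStrategy : zigzagStrategy.IsComputable := by
  refine ⟨fun s bits => controlInstruction (decodeTarget s) (bits.foldl controlStep (0, 0, 0)),
    Primrec₂.to_comp ?_, fun s h o => ?_⟩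
  · refine primrec_controlInstruction.comp (primrec_decodeTarget.comp Primrec.fst) ?_
    refine Primrec.list_foldl (h := fun _ x => controlStep x.1 x.2) Primrec.snd
      (Primrec.const (0, 0, 0)) ?_
    exact primrec_controlStep.comp (Primrec.fst.comp Primrec.snd) (Primrec.snd.comp Primrec.snd)
  · simp [zigzagStrategy]

/-- Every natural number below `2 ^ N` has a binary string of length `N`. -/
lemma exists_binaryValue_eq (N : ℕ) : ∀ X < 2 ^ N, ∃ s : List Bool, s.length = N ∧
    binaryValue s = X := by
  induction N with
  | zero => intro X hX; exact ⟨[], rfl, by simp at hX; simp [binaryValue, hX]⟩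
  | succ N ih =>
    intro X hX
    obtain ⟨s, hs, hv⟩ := ih (X / 2) (by rw [pow_succ] at hX; omega)
    refine ⟨decide (X % 2 = 1) :: s, by simp [hs], ?_⟩
    change (bif decide (X % 2 = 1) then 1 else 0) + 2 * binaryValue s = X
    rw [hv]
    rcases Nat.mod_two_eq_zero_or_one X with h | h <;> simp [h] <;> omega

/-! ### Runs of the zigzag strategy -/

/-- The direction of the line to the target, as an integral vector. -/
noncomputable def lineDirection (e : (ℕ × ℕ) × (ℕ × ℕ) × ℕ) : ℂ :=
  (pairInt e.1 : ℂ) + (pairInt e.2.1 : ℂ) * Complex.I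

/-- The target, in coordinates centered at the initial position. -/
noncomputable def targetOffset (e : (ℕ × ℕ) × (ℕ × ℕ) × ℕ) : ℂ :=
  lineDirection e / ((e.2.2 : ℂ) + 1)

/-- The views at the points of the line through the initial position with direction `w`. -/
def onLine (w : ℂ) : Set View := {V | cross w V.offset = 0}

lemma controlInstruction_free (e : (ℕ × ℕ) × (ℕ × ℕ) × ℕ) (c : ℕ × ℕ) (o : ℂ) :
    (controlInstruction e (0, c)).toMove o = .free (targetOffset e - o) := rfl

lemma controlInstruction_follow (e : (ℕ × ℕ) × (ℕ × ℕ) × ℕ) {m : ℕ} (hm : m ≠ 0) (i k : ℕ)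
    (o : ℂ) : (controlInstruction e (m, i, k)).toMove o =
      .follow (decide (m = 1 ∨ m = 4)) (2 ^ k / 2 ^ i) (onLine (lineDirection e)) := by
  have h : ((2 ^ i - 1 : ℕ) : ℝ) + 1 = 2 ^ i := by
    have : 1 ≤ 2 ^ i := Nat.one_le_two_pow
    push_cast [Nat.cast_sub this]; ring
  simp only [controlInstruction, hm, if_false, Instruction.toMove, h]
  push_cast
  rfl

namespace Terrain

variable {T : Terrain} {p q : ℂ}

lemma step_free_unstopped {σ : State} {v : ℂ} (h : T.reach σ.pos v = 1) :
    T.Step p σ (.free v) ⟨σ.pos + v, none, ‖v‖, false⟩ fun t => σ.pos + (t / ‖v‖) • v := by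
  simp [Step, h]

lemma step_free_stopped {σ : State} {v : ℂ} {P : ConvexPolygon} (h : T.reach σ.pos v < 1)
    (hP : T.Blocks P (σ.pos + T.reach σ.pos v • v) v) :
    T.Step p σ (.free v) ⟨σ.pos + T.reach σ.pos v • v, some P, T.reach σ.pos v * ‖v‖, true⟩
      fun t => σ.pos + (t / ‖v‖) • v :=
  ⟨fun _ => rfl, rfl, rfl, Or.inl ⟨h, rfl, P, rfl, hP⟩⟩

/-- A boundary move that reaches the chosen line, for the first time at time `t`. -/
lemma step_follow_hit {σ : State} {P : ConvexPolygon} {β : ℝ → ℂ} {ccw : Bool} {d t : ℝ} {w : ℂ}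
    (hP : σ.contact = some P) (hβ : P.IsBoundaryParam β) (h0 : β 0 = σ.pos) (ht : 0 < t)
    (htd : t ≤ d) (hz : cross w (ConvexPolygon.travel β ccw t - p) = 0)
    (hfirst : ∀ s, 0 < s → s < t → cross w (ConvexPolygon.travel β ccw s - p) ≠ 0) :
    T.Step p σ (.follow ccw d (onLine w)) ⟨ConvexPolygon.travel β ccw t, some P, t, true⟩
      (ConvexPolygon.travel β ccw) := by
  refine Or.inl ⟨P, hP, ⟨β, hβ, h0, fun _ => rfl⟩, Or.inl ⟨rfl, ⟨t, ht, htd, hz⟩, ?_⟩, rfl, rfl⟩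
  have hleast : IsLeast {s : ℝ | 0 < s ∧ s ≤ d ∧
      T.view p (ConvexPolygon.travel β ccw s) ∈ onLine w} t := by
    refine ⟨⟨ht, htd, hz⟩, ?_⟩
    rintro s ⟨hs, -, hsz⟩
    by_contra hlt
    exact hfirst s hs (not_le.1 hlt) hsz
  exact hleast.csInf_eq.symm

/-- A boundary move that does not reach the chosen line. -/
lemma step_follow_miss {σ : State} {P : ConvexPolygon} {β : ℝ → ℂ} {ccw : Bool} {d : ℝ} {w : ℂ}
    (hP : σ.contact = some P) (hβ : P.IsBoundaryParam β) (h0 : β 0 = σ.pos) (hd : 0 ≤ d)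
    (hne : ∀ s, 0 < s → s ≤ d → cross w (ConvexPolygon.travel β ccw s - p) ≠ 0) :
    T.Step p σ (.follow ccw d (onLine w)) ⟨ConvexPolygon.travel β ccw d, some P, d, false⟩
      (ConvexPolygon.travel β ccw) := by
  refine Or.inl ⟨P, hP, ⟨β, hβ, h0, fun _ => rfl⟩, Or.inr ⟨rfl, ?_, (max_eq_left hd).symm⟩,
    rfl, rfl⟩
  rintro ⟨t, h1, h2, h3⟩
  exact hne t h1 h2 h3

/-- After a boundary move that left the line and did not reach it again, the boundary move in the
opposite direction leads back to the starting point. -/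
lemma step_follow_back {σ σ' : State} {P : ConvexPolygon} {β : ℝ → ℂ} {ccw ccw' : Bool} {d : ℝ}
    {w : ℂ} (hP : σ'.contact = some P) (hβ : P.IsBoundaryParam β) (h0 : β 0 = σ.pos) (hd : 0 < d)
    (hpos : σ'.pos = ConvexPolygon.travel β ccw d) (hcc : ccw' = !ccw)
    (hline : cross w (σ.pos - p) = 0)
    (hne : ∀ s, 0 < s → s ≤ d → cross w (ConvexPolygon.travel β ccw s - p) ≠ 0) :
    ∃ γ, T.Step p σ' (.follow ccw' d (onLine w)) ⟨σ.pos, some P, d, true⟩ γ := by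
  subst hcc
  set β' : ℝ → ℂ := fun t => β (t + if ccw = true then d else -d) with hβ'
  have htr : ∀ t, ConvexPolygon.travel β' (!ccw) t = ConvexPolygon.travel β ccw (d - t) := by
    intro t
    cases ccw
    · simp only [ConvexPolygon.travel, hβ', Bool.not_false, if_true, Bool.false_eq_true, if_false]
      congr 1; ring
    · simp only [ConvexPolygon.travel, hβ', Bool.not_true, if_true, Bool.false_eq_true, if_false]
      congr 1; ring
  have hend : ConvexPolygon.travel β' (!ccw) d = σ.pos := by
    rw [htr, sub_self]; simp [ConvexPolygon.travel, h0]
  refine ⟨_, hend ▸ step_follow_hit hP (hβ.shift _) (β := β') ?_ hd le_rfl ?_ ?_⟩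
  · rw [hpos]; simp only [hβ', zero_add]; rfl
  · rw [hend]; exact hline
  · intro s h1 h2
    rw [htr]
    exact hne _ (by linarith) (by linarith)

/-- From the control state `c` and the state `σ₀` on, the agent executing the zigzag towards the
target `e` sees the treasure at cost at most `B`. -/
def Wins (T : Terrain) (p q : ℂ) (e : (ℕ × ℕ) × (ℕ × ℕ) × ℕ) (c : ℕ × ℕ × ℕ) (σ₀ : State)
    (B : ℝ) : Prop :=
  ∃ (cs : ℕ → ℕ × ℕ × ℕ) (σ : ℕ → State) (γ : ℕ → ℝ → ℂ), cs 0 = c ∧ σ 0 = σ₀ ∧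
    (∀ n, cs (n + 1) = controlStep (cs n) (σ (n + 1)).stopped ∧
      T.Step p (σ n) ((controlInstruction e (cs n)).toMove ((σ n).pos - p)) (σ (n + 1)) (γ n)) ∧
    ∃ (n : ℕ) (t : ℝ), 0 ≤ t ∧ t ≤ (σ (n + 1)).travelled ∧ T.Sees (γ n t) q ∧
      (∑ m ∈ Finset.range n, (σ (m + 1)).travelled) + t ≤ B

variable {e : (ℕ × ℕ) × (ℕ × ℕ) × ℕ} {c : ℕ × ℕ × ℕ} {σ₀ : State}

lemma Wins.mono {B B' : ℝ} (h : T.Wins p q e c σ₀ B) (hB : B ≤ B') : T.Wins p q e c σ₀ B' := by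
  obtain ⟨cs, σ, γ, h1, h2, h3, n, t, h4, h5, h6, h7⟩ := h
  exact ⟨cs, σ, γ, h1, h2, h3, n, t, h4, h5, h6, h7.trans hB⟩

lemma Wins.of_step {σ' : State} {γ₀ : ℝ → ℂ} {B : ℝ}
    (hs : T.Step p σ₀ ((controlInstruction e c).toMove (σ₀.pos - p)) σ' γ₀)
    (h : T.Wins p q e (controlStep c σ'.stopped) σ' B) :
    T.Wins p q e c σ₀ (σ'.travelled + B) := by
  obtain ⟨cs, σ, γ, h1, h2, h3, n, t, h4, h5, h6, h7⟩ := h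
  refine ⟨fun n => Nat.casesOn n c cs, fun n => Nat.casesOn n σ₀ σ, fun n => Nat.casesOn n γ₀ γ,
    rfl, rfl, ?_, n + 1, t, h4, h5, h6, ?_⟩
  · rintro (_ | n)
    · refine ⟨?_, ?_⟩
      · change cs 0 = controlStep c (σ 0).stopped
        rw [h1, h2]
      · change T.Step p σ₀ _ (σ 0) γ₀
        rw [h2]; exact hs
    · exact h3 n
  · rw [Finset.sum_range_succ']
    change ∑ m ∈ Finset.range n, (σ (m + 1)).travelled + (σ 0).travelled + t ≤ _
    rw [h2]; linarith

/-- An agent at the target stays there forever. -/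
lemma wins_of_sees {i k : ℕ} (hpos : σ₀.pos = p + targetOffset e) (hmem : σ₀.pos ∈ T.carrier)
    (hsees : T.Sees σ₀.pos q) : T.Wins p q e (0, i, k) σ₀ 0 := by
  have hreach : T.reach σ₀.pos 0 = 1 :=
    le_antisymm (reach_le_one _ _) (le_reach zero_le_one le_rfl fun s _ _ => by simpa using hmem)
  have hmove : ∀ σ : State, σ.pos = σ₀.pos →
      T.Step p σ ((controlInstruction e (0, i, k)).toMove (σ.pos - p))
        ⟨σ₀.pos, none, 0, false⟩ fun _ => σ₀.pos := by
    intro σ hσ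
    have h1 : targetOffset e - (σ.pos - p) = 0 := by rw [hσ, hpos]; ring
    rw [controlInstruction_free, h1]
    have := step_free_unstopped (p := p) (σ := σ) (v := 0) (by rw [hσ]; exact hreach)
    simpa [hσ] using this
  refine ⟨fun _ => (0, i, k), fun n => Nat.casesOn n σ₀ fun _ => ⟨σ₀.pos, none, 0, false⟩,
    fun _ _ => σ₀.pos, rfl, rfl, ?_, 0, 0, le_rfl, le_rfl, hsees, by simp⟩
  rintro (_ | n)
  · exact ⟨rfl, hmove σ₀ rfl⟩
  · exact ⟨rfl, hmove _ rfl⟩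

/-- One round of the zigzag, with attempts of length `d` in both directions: either one of them
leads around the obstacle, or both fail and the agent, back at the entry point, starts the next
round. -/
lemma wins_round {P : ConvexPolygon} {v x : ℂ} {τ B B' : ℝ} {i k : ℕ} (hch : P.IsChord v x τ)
    {β : ℝ → ℂ} (hβ : P.IsBoundaryParam β) (hβ0 : β 0 = x)
    (hline : ∀ z, cross (lineDirection e) (z - p) = 0 ↔ cross v (z - x) = 0)
    (hnext : ∀ σ : State, σ.pos = x + τ • v → T.Wins p q e (0, i + 1, 0) σ B) (hB : B ≤ B')
    (hagain : (∀ ccw s, 0 < s → s ≤ (2 : ℝ) ^ k / 2 ^ i →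
        cross v (ConvexPolygon.travel β ccw s - x) ≠ 0) →
      ∀ σ : State, σ.pos = x → σ.contact = some P → T.Wins p q e (1, i, k + 1) σ B')
    {σ : State} (hσ : σ.pos = x) (hc : σ.contact = some P) :
    T.Wins p q e (1, i, k) σ (4 * (2 ^ k / 2 ^ i) + B') := by
  have hxl : cross (lineDirection e) (σ.pos - p) = 0 :=
    (hline _).2 (by rw [hσ, sub_self, cross_zero_right])
  have hβσ : β 0 = σ.pos := by rw [hσ, hβ0]
  set d : ℝ := 2 ^ k / 2 ^ i with hd
  have hd0 : 0 < d := by positivity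
  rcases hch.travel_cases hβ true hβ0 d with ⟨t, ht, htd, hz, hy, hf⟩ | hmiss
  · have hst := step_follow_hit (T := T) (p := p) (σ := σ) (w := lineDirection e) hc hβ hβσ
      ht htd ((hline _).2 hz) fun s h1 h2 => mt (hline _).1 (hf s h1 h2)
    refine (Wins.of_step (by rw [controlInstruction_follow e one_ne_zero]; exact hst)
      (hnext _ hy)).mono ?_
    change t + B ≤ _
    linarith
  have hmiss' : ∀ s, 0 < s → s ≤ d →
      cross (lineDirection e) (ConvexPolygon.travel β true s - p) ≠ 0 :=
    fun s h1 h2 => mt (hline _).1 (hmiss s h1 h2)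
  have hst1 := step_follow_miss (T := T) (p := p) (σ := σ) (w := lineDirection e) hc hβ hβσ
    hd0.le hmiss'
  obtain ⟨γ2, hst2⟩ := step_follow_back (T := T) (p := p) (σ := σ)
    (σ' := ⟨ConvexPolygon.travel β true d, some P, d, false⟩) (ccw' := false) rfl hβ hβσ
    hd0 rfl rfl hxl hmiss'
  have prepend : ∀ {B'}, T.Wins p q e (3, i, k) ⟨σ.pos, some P, d, true⟩ B' →
      T.Wins p q e (1, i, k) σ (d + (d + B')) := by
    intro B' h3
    have h2 := Wins.of_step (e := e) (c := (2, i, k)) (by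
      rw [controlInstruction_follow e (by norm_num)]; exact hst2) h3
    exact Wins.of_step (e := e) (c := (1, i, k)) (by
      rw [controlInstruction_follow e (by norm_num)]; exact hst1) h2
  rcases hch.travel_cases hβ false hβ0 d with ⟨t, ht, htd, hz, hy, hf⟩ | hmiss2
  · have hst3 := step_follow_hit (T := T) (p := p) (σ := ⟨σ.pos, some P, d, true⟩)
      (w := lineDirection e) rfl hβ hβσ ht htd ((hline _).2 hz)
      fun s h1 h2 => mt (hline _).1 (hf s h1 h2)
    have h3 := Wins.of_step (e := e) (c := (3, i, k)) (by
      rw [controlInstruction_follow e (by norm_num)]; exact hst3) (hnext _ hy)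
    refine (prepend h3).mono ?_
    change d + (d + (t + B)) ≤ _
    linarith
  have hmiss2' : ∀ s, 0 < s → s ≤ d →
      cross (lineDirection e) (ConvexPolygon.travel β false s - p) ≠ 0 :=
    fun s h1 h2 => mt (hline _).1 (hmiss2 s h1 h2)
  have hst3 := step_follow_miss (T := T) (p := p) (σ := ⟨σ.pos, some P, d, true⟩)
    (w := lineDirection e) rfl hβ hβσ hd0.le hmiss2'
  obtain ⟨γ4, hst4⟩ := step_follow_back (T := T) (p := p) (σ := σ)
    (σ' := ⟨ConvexPolygon.travel β false d, some P, d, false⟩) (ccw' := true) rfl hβ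
    hβσ hd0 rfl rfl hxl hmiss2'
  have h5 := hagain (by rintro (_ | _) <;> assumption) ⟨σ.pos, some P, d, true⟩ hσ rfl
  have h4 := Wins.of_step (e := e) (c := (4, i, k)) (by
    rw [controlInstruction_follow e (by norm_num)]; exact hst4) h5
  have h3 := Wins.of_step (e := e) (c := (3, i, k)) (by
    rw [controlInstruction_follow e (by norm_num)]; exact hst3) h4
  refine (prepend h3).mono ?_
  change d + (d + (d + (d + B'))) ≤ _
  linarith

/-- The agent gets around an obstacle, at cost proportional to the length `G` of the shorter arc:
the lengths of the attempts grow geometrically, until they exceed `G`. -/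
lemma wins_zigzag {P : ConvexPolygon} {v x : ℂ} {τ G B : ℝ} {i K : ℕ} (hch : P.IsChord v x τ)
    (hx : x ∈ P.region) (hx' : x ∉ P.inner)
    (hline : ∀ z, cross (lineDirection e) (z - p) = 0 ↔ cross v (z - x) = 0)
    (hgood : ∃ ccw : Bool, ∀ β, P.IsBoundaryParam β → β 0 = x →
      ∃ t, 0 < t ∧ t ≤ G ∧ cross v (ConvexPolygon.travel β ccw t - x) = 0)
    (hK : G ≤ 2 ^ K / 2 ^ i)
    (hnext : ∀ σ : State, σ.pos = x + τ • v → T.Wins p q e (0, i + 1, 0) σ B) :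
    ∀ j k, k + j = K → ∀ σ : State, σ.pos = x → σ.contact = some P →
      T.Wins p q e (1, i, k) σ (4 / 2 ^ i * (2 ^ (K + 1) - 2 ^ k) + B) := by
  obtain ⟨β, hβ, hβ0⟩ := ConvexPolygon.exists_isBoundaryParam hx hx'
  intro j
  induction j with
  | zero =>
    intro k hk σ hσ hc
    have hk' : k = K := by omega
    refine (wins_round hch hβ hβ0 hline hnext le_rfl (fun hmiss => ?_) hσ hc).mono (le_of_eq ?_)
    · obtain ⟨ccw, hg⟩ := hgood
      obtain ⟨t, h1, h2, h3⟩ := hg β hβ hβ0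
      exact absurd h3 (hmiss ccw t h1 (by rw [hk']; exact h2.trans hK))
    · rw [← hk']; field_simp; ring
  | succ j ih =>
    intro k hk σ hσ hc
    have hle : 0 ≤ 4 / 2 ^ i * ((2 : ℝ) ^ (K + 1) - 2 ^ (k + 1)) := by
      have : (2 : ℝ) ^ (k + 1) ≤ 2 ^ (K + 1) := pow_le_pow_right₀ (by norm_num) (by omega)
      exact mul_nonneg (by positivity) (by linarith)
    refine (wins_round hch hβ hβ0 hline hnext (le_add_of_nonneg_left hle)
      (fun _ => ih (k + 1) (by omega)) hσ hc).mono (le_of_eq ?_)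
    field_simp; ring

/-- The first of the lengths `2 ^ K / 2 ^ i`, `K ≥ 0`, that is at least `G` is at most
`2 ^ (-i) + 2 G`. -/
lemma exists_scale (G : ℝ) (i : ℕ) :
    ∃ K : ℕ, G ≤ 2 ^ K / 2 ^ i ∧ (2 : ℝ) ^ K / 2 ^ i ≤ 1 / 2 ^ i + 2 * max G 0 := by
  classical
  have hex : ∃ K : ℕ, G ≤ 2 ^ K / 2 ^ i := by
    obtain ⟨K, hK⟩ := pow_unbounded_of_one_lt (G * 2 ^ i) (one_lt_two : (1 : ℝ) < 2)
    exact ⟨K, by rw [le_div_iff₀ (by positivity)]; exact hK.le⟩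
  refine ⟨Nat.find hex, Nat.find_spec hex, ?_⟩
  rcases hn : Nat.find hex with _ | n
  · have := le_max_right G 0
    simp only [pow_zero]; linarith
  · have h := Nat.find_min hex (m := n) (by omega)
    push Not at h
    have h2 : (2 : ℝ) ^ (n + 1) / 2 ^ i = 2 * (2 ^ n / 2 ^ i) := by ring
    have h3 : (0 : ℝ) < 1 / 2 ^ i := by positivity
    have := le_max_left G 0
    linarith

/-- The cost of the zigzag strategy: all detours together cost at most a multiple of the distance
to the target, plus a bounded amount, as the first attempt at the obstacle number `i` has length
`2 ^ (-i)`. -/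
theorem wins_from_line {c : ℝ} (hc : 0 < c) (hT : T.IsRegular c)
    (hq' : p + targetOffset e ∈ T.carrier) (hsees : T.Sees (p + targetOffset e) q) :
    ∀ x ∈ T.carrier, (∃ s : ℝ, x = p + s • lineDirection e) → ∀ i (σ : State), σ.pos = x →
      T.Wins p q e (0, i, 0) σ
        ((1 + 272 * c ^ 2) * dist x (p + targetOffset e) + 16 / 2 ^ i) := by
  set q' := p + targetOffset e with hq'def
  have hmoveto : ∀ (i : ℕ) (x : ℂ),
      (controlInstruction e (0, i, 0)).toMove (x - p) = .free (q' - x) := by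
    intro i x
    rw [controlInstruction_free, hq'def]; congr 1; ring
  refine line_induction hq' ?_ ?_
  · intro x hx h _ i σ hσ
    have hst := step_free_unstopped (p := p) (σ := σ) (v := q' - x) (by rw [hσ]; exact h)
    rw [hσ, add_sub_cancel] at hst
    have hw := wins_of_sees (T := T) (p := p) (q := q) (e := e) (i := i) (k := 0)
      (σ₀ := ⟨q', none, ‖q' - x‖, false⟩) hq'def hq' hsees
    refine (Wins.of_step (e := e) (c := (0, i, 0)) (by rw [hσ, hmoveto]; exact hst) hw).mono ?_
    change ‖q' - x‖ + 0 ≤ _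
    rw [dist_comm, dist_eq_norm]
    have : 0 ≤ 272 * c ^ 2 * ‖q' - x‖ := by positivity
    have : (0 : ℝ) < 16 / 2 ^ i := by positivity
    linarith
  · intro x hx r hr hr1 j τ hbl hreg hinn hch hrτ hyi ih hxs i σ hσ
    obtain ⟨s, hs⟩ := hxs
    set v := q' - x with hv
    set x1 := x + r • v with hx1
    set y := x1 + τ • v with hy
    have hr0 : 0 ≤ r := by rw [← hr]; exact reach_nonneg _ _
    have hτ0 := hch.pos
    have hv0 : v ≠ 0 := hch.direction_ne_zero
    -- the direction of motion is a multiple of the direction of the line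
    obtain ⟨μ, hμ⟩ : ∃ μ : ℝ, v = μ • lineDirection e := by
      refine ⟨1 / ((e.2.2 : ℝ) + 1) - s, ?_⟩
      rw [hv, hq'def, hs, targetOffset]
      simp only [Complex.real_smul]; push_cast; ring
    have hμ0 : μ ≠ 0 := by rintro rfl; exact hv0 (by rw [hμ, zero_smul])
    have hline : ∀ z, cross (lineDirection e) (z - p) = 0 ↔ cross v (z - x1) = 0 := by
      intro z
      have e1 : z - p = (z - x1) + (s + r * μ) • lineDirection e := by
        rw [hx1, hs, hμ, smul_smul]
        simp only [Complex.real_smul]; push_cast; ring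
      rw [e1, cross_add_right, cross_smul_right, cross_self_eq_zero, mul_zero, add_zero, hμ,
        cross_smul_left, mul_eq_zero, or_iff_right hμ0]
    have hyline : ∃ s : ℝ, y = p + s • lineDirection e := by
      refine ⟨s + r * μ + τ * μ, ?_⟩
      rw [hy, hx1, hμ, hs]
      simp only [Complex.real_smul]; push_cast; ring
    set G := 17 * c ^ 2 * (τ * ‖v‖) with hG
    have hG0 : 0 ≤ G := by positivity
    obtain ⟨K, hK1, hK2⟩ := exists_scale G i
    rw [max_eq_left hG0] at hK2
    have hzz := wins_zigzag (T := T) (q := q) hch hreg hinn hline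
      (hch.exists_short_arc hc (hT j)) hK1 (fun σ' hσ' => ih hyline (i + 1) σ' hσ') K 0 (by omega)
      ⟨x1, some (T.obstacle j), r * ‖v‖, true⟩ rfl rfl
    have hst := step_free_stopped (p := p) (σ := σ) (v := v) (P := T.obstacle j)
      (by rw [hσ, hr]; exact hr1) (by rw [hσ, hr]; exact hbl)
    rw [hσ, hr] at hst
    refine (Wins.of_step (e := e) (c := (0, i, 0)) (by rw [hσ, hmoveto]; exact hst) hzz).mono ?_
    change r * ‖v‖ + _ ≤ _
    have hdy : dist y q' = (1 - r - τ) * ‖v‖ := by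
      have : y - q' = (-(1 - r - τ)) • v := by
        rw [hy, hx1, hv]; simp only [Complex.real_smul]; push_cast; ring
      rw [dist_eq_norm, this, norm_smul, norm_neg, Real.norm_of_nonneg (by linarith)]
    have hdx : dist x q' = ‖v‖ := by rw [dist_comm, dist_eq_norm]
    rw [hdy, hdx]
    have hpow : (4 : ℝ) / 2 ^ i * (2 ^ (K + 1) - 2 ^ 0) ≤ 8 * (2 ^ K / 2 ^ i) := by
      have : (0 : ℝ) < 4 / 2 ^ i := by positivity
      have e1 : (4 : ℝ) / 2 ^ i * (2 ^ (K + 1) - 2 ^ 0)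
        = 8 * (2 ^ K / 2 ^ i) - 4 / 2 ^ i := by rw [pow_succ]; ring
      linarith
    -- the detour costs at most `8 * (2⁻ⁱ + 2 G)`; the first part is paid by halving `16 / 2 ^ i`,
    -- the second one, `16 * 17 c²` times the chord, by the advance along the line
    have hhalf : (16 : ℝ) / 2 ^ (i + 1) = 8 * (1 / 2 ^ i) := by rw [pow_succ]; field_simp; norm_num
    have h16 : (16 : ℝ) / 2 ^ i = 16 * (1 / 2 ^ i) := by ring
    rw [hhalf, h16]
    have hc2 : 0 ≤ 272 * c ^ 2 * (r * ‖v‖) := by positivity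
    have hτv : 0 ≤ τ * ‖v‖ := by positivity
    rw [hG] at hK2
    nlinarith

end Terrain

/-! ### Advice of logarithmic size suffices -/

namespace Terrain

variable {T : Terrain} {p q : ℂ}

/-- The control state is recovered from the sequence of the bits `stopped`. -/
lemma finds_of_wins {s : List Bool} {B : ℝ}
    (h : T.Wins p q (decodeTarget s) (0, 0, 0) ⟨p, none, 0, false⟩ B) :
    T.Finds p q zigzagStrategy s B := by
  obtain ⟨cs, σ, γ, h1, h2, h3, h4⟩ := h
  refine ⟨σ, γ, ⟨h2, fun n => ?_⟩, h4⟩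
  have hfold : ∀ n, (((List.range (n + 1)).map fun m => T.observe p (σ m)).map
      Observation.stopped).foldl controlStep (0, 0, 0) = cs n := by
    intro n
    induction n with
    | zero => simp [observe, h1, h2, controlStep]
    | succ n ih =>
      rw [List.range_succ, List.map_append, List.map_append, List.foldl_append, ih, (h3 n).1]
      rfl
  have hmove : zigzagStrategy s ((List.range (n + 1)).map fun m => T.observe p (σ m))
      = (controlInstruction (decodeTarget s) (cs n)).toMove ((σ n).pos - p) := by
    rw [← hfold n, zigzagStrategy, List.range_succ]
    simp [observe, view]
  rw [hmove]
  exact (h3 n).2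

lemma accessibility_pos (hq : q ∈ interior T.carrier) : 0 < T.accessibility q := by
  obtain ⟨ε, hε, hb⟩ := Metric.mem_nhds_iff.1 (mem_interior_iff_mem_nhds.1 hq)
  have hpos : 0 < min (ε / 2) 1 := lt_min (by linarith) one_pos
  refine hpos.trans_le (le_csSup ⟨1, fun _ h => h.2.1⟩ ⟨hpos.le, min_le_right _ _, ?_⟩)
  exact (Metric.closedBall_subset_ball ((min_le_left _ _).trans_lt (by linarith))).trans hb

lemma accessibility_le_one : T.accessibility q ≤ 1 :=
  Real.sSup_le (fun _ h => h.2.1) zero_le_one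

lemma closedBall_subset_of_lt_accessibility {r : ℝ} (h0 : 0 ≤ r) (h : r < T.accessibility q) :
    Metric.closedBall q r ⊆ T.carrier := by
  have hne : {r : ℝ | 0 ≤ r ∧ r ≤ 1 ∧ Metric.closedBall q r ⊆ T.carrier}.Nonempty := by
    by_contra hcon
    rw [Set.not_nonempty_iff_eq_empty] at hcon
    rw [accessibility, hcon, Real.sSup_empty] at h
    linarith
  obtain ⟨r', hr', hlt⟩ := exists_lt_of_lt_csSup hne h
  exact (Metric.closedBall_subset_closedBall hlt.le).trans hr'.2.2

end Terrain

lemma pair_lt_two_pow {x y N : ℕ} (hx : x < 2 ^ N) (hy : y < 2 ^ N) :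
    Nat.pair x y < 2 ^ (2 * N) := by
  refine (Nat.pair_lt_max_add_one_sq x y).trans_le ?_
  rw [mul_comm, pow_mul]
  exact Nat.pow_le_pow_left (max_lt hx hy) 2

/-- An integer of absolute value less than `2 ^ N` is the difference of two naturals below
`2 ^ N`. -/
lemma exists_pairInt_eq {a : ℤ} {N : ℕ} (h : |a| < 2 ^ N) :
    ∃ e : ℕ × ℕ, pairInt e = a ∧ e.1 < 2 ^ N ∧ e.2 < 2 ^ N := by
  rw [abs_lt] at h
  refine ⟨((-a).toNat, a.toNat), ?_, ?_, ?_⟩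
  · simp only [pairInt]; omega
  · zify; simp only [Int.ofNat_toNat]
    rw [max_lt_iff]; constructor
    · linarith
    · positivity
  · zify; simp only [Int.ofNat_toNat]
    rw [max_lt_iff]; constructor
    · exact h.2
    · positivity

/-- A rational approximation, to precision `r`, of a vector of length at most `D` has a binary code
of size `O(log (D / r))`. -/
lemma exists_advice {w : ℂ} {D r : ℝ} (hD : 2 ≤ D) (hw : ‖w‖ ≤ D) (hr : 0 < r) (hr1 : r ≤ 1) :
    ∃ s : List Bool, (s.length : ℝ) ≤ 40 * Real.logb 2 (D / r) ∧
      ‖targetOffset (decodeTarget s) - w‖ ≤ r / 2 := by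
  set Y := D / r with hY
  have hY2 : 2 ≤ Y := by rw [hY, le_div_iff₀ hr]; linarith
  have hrinv : 1 ≤ 1 / r := by rw [le_div_iff₀ hr]; linarith
  have hYr : Y = D * (1 / r) := by rw [hY]; ring
  obtain ⟨N, hN1, hN2⟩ : ∃ N : ℕ, 6 * Y < 2 ^ N ∧ (8 * N : ℝ) ≤ 40 * Real.logb 2 Y := by
    have hlogY : 1 ≤ Real.logb 2 Y := by
      rw [Real.le_logb_iff_rpow_le one_lt_two (by linarith), Real.rpow_one]; exact hY2
    refine ⟨⌊Real.logb 2 (8 * Y)⌋₊ + 1, ?_, ?_⟩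
    · have h1 := Nat.lt_floor_add_one (Real.logb 2 (8 * Y))
      rw [Real.logb_lt_iff_lt_rpow one_lt_two (by linarith)] at h1
      have h2 : (2 : ℝ) ^ ((⌊Real.logb 2 (8 * Y)⌋₊ : ℝ) + 1)
          = 2 ^ (⌊Real.logb 2 (8 * Y)⌋₊ + 1) := by
        rw [← Real.rpow_natCast]; push_cast; rfl
      rw [h2] at h1
      linarith
    · have h8 : Real.logb 2 (8 * Y) = 3 + Real.logb 2 Y := by
        rw [Real.logb_mul (by norm_num) (by linarith), show (8 : ℝ) = 2 ^ (3 : ℕ) by norm_num,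
          Real.logb_pow, Real.logb_self_eq_one one_lt_two]
        norm_num
      have h1 := Nat.floor_le (show 0 ≤ Real.logb 2 (8 * Y) by rw [h8]; linarith)
      rw [h8] at h1 ⊢
      push_cast
      linarith
  obtain ⟨m, hm⟩ : ∃ m : ℕ, m + 1 = ⌈4 / r⌉₊ :=
    ⟨⌈4 / r⌉₊ - 1, Nat.sub_add_cancel (Nat.one_le_ceil_iff.2 (by positivity))⟩
  set M : ℝ := (m : ℝ) + 1 with hM
  have hM1 : 4 / r ≤ M := by
    have : ((m + 1 : ℕ) : ℝ) = M := by push_cast; rfl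
    rw [← this, hm]; exact Nat.le_ceil _
  have hM2 : M ≤ 5 * (1 / r) := by
    have : ((m + 1 : ℕ) : ℝ) = M := by push_cast; rfl
    rw [← this, hm]
    have := (Nat.ceil_lt_add_one (show 0 ≤ 4 / r by positivity)).le
    have e1 : 4 / r = 4 * (1 / r) := by ring
    linarith
  have hM0 : 0 < M := by positivity
  have hbound : ∀ x : ℝ, |x| ≤ D → |⌊x * M⌋| < (2 : ℤ) ^ N := by
    intro x hx
    have h1 : |x * M| ≤ 5 * Y := by
      rw [abs_mul, abs_of_pos hM0, hYr]
      calc |x| * M ≤ D * (5 * (1 / r)) := by gcongr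
        _ = _ := by ring
    have h2 : |((⌊x * M⌋ : ℤ) : ℝ)| < 2 ^ N := by
      rw [abs_le] at h1
      have h3 := Int.floor_le (x * M)
      have h4 := Int.lt_floor_add_one (x * M)
      rw [abs_lt]; constructor <;> linarith
    exact_mod_cast h2
  obtain ⟨a, ha, ha1, ha2⟩ := exists_pairInt_eq (hbound w.re ((Complex.abs_re_le_norm w).trans hw))
  obtain ⟨b, hb, hb1, hb2⟩ := exists_pairInt_eq (hbound w.im ((Complex.abs_im_le_norm w).trans hw))
  have hmN : m < 2 ^ (2 * N) := by
    have h1 : (m : ℝ) < 2 ^ N := by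
      have : 5 * (1 / r) ≤ 6 * Y := by rw [hYr]; nlinarith
      linarith
    have h2 : m < 2 ^ N := by exact_mod_cast h1
    exact h2.trans_le (Nat.pow_le_pow_right two_pos (by omega))
  have hbm := pair_lt_two_pow (pair_lt_two_pow hb1 hb2) hmN
  have haN : Nat.pair a.1 a.2 < 2 ^ (2 * (2 * N)) :=
    (pair_lt_two_pow ha1 ha2).trans_le (Nat.pow_le_pow_right two_pos (by omega))
  obtain ⟨s, hs, hv⟩ := exists_binaryValue_eq _ _ (pair_lt_two_pow haN hbm)
  refine ⟨s, ?_, ?_⟩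
  · rw [hs]; push_cast; linarith
  · have hdec : decodeTarget s = (a, b, m) := by
      simp only [decodeTarget, hv, Nat.unpair_pair]
    have hMc : ((m : ℂ) + 1) = ((M : ℝ) : ℂ) := by rw [hM]; push_cast; rfl
    have hMne : (M : ℂ) ≠ 0 := by exact_mod_cast hM0.ne'
    rw [hdec, targetOffset, lineDirection]
    simp only [ha, hb, hMc]
    have hfrac : ∀ x : ℝ, |(⌊x * M⌋ : ℝ) / M - x| ≤ r / 4 := by
      intro x
      have h3 := Int.floor_le (x * M)
      have h4 := Int.lt_floor_add_one (x * M)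
      have h5 : (⌊x * M⌋ : ℝ) / M - x = ((⌊x * M⌋ : ℝ) - x * M) / M := by field_simp
      rw [h5, abs_div, abs_of_pos hM0, div_le_iff₀ hM0]
      have h6 : 1 ≤ r / 4 * M := by
        rw [div_le_iff₀ hr] at hM1; linarith
      refine le_trans ?_ h6
      rw [abs_le]; constructor <;> linarith
    refine (Complex.norm_le_abs_re_add_abs_im _).trans ?_
    have hre : (((⌊w.re * M⌋ : ℂ) + (⌊w.im * M⌋ : ℂ) * Complex.I) / (M : ℂ) - w).re
        = (⌊w.re * M⌋ : ℝ) / M - w.re := by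
      rw [Complex.sub_re, Complex.div_ofReal_re]; simp
    have him : (((⌊w.re * M⌋ : ℂ) + (⌊w.im * M⌋ : ℂ) * Complex.I) / (M : ℂ) - w).im
        = (⌊w.im * M⌋ : ℝ) / M - w.im := by
      rw [Complex.sub_im, Complex.div_ofReal_im]; simp
    rw [hre, him]
    linarith [hfrac w.re, hfrac w.im]

/-- The zigzag strategy finds the treasure at linear cost, with advice of logarithmic size. -/
theorem zigzagStrategy_finds {c : ℝ} (hc : 0 < c) {T : Terrain} (hT : T.IsRegular c) {p q : ℂ}
    (hp : p ∈ T.carrier) (hq : q ∈ interior T.carrier) :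
    ∃ s : List Bool,
      (s.length : ℝ) ≤ 40 * Real.logb 2 (max (T.pathDist p q) 2 / T.accessibility q) ∧
      T.Finds p q zigzagStrategy s ((10 + 544 * c ^ 2) * max (T.pathDist p q) 2) := by
  set D := max (T.pathDist p q) 2 with hD
  have hD2 : 2 ≤ D := le_max_right _ _
  have hacc := Terrain.accessibility_pos hq
  have hacc1 : T.accessibility q ≤ 1 := Terrain.accessibility_le_one
  have hpq : ‖q - p‖ ≤ D := by
    rw [← dist_eq_norm, dist_comm]
    exact (Terrain.dist_le_pathDist hp (interior_subset hq)).trans (le_max_left _ _)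
  obtain ⟨s, hs, hw⟩ := exists_advice hD2 hpq hacc hacc1
  refine ⟨s, hs, Terrain.finds_of_wins ?_⟩
  set e := decodeTarget s with he
  have hdist : dist (p + targetOffset e) q ≤ T.accessibility q / 2 := by
    rw [dist_eq_norm, show p + targetOffset e - q = targetOffset e - (q - p) by ring]
    exact hw
  have hball := Terrain.closedBall_subset_of_lt_accessibility (T := T) (q := q)
    (r := T.accessibility q / 2) (by linarith) (by linarith)
  have hseg : segment ℝ (p + targetOffset e) q ⊆ T.carrier :=
    ((convex_closedBall q _).segment_subset (Metric.mem_closedBall.2 hdist)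
      (Metric.mem_closedBall_self (by linarith))).trans hball
  have hwin := Terrain.wins_from_line (q := q) hc hT (hball (Metric.mem_closedBall.2 hdist))
    ⟨hseg, by linarith⟩ p hp ⟨0, by simp⟩ 0 ⟨p, none, 0, false⟩ rfl
  refine hwin.mono ?_
  have h1 : dist p (p + targetOffset e) ≤ D + 1 := by
    rw [dist_self_add_right]
    have := norm_add_le (targetOffset e - (q - p)) (q - p)
    rw [sub_add_cancel] at this
    linarith
  have h2 : (1 + 272 * c ^ 2) * dist p (p + targetOffset e) ≤ (1 + 272 * c ^ 2) * (2 * D) := by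
    gcongr; linarith
  rw [pow_zero, div_one]
  linarith

/-! ### Runs are deterministic, and their trajectories are Lipschitz -/

namespace Terrain

variable {T : Terrain} {p : ℂ}

/-- A move cannot be stopped by two polygons at once, as the open obstacles are disjoint from one
another and from the exterior of the outer polygon. -/
lemma Blocks.unique {P P' : ConvexPolygon} {y v : ℂ} (h : T.Blocks P y v)
    (h' : T.Blocks P' y v) : P = P' := by
  have mixed : ∀ i, (∀ᶠ ε : ℝ in 𝓝[>] 0, y + ε • v ∈ (T.obstacle i).inner) →
      (∀ᶠ ε : ℝ in 𝓝[>] 0, y + ε • v ∉ T.outer.region) → False := by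
    intro i h1 h2
    obtain ⟨ε, h3, h4⟩ := (h1.and h2).exists
    exact h4 (T.outer.inner_subset_region (T.obstacle_subset i h3))
  rcases h with ⟨i, rfl, hi⟩ | ⟨rfl, ho⟩ <;> rcases h' with ⟨j, rfl, hj⟩ | ⟨rfl, ho'⟩
  · by_cases hij : i = j
    · rw [hij]
    · obtain ⟨ε, h3, h4⟩ := (hi.and hj).exists
      exact (Set.disjoint_left.1 (T.obstacle_disjoint i j hij) h3 h4).elim
  · exact (mixed i hi ho').elim
  · exact (mixed j hj ho).elim
  · rfl

/-- A boundary move has one outcome, as the boundary has only one arc-length parametrization that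
starts at the position of the agent. -/
lemma FollowStep.unique {P : ConvexPolygon} {σ σ₁ σ₂ : State} {ccw : Bool} {d : ℝ} {S : Set View}
    {γ₁ γ₂ : ℝ → ℂ} (h₁ : T.FollowStep p P σ ccw d S σ₁ γ₁)
    (h₂ : T.FollowStep p P σ ccw d S σ₂ γ₂) : σ₁ = σ₂ ∧ γ₁ = γ₂ := by
  obtain ⟨⟨β₁, hβ₁, h01, hγ₁⟩, ht₁, hp₁, hc₁⟩ := h₁
  obtain ⟨⟨β₂, hβ₂, h02, hγ₂⟩, ht₂, hp₂, hc₂⟩ := h₂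
  have hβ : β₁ = β₂ := hβ₁.unique hβ₂ (h01.trans h02.symm)
  have hγ : γ₁ = γ₂ := by funext t; rw [hγ₁, hγ₂, hβ]
  subst hγ
  refine ⟨?_, rfl⟩
  obtain ⟨pos₁, c₁, tr₁, st₁⟩ := σ₁
  obtain ⟨pos₂, c₂, tr₂, st₂⟩ := σ₂
  simp only at ht₁ hp₁ hc₁ ht₂ hp₂ hc₂
  have : tr₁ = tr₂ ∧ st₁ = st₂ := by
    rcases ht₁ with ⟨a1, a2, a3⟩ | ⟨a1, a2, a3⟩ <;> rcases ht₂ with ⟨b1, b2, b3⟩ | ⟨b1, b2, b3⟩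
    · exact ⟨a3.trans b3.symm, a1.trans b1.symm⟩
    · exact absurd a2 b2
    · exact absurd b2 a2
    · exact ⟨a3.trans b3.symm, a1.trans b1.symm⟩
  obtain ⟨rfl, rfl⟩ := this
  rw [hp₁, hp₂, hc₁, hc₂]

lemma Step.unique {σ σ₁ σ₂ : State} {m : Move} {γ₁ γ₂ : ℝ → ℂ} (h₁ : T.Step p σ m σ₁ γ₁)
    (h₂ : T.Step p σ m σ₂ γ₂) : σ₁ = σ₂ ∧ γ₁ = γ₂ := by
  rcases m with v | ⟨ccw, d, S⟩
  · obtain ⟨hγ₁, hp₁, ht₁, h₁⟩ := h₁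
    obtain ⟨hγ₂, hp₂, ht₂, h₂⟩ := h₂
    refine ⟨?_, funext fun t => by rw [hγ₁, hγ₂]⟩
    obtain ⟨pos₁, c₁, tr₁, st₁⟩ := σ₁
    obtain ⟨pos₂, c₂, tr₂, st₂⟩ := σ₂
    simp only at hp₁ ht₁ h₁ hp₂ ht₂ h₂
    have : c₁ = c₂ ∧ st₁ = st₂ := by
      rcases h₁ with ⟨a1, a2, P, a3, a4⟩ | ⟨a1, a2, a3⟩ <;>
        rcases h₂ with ⟨b1, b2, P', b3, b4⟩ | ⟨b1, b2, b3⟩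
      · refine ⟨?_, a2.trans b2.symm⟩
        rw [hp₁] at a4
        rw [hp₂] at b4
        rw [a3, b3, a4.unique b4]
      · linarith
      · linarith
      · exact ⟨a3.trans b3.symm, a2.trans b2.symm⟩
    obtain ⟨rfl, rfl⟩ := this
    rw [hp₁, hp₂, ht₁, ht₂]
  · rcases h₁ with ⟨P, hP, h₁⟩ | ⟨hn, h₁, hγ₁⟩ <;> rcases h₂ with ⟨P', hP', h₂⟩ | ⟨hn', h₂, hγ₂⟩
    · obtain rfl : P = P' := Option.some.inj (hP.symm.trans hP')
      exact h₁.unique h₂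
    · rw [hP] at hn'; cases hn'
    · rw [hP'] at hn; cases hn
    · exact ⟨h₁.trans h₂.symm, funext fun t => by rw [hγ₁, hγ₂]⟩

lemma IsRun.unique {A : Strategy} {s : List Bool} {σ σ' : ℕ → State} {γ γ' : ℕ → ℝ → ℂ}
    (h : T.IsRun p A s σ γ) (h' : T.IsRun p A s σ' γ') : σ = σ' ∧ γ = γ' := by
  have hlist : ∀ n, (∀ m ≤ n, σ m = σ' m) →
      (List.range (n + 1)).map (fun m => T.observe p (σ m))
        = (List.range (n + 1)).map fun m => T.observe p (σ' m) := by
    intro n hn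
    refine List.map_congr_left fun m hm => ?_
    rw [List.mem_range] at hm
    rw [hn m (by omega)]
  have hstep : ∀ n, (∀ m ≤ n, σ m = σ' m) → σ (n + 1) = σ' (n + 1) ∧ γ n = γ' n := by
    intro n hn
    have h1 := h.2 n
    have h2 := h'.2 n
    rw [← hlist n hn, ← hn n le_rfl] at h2
    exact h1.unique h2
  have hσ : ∀ n, ∀ m ≤ n, σ m = σ' m := by
    intro n
    induction n with
    | zero =>
      intro m hm
      obtain rfl : m = 0 := by omega
      rw [h.1, h'.1]
    | succ n ih =>
      intro m hm
      rcases Nat.lt_or_ge m (n + 1) with h1 | h1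
      · exact ih m (by omega)
      · obtain rfl : m = n + 1 := by omega
        exact (hstep n ih).1
  exact ⟨funext fun n => hσ n n le_rfl, funext fun n => (hstep n (hσ n)).2⟩

/-- The trajectory of a move joins its end points and has speed at most `1`. -/
lemma Step.lipschitz {σ σ' : State} {m : Move} {γ : ℝ → ℂ} (h : T.Step p σ m σ' γ) :
    0 ≤ σ'.travelled ∧ γ 0 = σ.pos ∧ γ σ'.travelled = σ'.pos ∧
      ∀ s t, dist (γ s) (γ t) ≤ |s - t| := by
  rcases m with v | ⟨ccw, d, S⟩
  · obtain ⟨hγ, hp, ht, -⟩ := h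
    refine ⟨?_, ?_, ?_, ?_⟩
    · rw [ht]; exact mul_nonneg (reach_nonneg _ _) (norm_nonneg _)
    · rw [hγ]; simp
    · rw [hγ, hp, ht]
      rcases eq_or_ne v 0 with rfl | hv
      · simp
      · rw [mul_div_cancel_right₀ _ (norm_ne_zero_iff.2 hv)]
    · intro s t
      rw [hγ, hγ, dist_add_left, dist_eq_norm, ← sub_smul, norm_smul, ← sub_div, norm_div,
        norm_norm, Real.norm_eq_abs]
      rcases eq_or_ne v 0 with rfl | hv
      · simp
      · rw [div_mul_cancel₀ _ (norm_ne_zero_iff.2 hv)]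
  · rcases h with ⟨P, -, ⟨β, hβ, h0, hγ⟩, ht, hp, -⟩ | ⟨-, rfl, hγ⟩
    · refine ⟨?_, by rw [hγ, ← h0]; simp, hp.symm, fun s t => ?_⟩
      · rcases ht with ⟨-, -, h1⟩ | ⟨-, -, h1⟩
        · rw [h1]; exact Real.sInf_nonneg fun x hx => hx.1.le
        · rw [h1]; exact le_max_right _ _
      · rw [hγ, hγ]
        refine (hβ.dist_le _ _).trans (le_of_eq ?_)
        cases ccw
        · simp only [Bool.false_eq_true, if_false]
          rw [neg_sub_neg, abs_sub_comm]
        · simp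
    · exact ⟨le_rfl, hγ 0, hγ _, fun s t => by rw [hγ, hγ, dist_self]; exact abs_nonneg _⟩

/-- The distance of two points of the trajectory is at most the difference of the travelled
lengths. -/
lemma IsRun.dist_le {A : Strategy} {s : List Bool} {σ : ℕ → State} {γ : ℕ → ℝ → ℂ}
    (h : T.IsRun p A s σ γ) {m n : ℕ} {t u : ℝ} (ht : 0 ≤ t) (ht' : t ≤ (σ (m + 1)).travelled)
    (hu : 0 ≤ u) (hu' : u ≤ (σ (n + 1)).travelled) :
    dist (γ m t) (γ n u) ≤ |((∑ k ∈ Finset.range m, (σ (k + 1)).travelled) + t) -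
      ((∑ k ∈ Finset.range n, (σ (k + 1)).travelled) + u)| := by
  have hstep := fun n => (h.2 n).lipschitz
  have hpos : ∀ a b, dist (σ a).pos (σ (a + b)).pos
      ≤ (∑ k ∈ Finset.range (a + b), (σ (k + 1)).travelled)
        - ∑ k ∈ Finset.range a, (σ (k + 1)).travelled := by
    intro a b
    induction b with
    | zero => simp
    | succ b ih =>
      rw [← add_assoc, Finset.sum_range_succ]
      obtain ⟨h1, h2, h3, h4⟩ := hstep (a + b)
      have h5 := h4 0 (σ (a + b + 1)).travelled
      rw [h2, h3, zero_sub, abs_neg, abs_of_nonneg h1] at h5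
      linarith [dist_triangle (σ a).pos (σ (a + b)).pos (σ (a + b + 1)).pos]
  have key : ∀ {m n : ℕ} {t u : ℝ}, m < n → t ≤ (σ (m + 1)).travelled → 0 ≤ u →
      dist (γ m t) (γ n u) ≤ ((∑ k ∈ Finset.range n, (σ (k + 1)).travelled) + u) -
        ((∑ k ∈ Finset.range m, (σ (k + 1)).travelled) + t) := by
    intro m n t u hmn ht' hu
    obtain ⟨b, rfl⟩ := Nat.exists_eq_add_of_lt hmn
    obtain ⟨h1, h2, h3, h4⟩ := hstep m
    have h5 := h4 t (σ (m + 1)).travelled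
    rw [h3, abs_sub_comm, abs_of_nonneg (by linarith)] at h5
    have h6 := hpos (m + 1) b
    rw [Finset.sum_range_succ] at h6
    obtain ⟨h1', h2', h3', h4'⟩ := hstep (m + b + 1)
    have h7 := h4' 0 u
    rw [h2', zero_sub, abs_neg, abs_of_nonneg hu] at h7
    rw [show m + 1 + b = m + b + 1 by omega] at h6
    have h8 := dist_triangle4 (γ m t) (σ (m + 1)).pos (σ (m + b + 1)).pos (γ (m + b + 1) u)
    linarith
  rcases lt_trichotomy m n with hmn | rfl | hmn
  · rw [abs_sub_comm]
    exact (key hmn ht' hu).trans (le_abs_self _)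
  · rw [add_sub_add_left_eq_sub]
    exact (hstep m).2.2.2 t u
  · rw [dist_comm]
    exact (key hmn hu' ht).trans (le_abs_self _)

end Terrain

/-! ### Regular polygons -/

section RegularPolygon

open Real

variable {n : ℕ} [NeZero n]

lemma norm_stdAddChar (i : ZMod n) : ‖ZMod.stdAddChar (N := n) i‖ = 1 :=
  Circle.norm_coe (ZMod.toCircle i)

lemma stdAddChar_mul_conj (i : ZMod n) :
    ZMod.stdAddChar i * (starRingEnd ℂ) (ZMod.stdAddChar i) = 1 := by
  rw [Complex.mul_conj, Complex.normSq_eq_norm_sq, norm_stdAddChar]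
  simp

/-- The signed area is invariant under rotations. -/
lemma cross_stdAddChar_mul (i : ZMod n) (u v : ℂ) :
    cross (ZMod.stdAddChar i * u) (ZMod.stdAddChar i * v) = cross u v := by
  rw [cross_eq_im, cross_eq_im, map_mul]
  congr 1
  linear_combination ((starRingEnd ℂ) u * v) * stdAddChar_mul_conj i

lemma stdAddChar_natCast (k : ℕ) :
    ZMod.stdAddChar (N := n) (k : ZMod n) = ⟨cos (k * (2 * π / n)), sin (k * (2 * π / n))⟩ := by
  have h := ZMod.stdAddChar_coe (N := n) (k : ℤ)
  rw [Int.cast_natCast] at h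
  rw [h]
  have e : 2 * (π : ℂ) * Complex.I * ((k : ℤ) : ℂ) / n
      = ((k * (2 * π / n) : ℝ) : ℂ) * Complex.I := by
    push_cast; ring
  rw [e]
  exact Complex.ext (Complex.exp_ofReal_mul_I_re _) (Complex.exp_ofReal_mul_I_im _)

lemma stdAddChar_one :
    ZMod.stdAddChar (N := n) 1 = ⟨cos (2 * (π / n)), sin (2 * (π / n))⟩ := by
  have := stdAddChar_natCast (n := n) 1
  rw [Nat.cast_one] at this
  rw [this, Nat.cast_one, one_mul, mul_div_assoc]

lemma angle_pos : 0 < π / n := div_pos pi_pos (by exact_mod_cast NeZero.pos n)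

lemma sin_angle_pos (hn : 3 ≤ n) : 0 < sin (π / n) := by
  refine sin_pos_of_pos_of_lt_pi angle_pos ?_
  rw [div_lt_iff₀ (by exact_mod_cast NeZero.pos n)]
  have : (3 : ℝ) ≤ n := by exact_mod_cast hn
  nlinarith [pi_pos]

lemma cos_angle_pos (hn : 3 ≤ n) : 0 < cos (π / n) := by
  have h1 : (3 : ℝ) ≤ n := by exact_mod_cast hn
  refine cos_pos_of_mem_Ioo ⟨by linarith [angle_pos (n := n), pi_pos], ?_⟩
  rw [div_lt_iff₀ (by linarith)]
  nlinarith [pi_pos]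

/-- The signed area spanned by the first side and a diagonal of a regular polygon. -/
lemma cross_diagonal (a b : ℝ) :
    cross (⟨cos (2 * a), sin (2 * a)⟩ - 1) (⟨cos (2 * b), sin (2 * b)⟩ - 1)
      = 4 * sin a * sin b * sin (b - a) := by
  simp only [cross, Complex.sub_re, Complex.sub_im, Complex.one_re, Complex.one_im, sub_zero]
  rw [cos_two_mul, cos_two_mul, sin_two_mul, sin_two_mul, sin_sub]
  have ha := sin_sq_add_cos_sq a
  have hb := sin_sq_add_cos_sq b
  linear_combination (4 * sin b * cos b) * ha + (-4 * sin a * cos a) * hb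

/-- The regular polygon with `n` vertices on the circle with center `z` and radius `R`; the vertex
number `0` is the easternmost point of this circle. -/
noncomputable def regularPolygon (n : ℕ) [NeZero n] (hn : 3 ≤ n) (z : ℂ) (R : ℝ) (hR : 0 < R) :
    ConvexPolygon where
  n := n
  three_le := hn
  vertex i := z + R * ZMod.stdAddChar (N := n) i
  ccw i j h h' := by
    obtain ⟨m, rfl⟩ : ∃ m, j = i + m := ⟨j - i, by ring⟩
    have e1 : z + R * ZMod.stdAddChar (N := n) (i + 1) - (z + R * ZMod.stdAddChar (N := n) i)
        = R • (ZMod.stdAddChar i * (ZMod.stdAddChar (N := n) 1 - 1)) := by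
      rw [AddChar.map_add_eq_mul, Complex.real_smul]; ring
    have e2 : z + R * ZMod.stdAddChar (N := n) (i + m) - (z + R * ZMod.stdAddChar (N := n) i)
        = R • (ZMod.stdAddChar i * (ZMod.stdAddChar (N := n) m - 1)) := by
      rw [AddChar.map_add_eq_mul, Complex.real_smul]; ring
    rw [e1, e2, cross_smul_left, cross_smul_right, cross_stdAddChar_mul]
    have hm0 : m ≠ 0 := by rintro rfl; exact h (add_zero i)
    have hm1 : m ≠ 1 := by rintro rfl; exact h' rfl
    obtain ⟨k, hk, rfl⟩ : ∃ k : ℕ, k < n ∧ m = (k : ZMod n) :=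
      ⟨m.val, ZMod.val_lt m, (ZMod.natCast_zmod_val m).symm⟩
    have hk0 : k ≠ 0 := by rintro rfl; exact hm0 Nat.cast_zero
    have hk1 : k ≠ 1 := by rintro rfl; exact hm1 Nat.cast_one
    have hk2 : (2 : ℝ) ≤ k := by exact_mod_cast (show 2 ≤ k by omega)
    have hkn : (k : ℝ) + 1 ≤ n := by exact_mod_cast hk
    have hnpos : (0 : ℝ) < n := by linarith
    rw [stdAddChar_one, stdAddChar_natCast, show (k : ℝ) * (2 * π / n) = 2 * (k * (π / n)) by ring,
      cross_diagonal]
    have ha := angle_pos (n := n)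
    have hmul : (n : ℝ) * (π / n) = π := by field_simp
    have s2 : 0 < sin (k * (π / n)) := by
      refine sin_pos_of_pos_of_lt_pi (by positivity) ?_
      calc (k : ℝ) * (π / n) < n * (π / n) := by gcongr
        _ = π := hmul
    have s3 : 0 < sin (k * (π / n) - π / n) := by
      refine sin_pos_of_pos_of_lt_pi (by nlinarith) ?_
      calc (k : ℝ) * (π / n) - π / n < n * (π / n) := by nlinarith
        _ = π := hmul
    have := sin_angle_pos hn
    positivity

variable {hn : 3 ≤ n} {z : ℂ} {R : ℝ} {hR : 0 < R}

lemma regularPolygon_vertex_zero : (regularPolygon n hn z R hR).vertex (0 : ZMod n) = z + R := by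
  simp [regularPolygon]

/-- The supporting half-planes of a regular polygon. -/
lemma regularPolygon_side (i : ZMod n) (u : ℂ) :
    (regularPolygon n hn z R hR).side i (z + ZMod.stdAddChar i * u)
      = 2 * R * sin (π / n) * (R * cos (π / n) - (cos (π / n) * u.re + sin (π / n) * u.im)) := by
  have e1 : (regularPolygon n hn z R hR).edge i
      = R • (ZMod.stdAddChar i * (ZMod.stdAddChar (N := n) 1 - 1)) := by
    change z + R * ZMod.stdAddChar (N := n) (i + 1) - (z + R * ZMod.stdAddChar (N := n) i) = _
    rw [AddChar.map_add_eq_mul, Complex.real_smul]; ring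
  have e2 : z + ZMod.stdAddChar i * u - (regularPolygon n hn z R hR).vertex i
      = ZMod.stdAddChar i * (u - R) := by
    change z + ZMod.stdAddChar i * u - (z + R * ZMod.stdAddChar (N := n) i) = _
    ring
  change cross ((regularPolygon n hn z R hR).edge i)
    (z + ZMod.stdAddChar i * u - (regularPolygon n hn z R hR).vertex i) = _
  rw [e1, e2, cross_smul_left, cross_stdAddChar_mul, stdAddChar_one]
  simp only [cross, Complex.sub_re, Complex.sub_im, Complex.one_re, Complex.one_im,
    Complex.ofReal_re, Complex.ofReal_im, sub_zero]
  rw [cos_two_mul, sin_two_mul]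
  have h := sin_sq_add_cos_sq (π / n)
  linear_combination (2 * R * u.im) * h

/-- The coordinates of a point in the frame centered at `z` and rotated by the root of unity
number `i`. -/
lemma exists_rotated (i : ZMod n) (x z : ℂ) :
    ∃ u : ℂ, x = z + ZMod.stdAddChar i * u ∧ ‖u‖ = dist x z := by
  refine ⟨(starRingEnd ℂ) (ZMod.stdAddChar i) * (x - z), ?_, ?_⟩
  · linear_combination (z - x) * stdAddChar_mul_conj i
  · rw [norm_mul, RCLike.norm_conj, norm_stdAddChar, one_mul, dist_eq_norm]

lemma cos_mul_re_add_sin_mul_im_le (a : ℝ) (u : ℂ) : cos a * u.re + sin a * u.im ≤ ‖u‖ := by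
  refine le_trans (le_abs_self _) (abs_le_of_sq_le_sq' ?_ (norm_nonneg u) |> abs_le.2)
  rw [← Complex.normSq_eq_norm_sq, Complex.normSq_apply]
  nlinarith [sq_nonneg (cos a * u.im - sin a * u.re), sin_sq_add_cos_sq a]

lemma ball_subset_regularPolygon_inner :
    Metric.ball z (R * cos (π / n)) ⊆ (regularPolygon n hn z R hR).inner := by
  refine fun x hx (i : ZMod n) => ?_
  change 0 < (regularPolygon n hn z R hR).side i x
  obtain ⟨u, rfl, hu⟩ := exists_rotated i x z
  have h1 := cos_mul_re_add_sin_mul_im_le (π / n) u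
  rw [Metric.mem_ball, ← hu] at hx
  rw [regularPolygon_side]
  have := sin_angle_pos hn
  exact mul_pos (by positivity) (by linarith)

lemma closedBall_subset_regularPolygon_region :
    Metric.closedBall z (R * cos (π / n)) ⊆ (regularPolygon n hn z R hR).region := by
  refine fun x hx (i : ZMod n) => ?_
  change 0 ≤ (regularPolygon n hn z R hR).side i x
  obtain ⟨u, rfl, hu⟩ := exists_rotated i x z
  have h1 := cos_mul_re_add_sin_mul_im_le (π / n) u
  rw [Metric.mem_closedBall, ← hu] at hx
  rw [regularPolygon_side]
  have := sin_angle_pos hn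
  exact mul_nonneg (by positivity) (by linarith)

/-- The direction from the center to `x` differs by at most `π / n` from the outer normal of some
side, and this side bounds the distance of `x` from the center. -/
lemma exists_side_le (x : ℂ) :
    ∃ i : ZMod n, (regularPolygon n hn z R hR).side i x
      ≤ 2 * R * sin (π / n) * cos (π / n) * (R - dist x z) := by
  have hn0 : (0 : ℝ) < n := by exact_mod_cast NeZero.pos n
  have hα := angle_pos (n := n)
  set α := π / n with hαdef
  set y := x - z with hy
  set k : ℤ := ⌊y.arg / (2 * α)⌋ with hk
  refine ⟨(k : ZMod n), ?_⟩
  set ψ := y.arg - k * (2 * α) with hψ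
  have hψ0 : 0 ≤ ψ := by
    have := Int.floor_le (y.arg / (2 * α))
    rw [← hk, le_div_iff₀ (by linarith)] at this
    linarith
  have hψ1 : ψ < 2 * α := by
    have := Int.lt_floor_add_one (y.arg / (2 * α))
    rw [← hk, div_lt_iff₀ (by linarith)] at this
    linarith
  have hx : x = z
      + ZMod.stdAddChar (N := n) (k : ZMod n) * (‖y‖ * Complex.exp (ψ * Complex.I)) := by
    have h1 : (ZMod.stdAddChar (N := n) (k : ZMod n) : ℂ)
        = Complex.exp ((k * (2 * α) : ℝ) * Complex.I) := by
      rw [ZMod.stdAddChar_coe]; congr 1; rw [hαdef]; push_cast; ring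
    have h2 : ZMod.stdAddChar (N := n) (k : ZMod n) * (‖y‖ * Complex.exp (ψ * Complex.I)) = y := by
      rw [h1, mul_left_comm, ← Complex.exp_add, ← add_mul, ← Complex.ofReal_add,
        show (k * (2 * α) : ℝ) + ψ = y.arg by rw [hψ]; ring]
      exact Complex.norm_mul_exp_arg_mul_I y
    rw [h2, hy]; ring
  have hs := regularPolygon_side (hn := hn) (z := z) (hR := hR) (k : ZMod n)
    (‖y‖ * Complex.exp (ψ * Complex.I))
  rw [← hx] at hs
  rw [hs, Complex.re_ofReal_mul, Complex.im_ofReal_mul, Complex.exp_ofReal_mul_I_re,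
    Complex.exp_ofReal_mul_I_im, dist_eq_norm, ← hy]
  have hcos : cos α ≤ cos α * cos ψ + sin α * sin ψ := by
    rw [← cos_sub, ← cos_abs (α - ψ)]
    refine cos_le_cos_of_nonneg_of_le_pi (abs_nonneg _) ?_ ?_
    · rw [hαdef]; exact div_le_self pi_pos.le (by exact_mod_cast (show 1 ≤ n by omega))
    · rw [abs_le]; constructor <;> linarith
  have hsin := sin_angle_pos hn
  have hnorm := norm_nonneg y
  have h3 : ‖y‖ * cos α ≤ ‖y‖ * (cos α * cos ψ + sin α * sin ψ) := by gcongr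
  calc _ ≤ 2 * R * sin α * (R * cos α - ‖y‖ * cos α) := by
        gcongr
        linarith
    _ = _ := by ring

lemma regularPolygon_region_subset :
    (regularPolygon n hn z R hR).region ⊆ Metric.closedBall z R := by
  intro x hx
  obtain ⟨i, hi⟩ := exists_side_le (hn := hn) (hR := hR) (z := z) x
  have h1 : 0 ≤ (regularPolygon n hn z R hR).side i x := hx i
  have h2 := sin_angle_pos hn
  have h3 := cos_angle_pos hn
  have h4 := nonneg_of_mul_nonneg_right (h1.trans hi) (by positivity)
  rw [Metric.mem_closedBall]; linarith

lemma regularPolygon_inner_subset :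
    (regularPolygon n hn z R hR).inner ⊆ Metric.ball z R := by
  intro x hx
  obtain ⟨i, hi⟩ := exists_side_le (hn := hn) (hR := hR) (z := z) x
  have h1 : 0 < (regularPolygon n hn z R hR).side i x := hx i
  have h2 := sin_angle_pos hn
  have h3 := cos_angle_pos hn
  have h4 := pos_of_mul_pos_right (h1.trans_le hi) (by positivity)
  rw [Metric.mem_ball]; linarith

lemma regularPolygon_isFat {c : ℝ} (hc : 0 < c) (h : 1 / c ≤ cos (π / n)) :
    (regularPolygon n hn z R hR).IsFat c := by
  refine ⟨z, z, R * cos (π / n), R, mul_pos hR (cos_angle_pos hn),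
    closedBall_subset_regularPolygon_region, regularPolygon_region_subset, ?_⟩
  rw [div_le_iff₀ hc] at h
  nlinarith

end RegularPolygon

/-- Regular polygons with many vertices are almost round. -/
lemma exists_cos_pi_div_ge {δ : ℝ} (hδ : δ < 1) : ∃ n : ℕ, 3 ≤ n ∧ δ ≤ Real.cos (Real.pi / n) := by
  have h : Filter.Tendsto (fun n : ℕ => Real.cos (Real.pi / n)) Filter.atTop (𝓝 1) := by
    have := (Real.continuous_cos.tendsto 0).comp (tendsto_const_div_atTop_nhds_zero_nat Real.pi)
    rwa [Real.cos_zero] at this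
  obtain ⟨n, h1, h2⟩ := ((h.eventually (lt_mem_nhds hδ)).and (Filter.eventually_ge_atTop 3)).exists
  exact ⟨n, h2, h1.le⟩

/-! ### A terrain in which the treasure can be seen only from nearby -/

/-- The centers of the eight discs of a cluster, in units of the accessibility and relative to the
center of the cluster. -/
def clusterOffset : Fin 8 → ℤ × ℤ :=
  ![(2, 0), (-2, 0), (0, 2), (0, -2), (5, 5), (-5, 5), (-5, -5), (5, -5)]

/-- The radii of the eight discs of a cluster, in units of the accessibility. -/
def clusterRadius : Fin 8 → ℤ := ![1, 1, 1, 1, 3, 3, 3, 3]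

lemma clusterRadius_bounds (m : Fin 8) : 1 ≤ clusterRadius m ∧ clusterRadius m ≤ 3 := by
  revert m; decide

lemma clusterOffset_bounds (m : Fin 8) : |(clusterOffset m).1| ≤ 5 ∧ |(clusterOffset m).2| ≤ 5 := by
  revert m; decide

lemma clusterOffset_separated (m m' : Fin 8) (h : m ≠ m') :
    (clusterRadius m + clusterRadius m') ^ 2 ≤
      ((clusterOffset m).1 - (clusterOffset m').1) ^ 2
        + ((clusterOffset m).2 - (clusterOffset m').2) ^ 2 := by
  revert m m'; decide

/-- The disc of radius `1` around the center of a cluster is disjoint from the discs of the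
cluster. -/
lemma clusterOffset_center (m : Fin 8) :
    (1 + clusterRadius m) ^ 2 ≤ (clusterOffset m).1 ^ 2 + (clusterOffset m).2 ^ 2 := by
  revert m; decide

/-- The horizontal ray to the east from the point `(3 / 2, 3 / 2)` avoids the discs. -/
lemma clusterOffset_corridor (m : Fin 8) :
    2 * clusterRadius m ≤ |3 - 2 * (clusterOffset m).2| ∨
      2 * clusterRadius m ≤ 3 - 2 * (clusterOffset m).1 := by
  revert m; decide

/-- The segment from the center of a cluster to the point `(3 / 2, 3 / 2)` avoids the discs. -/
lemma clusterOffset_diagonal (m : Fin 8) {t : ℝ} (h0 : 0 ≤ t) (h1 : t ≤ 3 / 2) :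
    (clusterRadius m : ℝ) ^ 2 ≤
      (t - (clusterOffset m).1) ^ 2 + (t - (clusterOffset m).2) ^ 2 := by
  fin_cases m <;> simp [clusterRadius, clusterOffset] <;> nlinarith [sq_nonneg (t - 1)]

/-- The discs of a cluster, even if shrunk by one percent, block every ray from the center. -/
lemma exists_blocking_disc (a b : ℝ) (h : 0 < a ^ 2 + b ^ 2) : ∃ m : Fin 8,
    0 ≤ (clusterOffset m).1 * a + (clusterOffset m).2 * b ∧
      ((clusterOffset m).1 * b - (clusterOffset m).2 * a) ^ 2
        < (99 / 100 * clusterRadius m) ^ 2 * (a ^ 2 + b ^ 2) := by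
  by_cases h1 : 4 * b ^ 2 < 98 / 100 * (a ^ 2 + b ^ 2)
  · rcases le_total 0 a with ha | ha
    · refine ⟨0, ?_, ?_⟩ <;> simp [clusterOffset, clusterRadius] <;> nlinarith
    · refine ⟨1, ?_, ?_⟩ <;> simp [clusterOffset, clusterRadius] <;> nlinarith
  by_cases h2 : 4 * a ^ 2 < 98 / 100 * (a ^ 2 + b ^ 2)
  · rcases le_total 0 b with hb | hb
    · refine ⟨2, ?_, ?_⟩ <;> simp [clusterOffset, clusterRadius] <;> nlinarith
    · refine ⟨3, ?_, ?_⟩ <;> simp [clusterOffset, clusterRadius] <;> nlinarith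
  push Not at h1 h2
  have hprod : 18 / 100 * (a ^ 2 + b ^ 2) ^ 2 ≤ (a * b) ^ 2 := by
    nlinarith [mul_nonneg (sub_nonneg.2 h1) (sub_nonneg.2 h2)]
  have habs : 33 / 100 * (a ^ 2 + b ^ 2) < |a * b| := by
    refine lt_of_pow_lt_pow_left₀ 2 (abs_nonneg _) ?_
    rw [sq_abs]
    nlinarith [pow_pos h 2]
  rcases le_total 0 a with ha | ha <;> rcases le_total 0 b with hb | hb
  · rw [abs_of_nonneg (mul_nonneg ha hb)] at habs
    refine ⟨4, ?_, ?_⟩ <;> simp [clusterOffset, clusterRadius] <;> nlinarith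
  · rw [abs_of_nonpos (mul_nonpos_of_nonneg_of_nonpos ha hb)] at habs
    refine ⟨7, ?_, ?_⟩ <;> simp [clusterOffset, clusterRadius] <;> nlinarith
  · rw [abs_of_nonpos (mul_nonpos_of_nonpos_of_nonneg ha hb)] at habs
    refine ⟨5, ?_, ?_⟩ <;> simp [clusterOffset, clusterRadius] <;> nlinarith
  · rw [abs_of_nonneg (mul_nonneg_of_nonpos_of_nonpos ha hb)] at habs
    refine ⟨6, ?_, ?_⟩ <;> simp [clusterOffset, clusterRadius] <;> nlinarith

/-- The parameters of a square array of `N × N` clusters at distance about `ℓ` from the origin.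
The discs of the clusters are approximated by regular `n`-gons, and the discs around the centers of
the clusters have radius `lam`. -/
structure ClusterArray where
  n : ℕ
  N : ℕ
  ℓ : ℝ
  lam : ℝ
  three_le : 3 ≤ n
  cos_ge : 99 / 100 ≤ Real.cos (Real.pi / n)
  ℓ_pos : 0 < ℓ
  lam_pos : 0 < lam

namespace ClusterArray

variable (D : ClusterArray)

instance : NeZero D.n := ⟨by have := D.three_le; omega⟩

/-- The center of the cluster number `(i, j)`, a possible location of the treasure. -/
noncomputable def treasure (i j : Fin D.N) : ℂ :=
  ⟨D.ℓ + 30 * D.lam * (i + 1), 30 * D.lam * j⟩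

/-- The center of the obstacle number `m` in the cluster `(i, j)`. -/
noncomputable def center (x : Fin D.N × Fin D.N × Fin 8) : ℂ :=
  ⟨D.ℓ + 30 * D.lam * (x.1 + 1) + D.lam * (clusterOffset x.2.2).1,
    30 * D.lam * x.2.1 + D.lam * (clusterOffset x.2.2).2⟩

/-- The circumradius of an obstacle. -/
noncomputable def radius (x : Fin D.N × Fin D.N × Fin 8) : ℝ := D.lam * clusterRadius x.2.2

lemma radius_pos (x : Fin D.N × Fin D.N × Fin 8) : 0 < D.radius x := by
  have : (1 : ℝ) ≤ clusterRadius x.2.2 := by exact_mod_cast (clusterRadius_bounds x.2.2).1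
  have := D.lam_pos
  unfold radius; positivity

lemma radius_le (x : Fin D.N × Fin D.N × Fin 8) : D.radius x ≤ 3 * D.lam := by
  have : (clusterRadius x.2.2 : ℝ) ≤ 3 := by exact_mod_cast (clusterRadius_bounds x.2.2).2
  have := D.lam_pos
  unfold radius; nlinarith

/-- A radius such that the disc with this radius contains the whole array. -/
noncomputable def extent : ℝ := 100 * (D.ℓ + D.lam * (D.N + 1))

lemma extent_pos : 0 < D.extent := by
  have := D.ℓ_pos; have := D.lam_pos
  unfold extent; positivity

lemma abs_offset_le (m : Fin 8) : |((clusterOffset m).1 : ℝ)| ≤ 5 ∧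
    |((clusterOffset m).2 : ℝ)| ≤ 5 := by
  have := clusterOffset_bounds m
  exact ⟨by exact_mod_cast this.1, by exact_mod_cast this.2⟩

lemma norm_center_le (x : Fin D.N × Fin D.N × Fin 8) : ‖D.center x‖ + D.radius x ≤ D.extent := by
  have h1 := (Complex.norm_le_abs_re_add_abs_im (D.center x))
  have hℓ := D.ℓ_pos
  have hl := D.lam_pos
  obtain ⟨ho1, ho2⟩ := abs_offset_le x.2.2
  have hi : ((x.1 : ℕ) : ℝ) + 1 ≤ D.N := by exact_mod_cast x.1.2
  have hj : ((x.2.1 : ℕ) : ℝ) + 1 ≤ D.N := by exact_mod_cast x.2.1.2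
  have hi0 : (0 : ℝ) ≤ ((x.1 : ℕ) : ℝ) := Nat.cast_nonneg _
  have hj0 : (0 : ℝ) ≤ ((x.2.1 : ℕ) : ℝ) := Nat.cast_nonneg _
  have hre : |(D.center x).re| ≤ D.ℓ + 30 * D.lam * D.N + 5 * D.lam := by
    simp only [center]
    rw [abs_le] at ho1 ⊢
    constructor <;> nlinarith
  have him : |(D.center x).im| ≤ 30 * D.lam * D.N + 5 * D.lam := by
    simp only [center]
    rw [abs_le] at ho2 ⊢
    constructor <;> nlinarith
  have hr := D.radius_le x
  have hN : 0 ≤ D.lam * D.N := by positivity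
  unfold extent
  nlinarith

/-- Points that are far apart in one of the two coordinates are far apart. -/
lemma le_dist_of_coord {z w : ℂ} {r : ℝ} (h : r ≤ |z.re - w.re| ∨ r ≤ |z.im - w.im|) :
    r ≤ dist z w := by
  rw [dist_eq_norm]
  rcases h with h | h
  · exact h.trans (by simpa using Complex.abs_re_le_norm (z - w))
  · exact h.trans (by simpa using Complex.abs_im_le_norm (z - w))

lemma le_dist_of_sq {z w : ℂ} {r : ℝ}
    (h : r ^ 2 ≤ (z.re - w.re) ^ 2 + (z.im - w.im) ^ 2) : r ≤ dist z w := by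
  have hd : dist z w ^ 2 = (z.re - w.re) ^ 2 + (z.im - w.im) ^ 2 := by
    rw [dist_eq_norm, ← Complex.normSq_eq_norm_sq, Complex.normSq_apply]
    simp only [Complex.sub_re, Complex.sub_im]; ring
  exact le_of_abs_le (abs_le_of_sq_le_sq (h.trans hd.ge) dist_nonneg)

/-- Positions relative to distinct points of a lattice with spacing `30 l` are far apart. -/
lemma lattice_gap {a a' : ℕ} (h : a ≠ a') {u u' M : ℝ} (hu : |u - u'| ≤ M) {l : ℝ} (hl : 0 ≤ l) :
    l * (30 - M) ≤ |30 * l * a + l * u - (30 * l * a' + l * u')| := by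
  have h1 : (1 : ℝ) ≤ |(a : ℝ) - a'| := by
    have : (1 : ℤ) ≤ |(a : ℤ) - a'| := Int.one_le_abs (by omega)
    exact_mod_cast this
  have e : 30 * l * a + l * u - (30 * l * a' + l * u') = l * (30 * ((a : ℝ) - a') + (u - u')) := by
    ring
  rw [e, abs_mul, abs_of_nonneg hl]
  refine mul_le_mul_of_nonneg_left ?_ hl
  have h2 := abs_sub_abs_le_abs_sub (30 * ((a : ℝ) - a')) (-(u - u'))
  rw [sub_neg_eq_add, abs_neg, abs_mul, abs_of_pos (by norm_num : (0 : ℝ) < 30)] at h2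
  linarith

/-- Distinct clusters are far apart in one of the two coordinates. -/
lemma array_index_gap {i i' j j' : ℕ} (h : i ≠ i' ∨ j ≠ j') {s t s' t' M : ℝ}
    (hs : |s - s'| ≤ M) (ht : |t - t'| ≤ M) {l : ℝ} (hl : 0 ≤ l) :
    l * (30 - M) ≤ |30 * l * i + l * s - (30 * l * i' + l * s')| ∨
      l * (30 - M) ≤ |30 * l * j + l * t - (30 * l * j' + l * t')| :=
  h.imp (fun h => lattice_gap h hs hl) fun h => lattice_gap h ht hl

lemma center_separated {x y : Fin D.N × Fin D.N × Fin 8} (h : x ≠ y) :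
    D.radius x + D.radius y ≤ dist (D.center x) (D.center y) := by
  obtain ⟨i, j, m⟩ := x
  obtain ⟨i', j', m'⟩ := y
  have hl := D.lam_pos
  by_cases hij : (i : ℕ) = i' ∧ (j : ℕ) = j'
  · obtain ⟨h1, h2⟩ := hij
    obtain rfl := Fin.ext h1
    obtain rfl := Fin.ext h2
    have hm : m ≠ m' := by rintro rfl; exact h rfl
    apply le_dist_of_sq
    have hsep : ((clusterRadius m : ℝ) + clusterRadius m') ^ 2 ≤
        ((clusterOffset m).1 - (clusterOffset m').1 : ℝ) ^ 2
          + ((clusterOffset m).2 - (clusterOffset m').2) ^ 2 := by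
      exact_mod_cast clusterOffset_separated m m' hm
    simp only [radius, center]
    nlinarith [mul_le_mul_of_nonneg_left hsep (sq_nonneg D.lam)]
  · apply le_dist_of_coord
    have hij' : (i : ℕ) ≠ i' ∨ (j : ℕ) ≠ j' := by omega
    have hr := D.radius_le (i, j, m)
    have hr' := D.radius_le (i', j', m')
    obtain ⟨a1, a2⟩ := abs_offset_le m
    obtain ⟨b1, b2⟩ := abs_offset_le m'
    rcases array_index_gap hij' (M := 10) ((abs_sub _ _).trans (add_le_add a1 b1) |>.trans
      (by norm_num)) ((abs_sub _ _).trans (add_le_add a2 b2) |>.trans (by norm_num)) hl.le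
      with h1 | h1
    · left
      refine le_trans (by linarith) (h1.trans (le_of_eq ?_))
      simp only [center]; congr 1; ring
    · right
      refine le_trans (by linarith) (h1.trans (le_of_eq ?_))
      simp only [center]

/-- The terrain with an array of clusters. -/
noncomputable def terrain : Terrain where
  outer := regularPolygon D.n D.three_le 0 (2 * D.extent) (mul_pos two_pos D.extent_pos)
  k := Fintype.card (Fin D.N × Fin D.N × Fin 8)
  obstacle f := regularPolygon D.n D.three_le (D.center ((Fintype.equivFin _).symm f))
    (D.radius ((Fintype.equivFin _).symm f)) (D.radius_pos _)
  obstacle_subset f := by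
    refine regularPolygon_inner_subset.trans (Set.Subset.trans ?_ ball_subset_regularPolygon_inner)
    intro z hz
    rw [Metric.mem_ball] at hz ⊢
    have h1 := D.norm_center_le ((Fintype.equivFin _).symm f)
    have h2 := dist_triangle z (D.center ((Fintype.equivFin _).symm f)) 0
    rw [dist_zero_right (D.center _)] at h2
    have := D.cos_ge
    have := D.extent_pos
    nlinarith
  obstacle_disjoint f g hfg := by
    refine Set.disjoint_of_subset regularPolygon_inner_subset regularPolygon_inner_subset
      (Metric.ball_disjoint_ball (D.center_separated ?_))
    exact fun h => hfg ((Fintype.equivFin _).symm.injective h)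

lemma terrain_isRegular {c : ℝ} (hc : 0 < c) (h : 1 / c ≤ Real.cos (Real.pi / D.n)) :
    D.terrain.IsRegular c := fun _ =>
  regularPolygon_isFat (hR := D.radius_pos _) hc h

lemma ball_subset_obstacle (x : Fin D.N × Fin D.N × Fin 8) :
    ∃ f, Metric.ball (D.center x) (99 / 100 * D.radius x) ⊆ (D.terrain.obstacle f).inner ∧
      D.center x + D.radius x ∈ (D.terrain.obstacle f).region := by
  obtain ⟨f, rfl⟩ := (Fintype.equivFin _).symm.surjective x
  refine ⟨f, ?_, ?_⟩
  · refine Set.Subset.trans (Metric.ball_subset_ball ?_)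
      (ball_subset_regularPolygon_inner (hR := D.radius_pos _))
    have := D.radius_pos ((Fintype.equivFin _).symm f)
    nlinarith [D.cos_ge]
  · have h := ConvexPolygon.vertex_mem_region (regularPolygon D.n D.three_le
      (D.center ((Fintype.equivFin _).symm f)) (D.radius ((Fintype.equivFin _).symm f))
      (D.radius_pos _)) (0 : ZMod D.n)
    rwa [regularPolygon_vertex_zero] at h

/-- Points outside of the circumscribed discs of the obstacles belong to the terrain. -/
lemma mem_terrain {z : ℂ} (hz : ‖z‖ ≤ D.extent)
    (h : ∀ x, D.radius x ≤ dist z (D.center x)) : z ∈ D.terrain.carrier := by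
  rw [Terrain.mem_carrier]
  refine ⟨closedBall_subset_regularPolygon_region
    (hR := mul_pos two_pos D.extent_pos) ?_, fun f hf => ?_⟩
  · rw [mem_closedBall_zero_iff]
    have := D.cos_ge
    have := D.extent_pos
    nlinarith
  · have := regularPolygon_inner_subset (hR := D.radius_pos _) hf
    rw [Metric.mem_ball] at this
    exact absurd (h _) (not_le.2 this)

lemma norm_le_extent {z : ℂ} (h1 : |z.re| ≤ D.ℓ + 45 * D.lam * (D.N + 1))
    (h2 : |z.im| ≤ 45 * D.lam * (D.N + 1)) : ‖z‖ ≤ D.extent := by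
  have := Complex.norm_le_abs_re_add_abs_im z
  have hl := D.lam_pos
  have hℓ := D.ℓ_pos
  have : 0 < D.lam * (D.N + 1) := by positivity
  unfold extent
  nlinarith

/-- The point at relative position `(s, t)` to the center of the cluster `(i, j)`, in units of the
accessibility. -/
noncomputable def localPoint (i j : Fin D.N) (s t : ℝ) : ℂ :=
  ⟨D.ℓ + 30 * D.lam * (i + 1) + D.lam * s, 30 * D.lam * j + D.lam * t⟩

variable {D}

/-- The points of the cluster `(i, j)` at relative position `(s, t)` belong to the terrain, if they
are outside of the discs of this cluster. -/
lemma mem_terrain_of_local {i j : Fin D.N} {s t : ℝ} (hs : |s| ≤ 15) (ht : |t| ≤ 15)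
    (h : ∀ m, (clusterRadius m : ℝ) ≤ |s - (clusterOffset m).1| ∨
      (clusterRadius m : ℝ) ≤ |t - (clusterOffset m).2| ∨
      (clusterRadius m : ℝ) ^ 2 ≤ (s - (clusterOffset m).1) ^ 2 + (t - (clusterOffset m).2) ^ 2) :
    D.localPoint i j s t ∈ D.terrain.carrier := by
  unfold localPoint
  have hl := D.lam_pos
  have hℓ := D.ℓ_pos
  have hi : ((i : ℕ) : ℝ) + 1 ≤ D.N := by exact_mod_cast i.2
  have hj : ((j : ℕ) : ℝ) + 1 ≤ D.N := by exact_mod_cast j.2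
  have hi0 : (0 : ℝ) ≤ ((i : ℕ) : ℝ) := Nat.cast_nonneg _
  have hj0 : (0 : ℝ) ≤ ((j : ℕ) : ℝ) := Nat.cast_nonneg _
  refine D.mem_terrain (D.norm_le_extent ?_ ?_) ?_
  · rw [abs_le] at hs ⊢
    constructor <;> nlinarith
  · rw [abs_le] at ht ⊢
    constructor <;> nlinarith
  · rintro ⟨i', j', m⟩
    by_cases hij : (i : ℕ) = i' ∧ (j : ℕ) = j'
    · obtain ⟨h1, h2⟩ := hij
      obtain rfl := Fin.ext h1
      obtain rfl := Fin.ext h2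
      rcases h m with h | h | h
      · apply le_dist_of_coord; left
        simp only [radius, center]
        rw [show ∀ a b c : ℝ, a + b - (a + c) = b - c by intros; ring, ← mul_sub, abs_mul,
          abs_of_pos hl]
        gcongr
      · apply le_dist_of_coord; right
        simp only [radius, center]
        rw [show ∀ a b c : ℝ, a + b - (a + c) = b - c by intros; ring, ← mul_sub, abs_mul,
          abs_of_pos hl]
        gcongr
      · apply le_dist_of_sq
        simp only [radius, center]
        nlinarith [mul_le_mul_of_nonneg_left h (sq_nonneg D.lam)]
    · apply le_dist_of_coord
      have hij' : (i : ℕ) ≠ i' ∨ (j : ℕ) ≠ j' := by omega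
      have hr := D.radius_le (i', j', m)
      obtain ⟨b1, b2⟩ := abs_offset_le m
      rcases array_index_gap hij' (M := 20) ((abs_sub s _).trans (add_le_add hs b1) |>.trans
        (by norm_num)) ((abs_sub t _).trans (add_le_add ht b2) |>.trans (by norm_num)) hl.le
        with h1 | h1
      · left
        refine le_trans (by linarith) (h1.trans (le_of_eq ?_))
        simp only [center]; congr 1; ring
      · right
        refine le_trans (by linarith) (h1.trans (le_of_eq ?_))
        simp only [center]

lemma treasure_eq (i j : Fin D.N) : D.treasure i j = D.localPoint i j 0 0 := by
  simp [treasure, localPoint]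

/-- The disc of radius `lam` around the center of a cluster is free. -/
lemma closedBall_treasure_subset (i j : Fin D.N) :
    Metric.closedBall (D.treasure i j) D.lam ⊆ D.terrain.carrier := by
  intro z hz
  have hl := D.lam_pos
  rw [Metric.mem_closedBall, dist_eq_norm] at hz
  set s := (z.re - (D.treasure i j).re) / D.lam with hs
  set t := (z.im - (D.treasure i j).im) / D.lam with ht
  have hst : s ^ 2 + t ^ 2 ≤ 1 := by
    have h1 : ‖z - D.treasure i j‖ ^ 2 ≤ D.lam ^ 2 := by gcongr
    rw [← Complex.normSq_eq_norm_sq, Complex.normSq_apply, Complex.sub_re, Complex.sub_im] at h1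
    rw [hs, ht, div_pow, div_pow, ← add_div, div_le_one (by positivity)]
    linarith
  have hz' : z = D.localPoint i j s t := by
    apply Complex.ext
    · simp only [hs, treasure, localPoint]; field_simp; ring
    · simp only [ht, treasure, localPoint]; field_simp; ring
  rw [hz']
  have hs1 : |s| ≤ 1 := abs_le_one_iff_mul_self_le_one.2 (by nlinarith [sq_nonneg t])
  have ht1 : |t| ≤ 1 := abs_le_one_iff_mul_self_le_one.2 (by nlinarith [sq_nonneg s])
  refine mem_terrain_of_local (by linarith) (by linarith) fun m => Or.inr (Or.inr ?_)
  set a := ((clusterOffset m).1 : ℝ) with ha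
  set b := ((clusterOffset m).2 : ℝ) with hb
  set ρ := (clusterRadius m : ℝ) with hρ
  have hρ1 : 1 ≤ ρ := by rw [hρ]; exact_mod_cast (clusterRadius_bounds m).1
  have hab : (1 + ρ) ^ 2 ≤ a ^ 2 + b ^ 2 := by
    rw [ha, hb, hρ]; exact_mod_cast clusterOffset_center m
  -- the triangle inequality, for the points `0`, `(s, t)` and `(a, b)`
  set z1 : ℂ := ⟨a, b⟩
  set z2 : ℂ := ⟨s, t⟩
  have e1 : ‖z1‖ ^ 2 = a ^ 2 + b ^ 2 := by
    rw [← Complex.normSq_eq_norm_sq, Complex.normSq_apply]; ring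
  have e2 : ‖z2‖ ^ 2 = s ^ 2 + t ^ 2 := by
    rw [← Complex.normSq_eq_norm_sq, Complex.normSq_apply]; ring
  have e3 : ‖z2 - z1‖ ^ 2 = (s - a) ^ 2 + (t - b) ^ 2 := by
    rw [← Complex.normSq_eq_norm_sq, Complex.normSq_apply, Complex.sub_re, Complex.sub_im]; ring
  have n1 : 1 + ρ ≤ ‖z1‖ :=
    le_of_abs_le (abs_le_of_sq_le_sq (by rw [e1]; exact hab) (norm_nonneg _))
  have n2 : ‖z2‖ ≤ 1 :=
    le_of_abs_le (abs_le_of_sq_le_sq (by rw [e2, one_pow]; exact hst) zero_le_one)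
  have n3 := norm_sub_norm_le z1 z2
  rw [← norm_neg (z1 - z2), neg_sub] at n3
  rw [← e3]
  have : ρ ≤ ‖z2 - z1‖ := by linarith
  gcongr

lemma treasure_mem_interior (i j : Fin D.N) : D.treasure i j ∈ interior D.terrain.carrier := by
  refine interior_mono (closedBall_treasure_subset i j) ?_
  exact Metric.ball_subset_interior_closedBall (Metric.mem_ball_self D.lam_pos)

lemma accessibility_treasure (h1 : D.lam ≤ 1) (i j : Fin D.N) :
    D.terrain.accessibility (D.treasure i j) = D.lam := by
  refine IsGreatest.csSup_eq ⟨⟨D.lam_pos.le, h1, closedBall_treasure_subset i j⟩, ?_⟩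
  rintro r ⟨hr0, -, hr⟩
  by_contra hlt
  push Not at hlt
  obtain ⟨f, -, hf⟩ := D.ball_subset_obstacle (i, j, 1)
  -- the easternmost vertex of the western disc of the cluster
  have e : D.center (i, j, 1) + D.radius (i, j, 1) = D.treasure i j - D.lam := by
    apply Complex.ext
    · simp [center, radius, treasure, clusterOffset, clusterRadius]; ring
    · simp [center, radius, treasure, clusterOffset]
  rw [e, ← ConvexPolygon.closure_inner, Metric.mem_closure_iff] at hf
  obtain ⟨z, hz, hdz⟩ := hf (r - D.lam) (by linarith)
  have hzr : z ∈ Metric.closedBall (D.treasure i j) r := by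
    rw [Metric.mem_closedBall]
    have h2 := dist_triangle z (D.treasure i j - D.lam) (D.treasure i j)
    rw [dist_comm z (D.treasure i j - D.lam), dist_self_sub_left, Complex.norm_real,
      Real.norm_of_nonneg D.lam_pos.le] at h2
    linarith
  exact (D.terrain.mem_carrier.1 (hr hzr)).2 f hz

/-- The center of a cluster is seen only from nearby. -/
lemma dist_le_of_sees {x : ℂ} {i j : Fin D.N} (h : D.terrain.Sees x (D.treasure i j)) :
    dist x (D.treasure i j) ≤ 10 * D.lam := by
  by_contra hlt
  push Not at hlt
  have hl := D.lam_pos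
  set w := x - D.treasure i j with hw
  have hwn : 10 * D.lam < ‖w‖ := by rwa [hw, ← dist_eq_norm]
  have hwpos : 0 < ‖w‖ := by linarith
  have hw2 : w.re ^ 2 + w.im ^ 2 = ‖w‖ ^ 2 := by
    rw [← Complex.normSq_eq_norm_sq, Complex.normSq_apply]; ring
  obtain ⟨m, hm1, hm2⟩ := exists_blocking_disc w.re w.im (by rw [hw2]; positivity)
  obtain ⟨f, hf, -⟩ := D.ball_subset_obstacle (i, j, m)
  obtain ⟨ho1, ho2⟩ := abs_offset_le m
  set a := ((clusterOffset m).1 : ℝ) with ha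
  set b := ((clusterOffset m).2 : ℝ) with hb
  -- the foot of the perpendicular from the center of the disc to the line of sight
  set t := D.lam * (a * w.re + b * w.im) / ‖w‖ ^ 2 with ht
  have ht0 : 0 ≤ t := by positivity
  have ht1 : t ≤ 1 := by
    rw [ht, div_le_one (by positivity)]
    have h1 : a * w.re ≤ 5 * ‖w‖ := by
      refine (le_abs_self _).trans ?_
      rw [abs_mul]
      exact mul_le_mul ho1 (Complex.abs_re_le_norm w) (abs_nonneg _) (by norm_num)
    have h2 : b * w.im ≤ 5 * ‖w‖ := by
      refine (le_abs_self _).trans ?_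
      rw [abs_mul]
      exact mul_le_mul ho2 (Complex.abs_im_le_norm w) (abs_nonneg _) (by norm_num)
    nlinarith
  have hmem : D.treasure i j + t • w ∈ D.terrain.carrier := by
    apply h.1
    rw [segment_symm, segment_eq_image']
    exact ⟨t, ⟨ht0, ht1⟩, rfl⟩
  refine (D.terrain.mem_carrier.1 hmem).2 f (hf ?_)
  rw [Metric.mem_ball, dist_eq_norm]
  have hρ : 0 < D.radius (i, j, m) := D.radius_pos _
  refine lt_of_pow_lt_pow_left₀ 2 (by positivity) ?_
  rw [← Complex.normSq_eq_norm_sq, Complex.normSq_apply]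
  have er : (D.treasure i j + t • w - D.center (i, j, m)).re = t * w.re - D.lam * a := by
    simp [treasure, center, ← ha]
  have ei : (D.treasure i j + t • w - D.center (i, j, m)).im = t * w.im - D.lam * b := by
    simp [treasure, center, ← hb]
  rw [er, ei, radius]
  have hperp : (t * w.re - D.lam * a) * (t * w.re - D.lam * a)
      + (t * w.im - D.lam * b) * (t * w.im - D.lam * b)
      = D.lam ^ 2 * (a * w.im - b * w.re) ^ 2 / ‖w‖ ^ 2 := by
    rw [ht, ← hw2]
    have : w.re ^ 2 + w.im ^ 2 ≠ 0 := by rw [hw2]; positivity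
    field_simp
    ring
  rw [hperp, div_lt_iff₀ (by positivity), ← hw2]
  have := mul_lt_mul_of_pos_left hm2 (pow_pos hl 2)
  calc _ < _ := this
    _ = _ := by ring

lemma treasure_separated {i i' j j' : Fin D.N} (h : (i, j) ≠ (i', j')) :
    30 * D.lam ≤ dist (D.treasure i j) (D.treasure i' j') := by
  apply le_dist_of_coord
  have hij : (i : ℕ) ≠ i' ∨ (j : ℕ) ≠ j' := by
    by_contra hcon
    push Not at hcon
    exact h (Prod.ext (Fin.ext hcon.1) (Fin.ext hcon.2))
  rcases array_index_gap hij (s := 0) (s' := 0) (t := 0) (t' := 0) (M := 0) (by simp) (by simp)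
    D.lam_pos.le with h1 | h1
  · left
    refine le_trans (by linarith) (h1.trans (le_of_eq ?_))
    simp only [treasure]; congr 1; ring
  · right
    refine le_trans (by linarith) (h1.trans (le_of_eq ?_))
    simp only [treasure]; congr 1; ring

end ClusterArray

/-! ### The paths to the possible locations of the treasure -/

namespace ClusterArray

variable {D : ClusterArray}

lemma localPoint_lineMap (i j : Fin D.N) (s t s' t' u : ℝ) :
    D.localPoint i j s t + u • (D.localPoint i j s' t' - D.localPoint i j s t)
      = D.localPoint i j (s + u * (s' - s)) (t + u * (t' - t)) := by
  apply Complex.ext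
  · simp [localPoint]; ring
  · simp [localPoint]; ring

lemma dist_localPoint_le (i j : Fin D.N) (s t s' t' : ℝ) :
    dist (D.localPoint i j s t) (D.localPoint i j s' t') ≤ D.lam * (|s - s'| + |t - t'|) := by
  rw [dist_eq_norm]
  refine (Complex.norm_le_abs_re_add_abs_im _).trans (le_of_eq ?_)
  simp only [localPoint, Complex.sub_re, Complex.sub_im, add_sub_add_left_eq_sub, ← mul_sub,
    abs_mul, abs_of_pos D.lam_pos]
  ring

/-- The strip to the left of the array is free. -/
lemma mem_terrain_of_re_eq_zero {z : ℂ} (h : z.re = 0) (h' : |z.im| ≤ 45 * D.lam * (D.N + 1)) :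
    z ∈ D.terrain.carrier := by
  have hl := D.lam_pos
  have hℓ := D.ℓ_pos
  refine D.mem_terrain (D.norm_le_extent (by rw [h, abs_zero]; positivity) h') fun x => ?_
  refine le_dist_of_coord (Or.inl ?_)
  have hr := D.radius_le x
  obtain ⟨b1, -⟩ := abs_offset_le x.2.2
  rw [abs_le] at b1
  have hi0 : (0 : ℝ) ≤ ((x.1 : ℕ) : ℝ) := Nat.cast_nonneg _
  rw [h, zero_sub, abs_neg]
  refine le_trans ?_ (le_abs_self _)
  simp only [center]
  nlinarith [mul_nonneg hl.le hi0, mul_le_mul_of_nonneg_left b1.1 hl.le]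

/-- The corridors between the rows of the array are free. -/
lemma mem_terrain_of_corridor {z : ℂ} (j : Fin D.N) (h : z.im = 30 * D.lam * j + D.lam * 15)
    (h' : |z.re| ≤ D.ℓ + 45 * D.lam * (D.N + 1)) : z ∈ D.terrain.carrier := by
  have hl := D.lam_pos
  have hj : ((j : ℕ) : ℝ) + 1 ≤ D.N := by exact_mod_cast j.2
  have hj0 : (0 : ℝ) ≤ ((j : ℕ) : ℝ) := Nat.cast_nonneg _
  refine D.mem_terrain (D.norm_le_extent h' ?_) fun x => ?_
  · rw [h, abs_of_nonneg (by positivity)]; nlinarith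
  refine le_dist_of_coord (Or.inr ?_)
  have hr := D.radius_le x
  obtain ⟨-, b2⟩ := abs_offset_le x.2.2
  rw [h]
  simp only [center]
  by_cases hjj : (j : ℕ) = x.2.1
  · rw [hjj, add_sub_add_left_eq_sub, ← mul_sub]
    rw [abs_le] at b2
    refine le_trans ?_ (le_abs_self _)
    nlinarith
  · have := lattice_gap hjj (u := 15) (M := 20)
      ((abs_sub _ _).trans (add_le_add_right b2 _) |>.trans
      (by norm_num)) hl.le
    linarith

lemma zero_mem_terrain : (0 : ℂ) ∈ D.terrain.carrier := by
  have hl := D.lam_pos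
  exact mem_terrain_of_re_eq_zero rfl (by simp only [Complex.zero_im, abs_zero]; positivity)

lemma le_pathDist (i j : Fin D.N) : D.ℓ ≤ D.terrain.pathDist 0 (D.treasure i j) := by
  refine le_trans ?_ (Terrain.dist_le_pathDist zero_mem_terrain
    (interior_subset (treasure_mem_interior i j)))
  refine le_dist_of_coord (Or.inl ?_)
  have hl := D.lam_pos
  rw [Complex.zero_re, zero_sub, abs_neg]
  refine le_trans ?_ (le_abs_self _)
  simp only [treasure]
  have : 0 ≤ 30 * D.lam * (((i : ℕ) : ℝ) + 1) := by positivity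
  linarith

/-- A path to the treasure: along the left edge of the array to the corridor above the row `j`,
along this corridor, down between two columns, and into the cluster. -/
lemma pathDist_le (i j : Fin D.N) :
    D.terrain.pathDist 0 (D.treasure i j) ≤ D.ℓ + 60 * D.lam * (D.N + 1) := by
  have hl := D.lam_pos
  have hℓ := D.ℓ_pos
  have hi : ((i : ℕ) : ℝ) + 1 ≤ D.N := by exact_mod_cast i.2
  have hj : ((j : ℕ) : ℝ) + 1 ≤ D.N := by exact_mod_cast j.2
  have hi0 : (0 : ℝ) ≤ ((i : ℕ) : ℝ) := Nat.cast_nonneg _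
  have hj0 : (0 : ℝ) ≤ ((j : ℕ) : ℝ) := Nat.cast_nonneg _
  set Y := 30 * D.lam * j + D.lam * 15 with hY
  set X := D.ℓ + 30 * D.lam * (i + 1) + D.lam * 15 with hX
  have hY0 : 0 ≤ Y := by positivity
  have hX0 : 0 ≤ X := by positivity
  have hY1 : Y ≤ 30 * D.lam * D.N - 15 * D.lam := by nlinarith
  have hX1 : X ≤ D.ℓ + 30 * D.lam * D.N + 15 * D.lam := by nlinarith
  set A : ℂ := ⟨0, Y⟩ with hA
  set B := D.localPoint i j 15 15 with hB
  have s1 : segment ℝ 0 A ⊆ D.terrain.carrier := by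
    refine segment_subset_iff_lineMap.2 fun s h0 h1 => mem_terrain_of_re_eq_zero (by simp [hA]) ?_
    have : (0 + s • (A - 0)).im = s * Y := by simp [hA]
    rw [this, abs_of_nonneg (by positivity)]
    nlinarith
  have s2 : segment ℝ A B ⊆ D.terrain.carrier := by
    refine segment_subset_iff_lineMap.2 fun s h0 h1 => mem_terrain_of_corridor j ?_ ?_
    · simp [hA, hB, localPoint, hY]
    · have : (A + s • (B - A)).re = s * X := by simp [hA, hB, localPoint, hX]
      rw [this, abs_of_nonneg (by positivity)]
      have : s * X ≤ X := by nlinarith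
      nlinarith
  have hρ : ∀ m, (clusterRadius m : ℝ) ≤ 3 := fun m => by
    exact_mod_cast (clusterRadius_bounds m).2
  have s3 : segment ℝ B (D.localPoint i j 15 (3 / 2)) ⊆ D.terrain.carrier := by
    refine segment_subset_iff_lineMap.2 fun s h0 h1 => ?_
    rw [localPoint_lineMap]
    refine mem_terrain_of_local (by rw [abs_le]; constructor <;> linarith)
      (by rw [abs_le]; constructor <;> linarith) fun m => Or.inl ?_
    obtain ⟨b1, -⟩ := abs_offset_le m
    rw [abs_le] at b1
    exact le_trans (by linarith [hρ m]) (le_abs_self _)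
  have s4 : segment ℝ (D.localPoint i j 15 (3 / 2)) (D.localPoint i j (3 / 2) (3 / 2))
      ⊆ D.terrain.carrier := by
    refine segment_subset_iff_lineMap.2 fun s h0 h1 => ?_
    rw [localPoint_lineMap]
    refine mem_terrain_of_local (by rw [abs_le]; constructor <;> linarith)
      (by rw [abs_le]; constructor <;> linarith) fun m => ?_
    rcases clusterOffset_corridor m with h | h
    · right; left
      have h2 : (2 : ℝ) * clusterRadius m ≤ |3 - 2 * ((clusterOffset m).2 : ℝ)| := by
        exact_mod_cast h
      rw [show (3 : ℝ) - 2 * ((clusterOffset m).2 : ℝ)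
        = 2 * (3 / 2 + s * (3 / 2 - 3 / 2) - (clusterOffset m).2) by ring, abs_mul, abs_two] at h2
      linarith
    · left
      have h2 : (2 : ℝ) * clusterRadius m ≤ 3 - 2 * ((clusterOffset m).1 : ℝ) := by
        exact_mod_cast h
      exact le_trans (by linarith) (le_abs_self _)
  have s5 : segment ℝ (D.localPoint i j (3 / 2) (3 / 2)) (D.treasure i j)
      ⊆ D.terrain.carrier := by
    rw [treasure_eq]
    refine segment_subset_iff_lineMap.2 fun s h0 h1 => ?_
    rw [localPoint_lineMap]
    refine mem_terrain_of_local (by rw [abs_le]; constructor <;> linarith)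
      (by rw [abs_le]; constructor <;> linarith) fun m => Or.inr (Or.inr ?_)
    exact clusterOffset_diagonal m (by linarith) (by linarith)
  refine (Terrain.pathDist_le (l := [A, B, D.localPoint i j 15 (3 / 2),
    D.localPoint i j (3 / 2) (3 / 2), D.treasure i j])
    (ℓ := dist 0 A + dist A B + dist B (D.localPoint i j 15 (3 / 2)) +
      dist (D.localPoint i j 15 (3 / 2)) (D.localPoint i j (3 / 2) (3 / 2)) +
      dist (D.localPoint i j (3 / 2) (3 / 2)) (D.treasure i j))
    ⟨s1, s2, s3, s4, s5, rfl, by ring⟩).trans ?_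
  have d1 : dist 0 A ≤ Y := by
    rw [dist_eq_norm]
    refine (Complex.norm_le_abs_re_add_abs_im _).trans (le_of_eq ?_)
    simp [hA, abs_of_nonneg hY0]
  have d2 : dist A B ≤ X := by
    rw [dist_eq_norm]
    refine (Complex.norm_le_abs_re_add_abs_im _).trans (le_of_eq ?_)
    have e1 : (A - B).re = -X := by simp [hA, hB, localPoint, hX]
    have e2 : (A - B).im = 0 := by simp [hA, hB, localPoint, hY]
    rw [e1, e2, abs_neg, abs_of_nonneg hX0, abs_zero, add_zero]
  have d3 := dist_localPoint_le i j 15 15 15 (3 / 2)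
  have d4 := dist_localPoint_le i j 15 (3 / 2) (3 / 2) (3 / 2)
  have d5 := dist_localPoint_le i j (3 / 2) (3 / 2) 0 0
  rw [← treasure_eq] at d5
  norm_num at d3 d4 d5
  linarith

end ClusterArray

/-! ### Counting advice strings -/

/-- A binary string, read as the natural number with these binary digits and an additional leading
digit `1`. -/
def stringCode (s : List Bool) : ℕ := s.foldr (fun b n => (bif b then 1 else 0) + 2 * n) 1

lemma stringCode_pos (s : List Bool) : 0 < stringCode s := by
  induction s with
  | nil => exact one_pos
  | cons b s ih =>
    change 0 < (bif b then 1 else 0) + 2 * stringCode s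
    omega

lemma stringCode_lt (s : List Bool) : stringCode s < 2 ^ (s.length + 1) := by
  induction s with
  | nil => exact one_lt_two
  | cons b s ih =>
    change (bif b then 1 else 0) + 2 * stringCode s < 2 ^ (s.length + 1 + 1)
    rw [pow_succ]
    cases b <;> simp <;> omega

lemma stringCode_injective : Function.Injective stringCode := by
  intro s
  induction s with
  | nil =>
    intro s' h
    rcases s' with _ | ⟨b, s'⟩
    · rfl
    · change 1 = (bif b then 1 else 0) + 2 * stringCode s' at h
      have := stringCode_pos s'
      omega
  | cons b s ih =>
    intro s' h
    rcases s' with _ | ⟨b', s'⟩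
    · change (bif b then 1 else 0) + 2 * stringCode s = 1 at h
      have := stringCode_pos s
      omega
    · change (bif b then 1 else 0) + 2 * stringCode s
        = (bif b' then 1 else 0) + 2 * stringCode s' at h
      have hbb : b = b' ∧ stringCode s = stringCode s' := by
        cases b <;> cases b' <;> simp at h ⊢ <;> omega
      rw [hbb.1, ih hbb.2]

namespace ClusterArray

variable {D : ClusterArray}

/-- With one advice string, an agent that travels a distance at most `B` sees at most
`B / (10 lam) + 1` of the possible locations of the treasure. Hence, if for each of the `N²`
locations there is a successful string of length at most `b`, then `N²` is at most the number of
these strings times this bound. -/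
theorem card_le_of_finds (A : Strategy) {B b : ℝ} (hB : 0 ≤ B)
    (h : ∀ i j : Fin D.N, ∃ s : List Bool, (s.length : ℝ) ≤ b ∧
      D.terrain.Finds 0 (D.treasure i j) A s B) :
    (D.N : ℝ) ^ 2 ≤ 2 * (2 : ℝ) ^ b * (B / (10 * D.lam) + 1) := by
  have hl := D.lam_pos
  choose s hs hf using h
  choose σ γ hrun n t ht0 ht hsees hcost using hf
  set τ : Fin D.N → Fin D.N → ℝ := fun i j =>
    (∑ m ∈ Finset.range (n i j), (σ i j (m + 1)).travelled) + t i j with hτ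
  have hτ0 : ∀ i j, 0 ≤ τ i j := fun i j =>
    add_nonneg (Finset.sum_nonneg fun m _ => ((hrun i j).2 m).lipschitz.1) (ht0 i j)
  set S := ⌊2 * (2 : ℝ) ^ b⌋₊ with hS
  set F := ⌊B / (10 * D.lam)⌋₊ + 1 with hF
  have hcode : ∀ i j, stringCode (s i j) < S + 1 := by
    intro i j
    rw [Nat.lt_succ_iff]
    refine Nat.le_floor ?_
    have h1 : (stringCode (s i j) : ℝ) ≤ 2 ^ ((s i j).length + 1) := by
      exact_mod_cast (stringCode_lt (s i j)).le
    refine h1.trans ?_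
    rw [pow_succ, mul_comm, ← Real.rpow_natCast]
    gcongr
    · norm_num
    · exact hs i j
  have hfloor : ∀ i j, ⌊τ i j / (10 * D.lam)⌋₊ < F := by
    intro i j
    rw [hF, Nat.lt_succ_iff]
    exact Nat.floor_mono (by gcongr; exact hcost i j)
  -- the code `0` is not the code of a string
  set f : Fin D.N × Fin D.N → Fin S × Fin F := fun x =>
    (⟨stringCode (s x.1 x.2) - 1, by
      have := hcode x.1 x.2; have := stringCode_pos (s x.1 x.2); omega⟩,
      ⟨⌊τ x.1 x.2 / (10 * D.lam)⌋₊, hfloor x.1 x.2⟩) with hfdef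
  have hinj : Function.Injective f := by
    rintro ⟨i, j⟩ ⟨i', j'⟩ heq
    by_contra hne
    simp only [hfdef, Prod.mk.injEq, Fin.mk.injEq] at heq
    obtain ⟨h1, h2⟩ := heq
    have hss : s i j = s i' j' := by
      apply stringCode_injective
      have := stringCode_pos (s i j); have := stringCode_pos (s i' j')
      omega
    have hrun' := hrun i' j'
    rw [← hss] at hrun'
    obtain ⟨hσ, hγ⟩ := (hrun i j).unique hrun'
    have ht' := ht i' j'
    rw [← hσ] at ht'
    have hd := (hrun i j).dist_le (ht0 i j) (ht i j) (ht0 i' j') ht'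
    have hτ' : τ i' j' = (∑ m ∈ Finset.range (n i' j'), (σ i j (m + 1)).travelled) + t i' j' := by
      rw [hτ, hσ]
    rw [← hτ'] at hd
    have hlt : |τ i j - τ i' j'| < 10 * D.lam := by
      have a1 := Nat.floor_le (div_nonneg (hτ0 i j) (by positivity : 0 ≤ 10 * D.lam))
      have a2 := Nat.lt_floor_add_one (τ i j / (10 * D.lam))
      have b1 := Nat.floor_le (div_nonneg (hτ0 i' j') (by positivity : 0 ≤ 10 * D.lam))
      have b2 := Nat.lt_floor_add_one (τ i' j' / (10 * D.lam))
      rw [h2] at a1 a2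
      have h3 : |τ i j / (10 * D.lam) - τ i' j' / (10 * D.lam)| < 1 := by
        rw [abs_lt]; constructor <;> linarith
      rwa [← sub_div, abs_div, abs_of_pos (by positivity : 0 < 10 * D.lam),
        div_lt_one (by positivity)] at h3
    have hs1 := dist_le_of_sees (hsees i j)
    have hs2 := dist_le_of_sees (hsees i' j')
    rw [← hγ] at hs2
    have hsep := treasure_separated hne
    have htri := dist_triangle4 (D.treasure i j) (γ i j (n i j) (t i j))
      (γ i j (n i' j') (t i' j')) (D.treasure i' j')
    rw [dist_comm (D.treasure i j) (γ i j (n i j) (t i j))] at htri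
    have : dist (γ i j (n i j) (t i j)) (γ i j (n i' j') (t i' j')) < 10 * D.lam := hd.trans_lt hlt
    linarith
  have hcard := Fintype.card_le_of_injective f hinj
  simp only [Fintype.card_prod, Fintype.card_fin] at hcard
  have hcard' : (D.N : ℝ) ^ 2 ≤ S * F := by
    rw [sq]; exact_mod_cast hcard
  refine hcard'.trans ?_
  have h1 : (S : ℝ) ≤ 2 * (2 : ℝ) ^ b := Nat.floor_le (by positivity)
  have h2 : (F : ℝ) ≤ B / (10 * D.lam) + 1 := by
    rw [hF]; push_cast
    have := Nat.floor_le (div_nonneg hB (by positivity : 0 ≤ 10 * D.lam))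
    linarith
  gcongr

end ClusterArray

/-! ### The lower bound -/

lemma Terrain.Finds.mono {T : Terrain} {p q : ℂ} {A : Strategy} {s : List Bool} {B B' : ℝ}
    (h : T.Finds p q A s B) (hB : B ≤ B') : T.Finds p q A s B' := by
  obtain ⟨σ, γ, h1, n, t, h2, h3, h4, h5⟩ := h
  exact ⟨σ, γ, h1, n, t, h2, h3, h4, h5.trans hB⟩

/-- For large `X`, the number `(X / 100)²` of locations exceeds the number of locations that are
found at cost `O(X)` with `O(√X)` advice strings. -/
lemma counting_bound {C X N : ℝ} (hC : 0 ≤ C) (hX : (160000 * (C + 1)) ^ 2 < X)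
    (hN : X / 100 - 1 ≤ N)
    (h : N ^ 2 ≤ 2 * Real.sqrt (2 * X) * (C * (2 * X) / 10 + 1)) : False := by
  have hX1 : 160000 < X := by nlinarith
  set r := Real.sqrt X with hr
  have hr2 : r ^ 2 = X := Real.sq_sqrt (by linarith)
  have hr0 : 0 ≤ r := Real.sqrt_nonneg X
  have hs : Real.sqrt (2 * X) ≤ 2 * r := by
    rw [Real.sqrt_le_left (by linarith), mul_pow, hr2]; linarith
  have hN2 : (X / 200) ^ 2 ≤ N ^ 2 := by
    have : X / 200 ≤ N := by linarith
    gcongr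
  have h1 : 2 * Real.sqrt (2 * X) * (C * (2 * X) / 10 + 1) ≤ 2 * (2 * r) * ((C + 1) * X) := by
    have : C * (2 * X) / 10 + 1 ≤ (C + 1) * X := by nlinarith
    gcongr
  have h2 : X * X ≤ X * (160000 * (C + 1) * r) := by nlinarith
  have h3 : X ≤ 160000 * (C + 1) * r := le_of_mul_le_mul_left h2 (by linarith)
  have hrpos : 0 < r := Real.sqrt_pos.2 (by linarith)
  rw [← hr2, sq] at h3
  have h4 : r ≤ 160000 * (C + 1) := le_of_mul_le_mul_right h3 hrpos
  have h5 : r ^ 2 ≤ (160000 * (C + 1)) ^ 2 := by gcongr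
  linarith

/-- Advice of logarithmic size is necessary. -/
theorem exists_terrain_requiring_advice {c : ℝ} (hc : 1 < c) (C : ℝ) :
    ∃ ℓ₀ : ℝ, ∀ ℓ : ℝ, ℓ₀ ≤ ℓ → ∀ lam : ℝ, 0 < lam → lam ≤ 1 →
      ∃ T : Terrain, T.IsRegular c ∧ ∃ p ∈ T.carrier, ∀ A : Strategy,
        ∃ q ∈ interior T.carrier,
          T.accessibility q = lam ∧ ℓ ≤ T.pathDist p q ∧ T.pathDist p q ≤ 2 * ℓ ∧
          ∀ s : List Bool, T.Finds p q A s (C * T.pathDist p q) →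
            1 / 2 * Real.logb 2 (T.pathDist p q / lam) ≤ (s.length : ℝ) := by
  have hc0 : 0 < c := by linarith
  obtain ⟨n, hn, hcos⟩ := exists_cos_pi_div_ge (δ := max (1 / c) (99 / 100))
    (max_lt ((div_lt_one hc0).2 hc) (by norm_num))
  refine ⟨(160000 * (|C| + 1)) ^ 2 + 1, fun ℓ hℓ lam hlam hlam1 => ?_⟩
  have hC := abs_nonneg C
  have hℓ1 : 160000 < ℓ := by nlinarith
  set X := ℓ / lam with hX
  have hℓX : ℓ ≤ X := by rw [hX, le_div_iff₀ hlam]; nlinarith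
  have hXlam : X * lam = ℓ := div_mul_cancel₀ _ hlam.ne'
  let D : ClusterArray :=
    { n := n
      N := ⌊X / 100⌋₊
      ℓ := ℓ
      lam := lam
      three_le := hn
      cos_ge := (le_max_right _ _).trans hcos
      ℓ_pos := by linarith
      lam_pos := hlam }
  have hN1 : (D.N : ℝ) ≤ X / 100 := Nat.floor_le (by linarith)
  have hN2 : X / 100 - 1 ≤ D.N := by
    have : X / 100 < (D.N : ℝ) + 1 := Nat.lt_floor_add_one (X / 100)
    linarith
  refine ⟨D.terrain, D.terrain_isRegular hc0 ((le_max_left _ _).trans hcos), 0,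
    ClusterArray.zero_mem_terrain, fun A => ?_⟩
  have hup : ∀ i j : Fin D.N, D.terrain.pathDist 0 (D.treasure i j) ≤ 2 * ℓ := by
    intro i j
    have h1 : D.terrain.pathDist 0 (D.treasure i j) ≤ ℓ + 60 * lam * (D.N + 1) :=
      ClusterArray.pathDist_le i j
    have h2 : lam * D.N ≤ lam * (X / 100) := by gcongr
    linarith
  have hlow : ∀ i j : Fin D.N, ℓ ≤ D.terrain.pathDist 0 (D.treasure i j) :=
    ClusterArray.le_pathDist
  by_contra hcon
  push Not at hcon
  refine counting_bound hC (by linarith : (160000 * (|C| + 1)) ^ 2 < X) hN2 ?_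
  have hcard := ClusterArray.card_le_of_finds (D := D) A (B := |C| * (2 * ℓ))
    (b := 1 / 2 * Real.logb 2 (2 * X)) (by positivity) fun i j => by
      obtain ⟨s, hs, hlen⟩ := hcon _ (ClusterArray.treasure_mem_interior i j)
        (ClusterArray.accessibility_treasure hlam1 i j) (hlow i j) (hup i j)
      have hpos : 0 < D.terrain.pathDist 0 (D.treasure i j) := by linarith [hlow i j]
      refine ⟨s, hlen.le.trans ?_, hs.mono ?_⟩
      · refine mul_le_mul_of_nonneg_left ?_ (by norm_num)
        refine Real.logb_le_logb_of_le one_lt_two (div_pos hpos hlam) ?_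
        rw [hX, ← mul_div_assoc]
        gcongr
        exact hup i j
      · exact mul_le_mul (le_abs_self C) (hup i j) hpos.le (abs_nonneg C)
  have hpow : (2 : ℝ) ^ (1 / 2 * Real.logb 2 (2 * X)) = Real.sqrt (2 * X) := by
    rw [mul_comm, Real.rpow_mul (by norm_num), Real.rpow_logb (by norm_num) (by norm_num)
      (by linarith), Real.sqrt_eq_rpow]
  have hB : |C| * (2 * ℓ) / (10 * D.lam) = |C| * (2 * X) / 10 := by
    change |C| * (2 * ℓ) / (10 * lam) = _
    rw [hX]; field_simp
  rwa [hpow, hB] at hcard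

theorem corollary2p1 (c : ℝ) (hc : 1 < c) :
    (∃ A : Strategy, A.IsComputable ∧ ∃ C K : ℝ,
      ∀ T : Terrain, T.IsRegular c → ∀ p ∈ T.carrier, ∀ q ∈ interior T.carrier,
        ∃ s : List Bool,
          (s.length : ℝ) ≤ K * Real.logb 2 (max (T.pathDist p q) 2 / T.accessibility q) ∧
          T.Finds p q A s (C * max (T.pathDist p q) 2)) ∧
    (∃ κ : ℝ, 0 < κ ∧ ∀ C : ℝ, ∃ ℓ₀ : ℝ, ∀ ℓ : ℝ, ℓ₀ ≤ ℓ → ∀ lam : ℝ, 0 < lam → lam ≤ 1 →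
      ∃ T : Terrain, T.IsRegular c ∧ ∃ p ∈ T.carrier, ∀ A : Strategy,
        ∃ q ∈ interior T.carrier,
          T.accessibility q = lam ∧ ℓ ≤ T.pathDist p q ∧ T.pathDist p q ≤ 2 * ℓ ∧
          ∀ s : List Bool, T.Finds p q A s (C * T.pathDist p q) →
            κ * Real.logb 2 (T.pathDist p q / lam) ≤ (s.length : ℝ)) :=
  ⟨⟨zigzagStrategy, isComputable_zigzagStrategy, 10 + 544 * c ^ 2, 40, fun _ hT _ hp _ hq =>
      zigzagStrategy_finds (by linarith) hT hp hq⟩,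
    1 / 2, by norm_num, exists_terrain_requiring_advice hc⟩
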